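/- Let $T>0$ and $\Omega_T=(0,1)\times(0,T)$. For $a\ge 0$, $1<p<\infty$ and an open interval $I$ let $H^{a,p}(I)$ be the space of restrictions to $I$ of elements of the Bessel potential space $H^{a,p}(\mathbb R)$ (complex-valued), with the quotient norm; let $H^a(I)=H^{a,2}(I)$, and let $H^a_0(I)$ be the closure of $C_c^\infty(I)$ in $H^a(I)$, with the norm of $H^a(I)$. For $h$ on $(0,T)$ and $t\in[0,T]$ put $$ (W_{2,N}h)(x,t)=\sum_{k=1}^\infty(-2ik\pi)\int_0^t e^{i(k\pi)^4(t-\tau)}h(\tau)\,d\tau\,\sin(k\pi x),\qquad 0<x<1 . $$ (1) There is a constant $C_T>0$ depending only on $T$ such that for every $h\in H^{1/4}(0,T)$ the series converges in $L^2(0,1)$ for every $t\in[0,T]$, its sum $u=W_{2,N}h$ belongs to $L^4(\Omega_T)\cap C([0,T];L^2(0,1))$, and $$ \|u\|_{L^4(\Omega_T)}\le C_T\|h\|_{H^{1/4}(0,T)},\qquad \sup_{0\le t\le T}\|u(\cdot,t)\|_{L^2(0,1)}\le C_T\|h\|_{H^{1/4}(0,T)} . $$ (2) For every real $s\in[0,4]$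 there is a constant $C>0$ depending only on $s$ and $T$ such that for every $h\in H_0^{(1+s)/4}(0,T)$ the function $u=W_{2,N}h$ has $x$-regularity of order $s$ in $L^4(\Omega_T)\cap C([0,T];L^2(0,1))$, that is, $u\in L^4(0,T;H^{s,4}(0,1))\cap C([0,T];H^s(0,1))$, and $$ \|u\|_{L^4(0,T;H^{s,4}(0,1))}\le C\|h\|_{H^{(1+s)/4}(0,T)},\qquad \sup_{0\le t\le T}\|u(\cdot,t)\|_{H^s(0,1)}\le C\|h\|_{H^{(1+s)/4}(0,T)} . $$ If $s$ is an integer, then, moreover, the weak derivative $\partial_x^su$ on $(0,1)$ belongs to $L^4(\Omega_T)\cap C([0,T];L^2(0,1))$ and $$ \|\partial_x^su\|_{L^4(\Omega_T)}\le C\|h\|_{H^{(1+s)/4}(0,T)},\qquad \sup_{0\le t\le T}\|\partial_x^su(\cdot,t)\|_{L^2(0,1)}\le C\|h\|_{H^{(1+s)/4}(0,T)} . $$ -/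

import Mathlib

open MeasureTheory Set Filter Topology
open scoped ENNReal ContDiff SchwartzMap

noncomputable section

namespace NavierBoundary

instance factOneLeFour : Fact ((1 : ℝ≥0∞) ≤ 4) := ⟨by norm_num⟩

/-- The norm of the Sobolev (Bessel potential) space `H^{s,p}(I)`, `s ≥ 0`, of restrictions to `I`
of elements of `H^{s,p}(ℝ)`: the infimum of `‖F‖_{H^{s,p}(ℝ)} = ‖g‖_{L^p(ℝ)}`, with
`g = (1 - (2π)⁻² ∂²)^{s/2} F`, over all `F` in `H^{s,p}(ℝ)` that agree with `f` a.e. on `I`.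
It is `⊤` if there is no such `F`, that is, if `f` is not in `H^{s,p}(I)`. -/
def sobolevENorm (s : ℝ) (p : ℝ≥0∞) [Fact (1 ≤ p)] (I : Set ℝ) (f : ℝ → ℂ) : ℝ≥0∞ :=
  ⨅ (F : Lp ℂ p (volume : Measure ℝ)) (g : Lp ℂ p (volume : Measure ℝ))
    (_ : F =ᵐ[volume.restrict I] f)
    (_ : TemperedDistribution.besselPotential ℝ ℂ s (F : 𝓢'(ℝ, ℂ)) = (g : 𝓢'(ℝ, ℂ))), ‖g‖ₑ

/-- Membership in `H^s(I) = H^{s,2}(I)`. -/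
def MemHs (s : ℝ) (I : Set ℝ) (f : ℝ → ℂ) : Prop :=
  sobolevENorm s 2 I f < ⊤

/-- Membership in `H_0^s(I)`, the closure of `C_c^∞(I)` in `H^s(I)`. -/
def MemHsZero (s : ℝ) (I : Set ℝ) (f : ℝ → ℂ) : Prop :=
  MemHs s I f ∧ ∀ ε : ℝ≥0∞, 0 < ε → ∃ φ : ℝ → ℂ, ContDiff ℝ ∞ φ ∧ HasCompactSupport φ ∧
    tsupport φ ⊆ I ∧ sobolevENorm s 2 I (fun t => f t - φ t) < ε

/-- The space `L²(0,1)` of complex-valued functions. -/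
abbrev L2 : Type := Lp ℂ 2 (volume.restrict (Ioo (0 : ℝ) 1))

theorem memLp_sin (k : ℕ) :
    MemLp (fun x : ℝ => (Real.sin (k * Real.pi * x) : ℂ)) 2 (volume.restrict (Ioo (0 : ℝ) 1)) := by
  refine MemLp.of_bound (C := 1) (by fun_prop) (ae_of_all _ fun x => ?_)
  rw [Complex.norm_real]
  exact Real.abs_sin_le_one _

/-- The function `x ↦ sin(kπx)` in `L²(0,1)`. -/
def sinL2 (k : ℕ) : L2 := (memLp_sin k).toLp _

/-- The coefficient `-2ikπ ∫₀ᵗ e^{i(kπ)⁴(t-τ)} h(τ) dτ`. -/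
def coeffW2 (h : ℝ → ℂ) (t : ℝ) (k : ℕ) : ℂ :=
  -2 * Complex.I * k * Real.pi *
    ∫ τ in (0 : ℝ)..t, Complex.exp (Complex.I * (k * Real.pi) ^ 4 * (t - τ)) * h τ

/-- The boundary integral operator `W_{2,N}`: the value at time `t`, in `L²(0,1)`, of
`∑_{k ≥ 1} -2ikπ ∫₀ᵗ e^{i(kπ)⁴(t-τ)} h(τ) dτ sin(kπx)`. The sum is meaningful only where the
series converges in `L²(0,1)`. -/
def W2N (h : ℝ → ℂ) (t : ℝ) : L2 :=
  ∑' k : ℕ, coeffW2 h t (k + 1) • sinL2 (k + 1)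

/-- `v` is the weak derivative of order `m` of `f` on the interval `(0,1)`. -/
def IsWeakDeriv (m : ℕ) (f v : L2) : Prop :=
  ∀ φ : ℝ → ℂ, ContDiff ℝ ∞ φ → HasCompactSupport φ → tsupport φ ⊆ Ioo 0 1 →
    ∫ x in Ioo (0 : ℝ) 1, f x * iteratedDeriv m φ x =
      (-1) ^ m * ∫ x in Ioo (0 : ℝ) 1, v x * φ x

/-- The space-time domain `Ω_T = (0,1) × (0,T)`. -/
def Omega (T : ℝ) : Set (ℝ × ℝ) := Ioo 0 1 ×ˢ Ioo 0 T

/-- The curve `t ↦ U(t)` in `L²(0,1)` is, as a function of `(x,t)`, in `L⁴(Ω_T)`, with norm at most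
`B`. -/
def L4NormLE (T : ℝ) (U : ℝ → L2) (B : ℝ≥0∞) : Prop :=
  ∃ u : ℝ × ℝ → ℂ, MemLp u 4 (volume.restrict (Omega T)) ∧
    (∀ᵐ t ∂volume.restrict (Ioo 0 T),
      (fun x => u (x, t)) =ᵐ[volume.restrict (Ioo (0 : ℝ) 1)] U t) ∧
    eLpNorm u 4 (volume.restrict (Omega T)) ≤ B

/-- The curve `t ↦ U(t)` is in `L⁴(0,T; H^{s,4}(0,1))`, with norm at most `B < ⊤`. (The norm at time
`t` is dominated by a measurable function `g`, so that an upper integral is bounded.) -/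
def L4HsNormLE (s T : ℝ) (U : ℝ → L2) (B : ℝ≥0∞) : Prop :=
  ∃ g : ℝ → ℝ≥0∞, Measurable g ∧
    (∀ᵐ t ∂volume.restrict (Ioo 0 T), sobolevENorm s 4 (Ioo 0 1) (U t) ≤ g t) ∧
    (∫⁻ t in Ioo 0 T, g t ^ (4 : ℝ)) ^ (1 / 4 : ℝ) ≤ B

/-- The curve `t ↦ U(t)` is in `C([0,T]; H^s(0,1))`. -/
def ContinuousHs (s T : ℝ) (U : ℝ → L2) : Prop :=
  (∀ t ∈ Icc 0 T, MemHs s (Ioo 0 1) (U t)) ∧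
  ∀ t₀ ∈ Icc 0 T, Tendsto (fun t => sobolevENorm s 2 (Ioo 0 1) (fun x => U t x - U t₀ x))
    (𝓝[Icc 0 T] t₀) (𝓝 0)

end NavierBoundary

end

/-! Time side. Put σ = (1+s)/4 and ω_k = ((k+1)π)⁴. Extend h to F in H^σ(ℝ) with Bessel potential g
of norm at most twice that of h. Parseval on (0,t) writes the k-th coefficient as the amplitude
-2πi(k+1) times e^{iω_k t} ∫ (1+ξ²)^{-σ/2} ĝ(ξ) K(2πξ-ω_k, t) dξ, with K = `kern`. After
multiplication by (k+1)^s the amplitude has size (k+1)^{4σ}. For |2πξ| ≥ ω_k/2 it is absorbed by the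
Bessel weight, which leaves a density bounded by 8|ĝ|. For the other ξ the kernel is O(1/ω_k), and
for s ≤ 3/2 the contribution is O((k+1)^{-3/2}), which is summable (`exists_goodFamily_low`).

For s ≥ 3/2 the low frequencies are too large until the boundary term h(t)/(iω_k) of an integration
by parts is removed. The other boundary term, at time 0, vanishes because h is a limit of test
functions (`extVal_zero_eq_zero`). What is removed is h(t) times a constant multiple of (k+1)⁻³, and
∑ k⁻³ sin(kπx) is a cubic Bernoulli polynomial on [0,1], hence harmless in every norm
(`exists_goodFamily_high`, `hasSum_contVec_cubic`).

L⁴ estimate. For free solutions ∑ c_k e^{i(k+1)πx+iω_k t} the fourth power of the modulus is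
integrated over full periods. Only quadruples with a+b=c+d and a⁴+b⁴=c⁴+d⁴ survive, and these are
trivial, so the L⁴ norm is bounded by the ℓ² norm of c. Translating ξ by ω_k/2π exhibits the Duhamel
sum as a superposition over η of free solutions with the common kernel K(2πη,t). Cauchy-Schwarz,
Minkowski and the uniform bound for ∑_k (1+|y-ω_k|)^{-1/2}, a consequence of the separation of the
ω_k, conclude (`exists_lintegral_duhamel_le`). The same weights give a square-summable majorant
independent of t, whence convergence and continuity in L². Both facts are recorded in `GoodFamily`.

Space side. `Admissible` systems are those that turn such coefficients into functions in L² and in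
space-time L⁴. Sines are combinations of two exponentials. For the Sobolev norms, (k+1)^{-s}
sin((k+1)πx) is cut off to the line. The Bessel potential of χ e^{2πimx} is |m|^s χ e^{2πimx} up to
O(|m|^{s-1}) in L² and L⁴, so the potentials form an admissible system again, the errors O(1/k)
being square-summable (`exists_admissible_besselS_extSin`). Weak derivatives are taken term by term.
-/

noncomputable section

namespace NavierBoundary

open scoped FourierTransform

/-! ### Measurable representatives of curves in `L²` -/

/-- A curve in L² is given slice by slice, and joint measurability has to come from the
approximants. A rapidly convergent subsequence, chosen independently of t, converges a.e. on almost
every slice and so a.e. on the product. Fatou's lemma carries over the L^p bound, and no relation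
between p and 2 is needed. -/
theorem exists_slices {X : Type*} [MeasurableSpace X] {μ : Measure X} [SFinite μ] {ν : Measure ℝ}
    [SFinite ν] {p : ℝ≥0∞} {S : ℕ → X × ℝ → ℂ} (hS : ∀ n, StronglyMeasurable (S n))
    {U : ℝ → Lp ℂ 2 μ} {ε : ℕ → ℝ≥0∞} (hε : Tendsto ε atTop (𝓝 0))
    (hU : ∀ n, ∀ᵐ t ∂ν, eLpNorm ((fun x => S n (x, t)) - ⇑(U t)) 2 μ ≤ ε n) {B : ℝ≥0∞}
    (hB : ∀ n, eLpNorm (S n) p (μ.prod ν) ≤ B) :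
    ∃ u : X × ℝ → ℂ, StronglyMeasurable u ∧
      (∀ᵐ t ∂ν, (fun x => u (x, t)) =ᵐ[μ] U t) ∧ eLpNorm u p (μ.prod ν) ≤ B := by
  have hev : ∀ n : ℕ, ∃ N, ∀ k ≥ N, ε k ≤ (2⁻¹ : ℝ≥0∞) ^ n := fun n => by
    have : ∀ᶠ k in atTop, ε k < (2⁻¹ : ℝ≥0∞) ^ n :=
      hε.eventually_lt_const (ENNReal.pow_pos (by simp) n)
    obtain ⟨N, hN⟩ := eventually_atTop.1 this
    exact ⟨N, fun k hk => (hN k hk).le⟩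
  obtain ⟨φ, hφ, hφε⟩ := extraction_forall_of_eventually' hev
  have hSt : ∀ n t, StronglyMeasurable (fun x => S n (x, t)) := fun n t =>
    (hS n).comp_measurable measurable_prodMk_right
  have hall : ∀ᵐ t ∂ν, ∀ n, eLpNorm ((fun x => S n (x, t)) - ⇑(U t)) 2 μ ≤ ε n := ae_all_iff.2 hU
  have hlim : ∀ᵐ t ∂ν, ∀ᵐ x ∂μ, ∃ l : ℂ, Tendsto (fun n => S (φ n) (x, t)) atTop (𝓝 l) := by
    filter_upwards [hall] with t ht
    -- The triangle inequality through `U t` gives the factor 2; the factor 3 makes the inequality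
    -- strict.
    refine Lp.ae_tendsto_of_cauchy_eLpNorm (p := 2) (B := fun n => 3 * (2⁻¹ : ℝ≥0∞) ^ n)
      (fun n => (hSt (φ n) t).aestronglyMeasurable) (by norm_num) ?_ ?_
    · rw [ENNReal.tsum_mul_left, ENNReal.tsum_geometric]
      norm_num
    · intro N n m hn hm
      have key : ∀ j, N ≤ j → eLpNorm ((fun x => S (φ j) (x, t)) - ⇑(U t)) 2 μ ≤ (2⁻¹ : ℝ≥0∞) ^ N :=
        fun j hj => (ht (φ j)).trans ((hφε j).trans (pow_le_pow_right_of_le_one' (by simp) hj))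
      have hsub : ((fun x => S (φ n) (x, t)) - fun x => S (φ m) (x, t)) =
          ((fun x => S (φ n) (x, t)) - ⇑(U t)) - ((fun x => S (φ m) (x, t)) - ⇑(U t)) := by
        ext x; simp
      rw [hsub]
      refine (eLpNorm_sub_le ((hSt _ _).aestronglyMeasurable.sub (Lp.aestronglyMeasurable _))
        ((hSt _ _).aestronglyMeasurable.sub (Lp.aestronglyMeasurable _)) (by norm_num)).trans_lt ?_
      refine (add_le_add (key n hn) (key m hm)).trans_lt ?_
      rw [← two_mul]
      refine ENNReal.mul_lt_mul_left ?_ ?_ (by norm_num)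
      · exact (ENNReal.pow_pos (by simp) N).ne'
      · exact ENNReal.pow_ne_top (by simp)
  have hmeas : MeasurableSet {z : X × ℝ | ∃ l : ℂ, Tendsto (fun n => S (φ n) z) atTop (𝓝 l)} :=
    measurableSet_exists_tendsto fun n => (hS _).measurable
  have hprod : ∀ᵐ z ∂(μ.prod ν), ∃ l : ℂ, Tendsto (fun n => S (φ n) z) atTop (𝓝 l) := by
    -- Time is the second factor but the outer variable of `hlim`, so the product is swapped before
    -- Fubini.
    have h1 : ∀ᵐ z ∂(ν.prod μ), ∃ l : ℂ, Tendsto (fun n => S (φ n) z.swap) atTop (𝓝 l) := by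
      refine (Measure.ae_prod_iff_ae_ae (measurable_swap hmeas)).2 hlim
    have h2 := (Measure.measurePreserving_swap (μ := μ) (ν := ν)).quasiMeasurePreserving.ae h1
    simpa using h2
  obtain ⟨u, hu, hut⟩ := exists_stronglyMeasurable_limit_of_tendsto_ae
    (fun n => (hS (φ n)).aestronglyMeasurable) hprod
  refine ⟨u, hu, ?_, ?_⟩
  · have h3 : ∀ᵐ t ∂ν, ∀ᵐ x ∂μ, Tendsto (fun n => S (φ n) (x, t)) atTop (𝓝 (u (x, t))) := by
      have := (Measure.measurePreserving_swap (μ := ν) (ν := μ)).quasiMeasurePreserving.ae hut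
      exact Measure.ae_ae_of_ae_prod this
    filter_upwards [hall, h3] with t ht htu
    have hu0 : eLpNorm ((fun x => u (x, t)) - ⇑(U t)) 2 μ ≤ 0 := by
      refine (Lp.eLpNorm_lim_le_liminf_eLpNorm (f := fun n => (fun x => S (φ n) (x, t)) - ⇑(U t))
        (fun n => (hSt _ _).aestronglyMeasurable.sub (Lp.aestronglyMeasurable _)) _ ?_).trans ?_
      · filter_upwards [htu] with x hx
        exact hx.sub_const _
      · have : Tendsto (fun n => eLpNorm ((fun x => S (φ n) (x, t)) - ⇑(U t)) 2 μ) atTop (𝓝 0) :=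
          tendsto_of_tendsto_of_tendsto_of_le_of_le tendsto_const_nhds
            (hε.comp hφ.tendsto_atTop) (fun _ => zero_le) (fun n => ht (φ n))
        exact this.liminf_eq.le
    have := (eLpNorm_eq_zero_iff ((hu.comp_measurable
      measurable_prodMk_right).aestronglyMeasurable.sub (Lp.aestronglyMeasurable _))
      (by norm_num)).1 (le_antisymm hu0 zero_le)
    filter_upwards [this] with x hx
    exact sub_eq_zero.1 hx
  · refine (Lp.eLpNorm_lim_le_liminf_eLpNorm (fun n => (hS (φ n)).aestronglyMeasurable) u hut).trans
      ?_
    exact liminf_le_of_le (by isBoundedDefault) fun b hb => by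
      obtain ⟨n, hn⟩ := hb.exists
      exact hn.trans (hB _)

/-! ### Bessel sequences -/

section Bessel

variable {H : Type*} [NormedAddCommGroup H] [NormedSpace ℂ H]

/-- The finite sums `∑ c_k v_k` are bounded by `A` times the `ℓ²` norm of the coefficients. -/
def BesselBound (v : ℕ → H) (A : ℝ) : Prop :=
  0 ≤ A ∧ ∀ (K : Finset ℕ) (c : ℕ → ℂ), ‖∑ k ∈ K, c k • v k‖ ≤ A * √(∑ k ∈ K, ‖c k‖ ^ 2)

theorem BesselBound.summable [CompleteSpace H] {v : ℕ → H} {A : ℝ} (hv : BesselBound v A)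
    {c : ℕ → ℂ} (hc : Summable fun k => ‖c k‖ ^ 2) : Summable fun k => c k • v k := by
  rw [summable_iff_vanishing_norm]
  intro ε hε
  obtain ⟨s, hs⟩ := summable_iff_vanishing_norm.1 hc ((ε / (A + 1)) ^ 2)
    (by have := hv.1; positivity)
  refine ⟨s, fun t ht => ?_⟩
  have h0 : (0 : ℝ) < A + 1 := by linarith [hv.1]
  have h1 := hs t ht
  rw [Real.norm_of_nonneg (Finset.sum_nonneg fun _ _ => by positivity)] at h1
  have h2 : √(∑ k ∈ t, ‖c k‖ ^ 2) < ε / (A + 1) :=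
    (Real.sqrt_lt' (by positivity)).2 h1
  calc _ ≤ A * √(∑ k ∈ t, ‖c k‖ ^ 2) := hv.2 t c
    _ ≤ (A + 1) * √(∑ k ∈ t, ‖c k‖ ^ 2) := by gcongr; linarith
    _ < (A + 1) * (ε / (A + 1)) := by gcongr
    _ = ε := by field_simp

theorem BesselBound.norm_tsum_le [CompleteSpace H] {v : ℕ → H} {A : ℝ} (hv : BesselBound v A)
    {c : ℕ → ℂ} (hc : Summable fun k => ‖c k‖ ^ 2) :
    ‖∑' k, c k • v k‖ ≤ A * √(∑' k, ‖c k‖ ^ 2) := by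
  refine le_of_tendsto (hv.summable hc).hasSum.norm (Eventually.of_forall fun K => ?_)
  refine (hv.2 K c).trans ?_
  have := hv.1
  gcongr
  exact hc.sum_le_tsum _ fun _ _ => by positivity

theorem BesselBound.norm_tsum_sub_le [CompleteSpace H] {v : ℕ → H} {A : ℝ} (hv : BesselBound v A)
    {c d : ℕ → ℂ} (hc : Summable fun k => ‖c k‖ ^ 2) (hd : Summable fun k => ‖d k‖ ^ 2)
    (hcd : Summable fun k => ‖c k - d k‖ ^ 2) :
    ‖∑' k, c k • v k - ∑' k, d k • v k‖ ≤ A * √(∑' k, ‖c k - d k‖ ^ 2) := by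
  rw [← (hv.summable hc).tsum_sub (hv.summable hd)]
  simp_rw [← sub_smul]
  exact hv.norm_tsum_le hcd

/-- The bound sees the coefficients only through their majorant. For time-dependent coefficients the
partial sums therefore converge uniformly in time, as `exists_slices` requires. -/
theorem BesselBound.norm_tsum_sub_sum_range_le [CompleteSpace H] {v : ℕ → H} {A : ℝ}
    (hv : BesselBound v A) {c : ℕ → ℂ} {β : ℕ → ℝ} (hc : ∀ k, ‖c k‖ ≤ β k)
    (hβ : Summable fun k => β k ^ 2) (N : ℕ) :
    ‖∑' k, c k • v k - ∑ k ∈ Finset.range N, c k • v k‖ ≤ A * √(∑' k, β (k + N) ^ 2) := by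
  have hsq : ∀ k, ‖c k‖ ^ 2 ≤ β k ^ 2 := fun k => by gcongr; exact hc k
  have hcs : Summable fun k => ‖c k‖ ^ 2 := hβ.of_nonneg_of_le (fun _ => by positivity) hsq
  have hs := hv.summable hcs
  rw [← hs.sum_add_tsum_nat_add N, add_sub_cancel_left]
  -- A tail of a Bessel sequence is tested by moving the index set and the coefficients by N.
  have hv' : BesselBound (fun k => v (k + N)) A := by
    refine ⟨hv.1, fun K d => ?_⟩
    have h := hv.2 (K.map (addRightEmbedding N)) (fun k => d (k - N))
    simp only [Finset.sum_map, addRightEmbedding_apply, Nat.add_sub_cancel] at h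
    exact h
  refine (hv'.norm_tsum_le (c := fun k => c (k + N)) ((summable_nat_add_iff N).2 hcs)).trans ?_
  refine mul_le_mul_of_nonneg_left (Real.sqrt_le_sqrt ?_) hv.1
  exact ((summable_nat_add_iff N).2 hcs).tsum_le_tsum (fun k => hsq (k + N))
    ((summable_nat_add_iff N).2 hβ)

end Bessel

theorem tendsto_tsum_sq_sub {b : ℝ → ℕ → ℂ} {S : Set ℝ} {β : ℕ → ℝ}
    (hb : ∀ k, ContinuousOn (fun t => b t k) S) (hbβ : ∀ t ∈ S, ∀ k, ‖b t k‖ ≤ β k)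
    (hβ : Summable fun k => β k ^ 2) {t₀ : ℝ} (ht₀ : t₀ ∈ S) :
    Tendsto (fun t => ∑' k, ‖b t k - b t₀ k‖ ^ 2) (𝓝[S] t₀) (𝓝 0) := by
  have h : Tendsto (fun t => ∑' k, ‖b t k - b t₀ k‖ ^ 2) (𝓝[S] t₀) (𝓝 (∑' _ : ℕ, (0 : ℝ))) :=
    tendsto_tsum_of_dominated_convergence (bound := fun k => 4 * β k ^ 2) (hβ.mul_left 4) ?_ ?_
  · simpa using h
  · intro k
    have : Tendsto (fun t => ‖b t k - b t₀ k‖ ^ 2) (𝓝[S] t₀) (𝓝 (‖b t₀ k - b t₀ k‖ ^ 2)) :=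
      (((hb k t₀ ht₀).tendsto).sub_const _).norm.pow 2
    simpa using this
  · filter_upwards [self_mem_nhdsWithin] with t ht k
    rw [norm_pow, norm_norm]
    have : ‖b t k - b t₀ k‖ ≤ 2 * β k :=
      (norm_sub_le _ _).trans (by linarith [hbβ t ht k, hbβ t₀ ht₀ k])
    calc _ ≤ (2 * β k) ^ 2 := by gcongr
      _ = _ := by ring

theorem summable_sq_sub {c d : ℕ → ℂ} {β : ℕ → ℝ} (hc : ∀ k, ‖c k‖ ≤ β k) (hd : ∀ k, ‖d k‖ ≤ β k)
    (hβ : Summable fun k => β k ^ 2) : Summable fun k => ‖c k - d k‖ ^ 2 := by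
  refine (hβ.mul_left 4).of_nonneg_of_le (fun _ => by positivity) fun k => ?_
  have : ‖c k - d k‖ ≤ 2 * β k := (norm_sub_le _ _).trans (by linarith [hc k, hd k])
  calc _ ≤ (2 * β k) ^ 2 := by gcongr
    _ = _ := by ring

theorem summable_sq_of_norm_le {c : ℕ → ℂ} {β : ℕ → ℝ} (hc : ∀ k, ‖c k‖ ≤ β k)
    (hβ : Summable fun k => β k ^ 2) : Summable fun k => ‖c k‖ ^ 2 :=
  hβ.of_nonneg_of_le (fun _ => by positivity) fun k => by gcongr; exact hc k

theorem BesselBound.continuousOn_tsum {H : Type*} [NormedAddCommGroup H] [NormedSpace ℂ H]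
    [CompleteSpace H] {v : ℕ → H} {A : ℝ} (hv : BesselBound v A) {b : ℝ → ℕ → ℂ} {S : Set ℝ}
    {β : ℕ → ℝ} (hb : ∀ k, ContinuousOn (fun t => b t k) S)
    (hbβ : ∀ t ∈ S, ∀ k, ‖b t k‖ ≤ β k) (hβ : Summable fun k => β k ^ 2) :
    ContinuousOn (fun t => ∑' k, b t k • v k) S := by
  intro t₀ ht₀
  rw [ContinuousWithinAt, tendsto_iff_norm_sub_tendsto_zero]
  have h := ((tendsto_tsum_sq_sub hb hbβ hβ ht₀).sqrt).const_mul A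
  rw [Real.sqrt_zero, mul_zero] at h
  refine squeeze_zero' (Eventually.of_forall fun _ => norm_nonneg _) ?_ h
  filter_upwards [self_mem_nhdsWithin] with t ht
  exact hv.norm_tsum_sub_le (summable_sq_of_norm_le (hbβ t ht) hβ)
    (summable_sq_of_norm_le (hbβ t₀ ht₀) hβ) (summable_sq_sub (hbβ t ht) (hbβ t₀ ht₀) hβ)

/-- A curve `t ↦ ∑ b_k(t) v_k` in `L²` whose partial sums are bounded in `L^p` of space-time is a
function in `L^p` of space-time. -/
theorem BesselBound.exists_slices {X : Type*} [MeasurableSpace X] {μ : Measure X} [SFinite μ]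
    {p : ℝ≥0∞} {T : ℝ} (hT : 0 ≤ T) {v : ℕ → Lp ℂ 2 μ} {w : ℕ → X → ℂ} {A : ℝ}
    (hv : BesselBound v A)
    (hw : ∀ k, StronglyMeasurable (w k)) (hvw : ∀ k, v k =ᵐ[μ] w k)
    {b : ℝ → ℕ → ℂ} {β : ℕ → ℝ} (hb : ∀ k, ContinuousOn (fun t => b t k) (Icc 0 T))
    (hbβ : ∀ t ∈ Icc 0 T, ∀ k, ‖b t k‖ ≤ β k) (hβ : Summable fun k => β k ^ 2) {B : ℝ≥0∞}
    (hB : ∀ N, eLpNorm (fun z : X × ℝ => ∑ k ∈ Finset.range N, b z.2 k * w k z.1) p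
      (μ.prod (volume.restrict (Ioo 0 T))) ≤ B) :
    ∃ u : X × ℝ → ℂ, StronglyMeasurable u ∧
      (∀ᵐ t ∂(volume.restrict (Ioo 0 T)),
        (fun x => u (x, t)) =ᵐ[μ] (∑' k, b t k • v k : Lp ℂ 2 μ)) ∧
      eLpNorm u p (μ.prod (volume.restrict (Ioo 0 T))) ≤ B := by
  -- Nothing is known about the coefficients outside [0,T]; constant extension makes the partial
  -- sums measurable without changing them for a.e. time.
  let b' : ℕ → ℝ → ℂ := fun k => IccExtend hT ((Icc 0 T).domRestrict fun t => b t k)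
  have hb' : ∀ k, Continuous (b' k) := fun k => (hb k).domRestrict.Icc_extend'
  have hbb : ∀ k, ∀ t ∈ Icc 0 T, b' k t = b t k := fun k t ht => by
    simp only [b']
    rw [IccExtend_of_mem _ _ ht, domRestrict_apply]
  have haet : ∀ᵐ t ∂(volume.restrict (Ioo 0 T)), t ∈ Icc 0 T := by
    filter_upwards [ae_restrict_mem measurableSet_Ioo] with t ht using Ioo_subset_Icc_self ht
  have haez : ∀ᵐ z ∂(μ.prod (volume.restrict (Ioo 0 T))), z.2 ∈ Icc 0 T :=
    Measure.quasiMeasurePreserving_snd.ae haet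
  have hnn : ∀ t ∈ Icc 0 T, ∀ N, eLpNorm ((fun x => ∑ k ∈ Finset.range N, b' k t * w k x) -
      ⇑(∑' k, b t k • v k : Lp ℂ 2 μ)) 2 μ ≤ ENNReal.ofReal (A * √(∑' k, β (k + N) ^ 2)) := by
    intro t ht N
    have h1 := hv.norm_tsum_sub_sum_range_le (hbβ t ht) hβ N
    rw [← norm_neg, neg_sub, Lp.norm_def] at h1
    have h2 := (ENNReal.le_ofReal_iff_toReal_le (Lp.eLpNorm_ne_top _)
      (mul_nonneg hv.1 (Real.sqrt_nonneg _))).2 h1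
    refine le_trans (eLpNorm_congr_ae ?_).le h2
    filter_upwards [Lp.coeFn_sub (∑ k ∈ Finset.range N, b t k • v k) (∑' k, b t k • v k),
      (Lp.coeFn_finsetSum (p := 2) (Finset.range N) (fun k => b t k • v k)),
      ae_all_iff.2 fun k => Lp.coeFn_smul (b t k) (v k), ae_all_iff.2 hvw] with x hx1 hx2 hx3 hx4
    rw [hx1, Pi.sub_apply, Pi.sub_apply, hx2, Finset.sum_apply]
    congr 1
    refine Finset.sum_congr rfl fun k _ => ?_
    rw [hx3, hbb k t ht, Pi.smul_apply, hx4, smul_eq_mul]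
  refine NavierBoundary.exists_slices (U := fun t => ∑' k, b t k • v k)
    (S := fun N z => ∑ k ∈ Finset.range N, b' k z.2 * w k z.1)
    (ε := fun N => ENNReal.ofReal (A * √(∑' k, β (k + N) ^ 2))) ?_ ?_ ?_ ?_
  · intro N
    refine Finset.stronglyMeasurable_fun_sum _ fun k _ => ?_
    exact ((hb' k).stronglyMeasurable.comp_measurable measurable_snd).mul
      ((hw k).comp_measurable measurable_fst)
  · have h := (tendsto_sum_nat_add fun k => β k ^ 2).sqrt.const_mul A
    rw [Real.sqrt_zero, mul_zero] at h
    simpa using ENNReal.tendsto_ofReal h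
  · intro N
    filter_upwards [haet] with t ht using hnn t ht N
  · intro N
    refine le_trans (eLpNorm_congr_ae ?_).le (hB N)
    filter_upwards [haez] with z hz
    exact Finset.sum_congr rfl fun k _ => by rw [hbb k _ hz]

/-! ### The `L⁴` inequality for `∑ c_k e^{i(k+1)πx + i((k+1)π)⁴t}` -/

/-- The exponential `e^{i(k+1)πx}`. -/
def expE (k : ℕ) (x : ℝ) : ℂ := Complex.exp (Complex.I * Real.pi * (k + 1) * x)

/-- The time frequency `((k+1)π)⁴`. -/
def freq (k : ℕ) : ℝ := ((k + 1) * Real.pi) ^ 4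

theorem norm_expE (k : ℕ) (x : ℝ) : ‖expE k x‖ = 1 := by
  have : Complex.I * Real.pi * (k + 1) * x = ((Real.pi * (k + 1) * x : ℝ) : ℂ) * Complex.I := by
    push_cast; ring
  rw [expE, this, Complex.norm_exp_ofReal_mul_I]

theorem continuous_expE (k : ℕ) : Continuous (expE k) := by
  unfold expE; fun_prop

theorem one_le_freq (k : ℕ) : 1 ≤ freq k := by
  have h : (1 : ℝ) ≤ (k + 1) * Real.pi := by
    have := Real.pi_gt_three
    have : (0 : ℝ) ≤ k := k.cast_nonneg
    nlinarith
  exact one_le_pow₀ h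

/-- With p = a+b one has a⁴+b⁴ = p⁴ - 4p²(ab) + 2(ab)². Equality of the two sums factors as
(ab-cd)(2p²-ab-cd) = 0, and the second factor is positive since products of numbers with sum p are
at most p²/4. Equal sum and equal product then give the same pair. -/
theorem eq_or_eq_of_add_eq_of_pow_four {a b c d : ℤ} (ha : 0 < a) (hb : 0 < b)
    (h1 : a + b = c + d) (h4 : a ^ 4 + b ^ 4 = c ^ 4 + d ^ 4) :
    (c = a ∧ d = b) ∨ (c = b ∧ d = a) := by
  obtain rfl : d = a + b - c := by omega
  have hprod : (a * b - c * (a + b - c)) * (2 * (a + b) ^ 2 - (a * b + c * (a + b - c))) = 0 := by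
    ring_nf at h4 ⊢
    linarith
  have hpos : 0 < 2 * (a + b) ^ 2 - (a * b + c * (a + b - c)) := by
    nlinarith [mul_pos ha hb, sq_nonneg (a - b), sq_nonneg (2 * c - (a + b))]
  have h0 : a * b - c * (a + b - c) = 0 := by
    rcases mul_eq_zero.1 hprod with h | h
    · exact h
    · omega
  have h2 : (c - a) * (c - b) = 0 := by linear_combination h0
  rcases mul_eq_zero.1 h2 with h | h <;> omega

/-- The interval is symmetric, leaves room around [0,1] for a cut-off, and consists of three periods
of length 2, so orthogonality is exact. -/
theorem integral_exp_int_mul (n : ℤ) :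
    ∫ x in Ioo (-3 : ℝ) 3, Complex.exp (Complex.I * Real.pi * n * x) = if n = 0 then 6 else 0 := by
  rw [← integral_Ioc_eq_integral_Ioo, ← intervalIntegral.integral_of_le (by norm_num)]
  split_ifs with h
  · simp [h]; norm_num
  · have hc : Complex.I * Real.pi * n ≠ 0 := by
      simp [h, Real.pi_ne_zero]
    rw [integral_exp_mul_complex hc]
    have : Complex.exp (Complex.I * Real.pi * n * (3 : ℝ)) =
        Complex.exp (Complex.I * Real.pi * n * (-3 : ℝ)) := by
      rw [Complex.exp_eq_exp_iff_exists_int]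
      exact ⟨3 * n, by push_cast; ring⟩
    rw [this]; simp

/-- All these exponentials have the common period 2/π³, and the interval is N such periods. -/
theorem integral_exp_int_mul_pi_pow_four (n : ℤ) (N : ℕ) :
    ∫ t in Ioo (0 : ℝ) (2 * N / Real.pi ^ 3), Complex.exp (Complex.I * Real.pi ^ 4 * n * t) =
      if n = 0 then (2 * N / Real.pi ^ 3 : ℂ) else 0 := by
  have hpi := Real.pi_pos
  rw [← integral_Ioc_eq_integral_Ioo, ← intervalIntegral.integral_of_le (by positivity)]
  split_ifs with h
  · simp [h]
  · have hpi' : (Real.pi : ℂ) ≠ 0 := by simp [Real.pi_ne_zero]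
    have hc : Complex.I * Real.pi ^ 4 * n ≠ 0 := by
      simp [h, Real.pi_ne_zero]
    rw [integral_exp_mul_complex hc]
    have : Complex.exp (Complex.I * Real.pi ^ 4 * n * (2 * N / Real.pi ^ 3 : ℝ)) = 1 := by
      rw [Complex.exp_eq_one_iff]
      refine ⟨N * n, ?_⟩
      push_cast
      field_simp
    rw [this]; simp

theorem integral_norm_sq_sum_expE (K : Finset ℕ) (c : ℕ → ℂ) :
    ∫ x in Ioo (-3 : ℝ) 3, ‖∑ k ∈ K, c k * expE k x‖ ^ 2 = 6 * ∑ k ∈ K, ‖c k‖ ^ 2 := by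
  have key : ∫ x in Ioo (-3 : ℝ) 3, ((‖∑ k ∈ K, c k * expE k x‖ ^ 2 : ℝ) : ℂ) =
      6 * ∑ k ∈ K, ((‖c k‖ ^ 2 : ℝ) : ℂ) := by
    have hpt : ∀ x : ℝ, ((‖∑ k ∈ K, c k * expE k x‖ ^ 2 : ℝ) : ℂ) =
        ∑ p ∈ K ×ˢ K, (c p.1 * (starRingEnd ℂ) (c p.2)) *
          Complex.exp (Complex.I * Real.pi * ((p.1 - p.2 : ℤ) : ℂ) * x) := by
      intro x
      push_cast
      rw [← Complex.mul_conj', map_sum, Finset.sum_mul_sum, ← Finset.sum_product']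
      refine Finset.sum_congr rfl fun p _ => ?_
      rw [map_mul, expE, expE, ← Complex.exp_conj, mul_mul_mul_comm, ← Complex.exp_add]
      congr 2
      simp
      ring
    simp_rw [hpt]
    rw [integral_finsetSum _ fun p _ => ?_]
    · simp_rw [integral_const_mul, integral_exp_int_mul, Finset.sum_product]
      simp only [sub_eq_zero, Nat.cast_inj, mul_ite, mul_zero, Finset.sum_ite_eq]
      rw [Finset.mul_sum]
      refine Finset.sum_congr rfl fun k hk => ?_
      rw [if_pos hk, Complex.mul_conj']
      push_cast; ring
    · refine (Continuous.integrableOn_Icc ?_).mono_set Ioo_subset_Icc_self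
      fun_prop
  rw [integral_complex_ofReal] at key
  exact_mod_cast key

/-- Each of the two admissible coincidences contributes (∑ f²)²; quadruples satisfying both are
counted twice, which only helps. -/
theorem sum_quadruples_le (K : Finset ℕ) {f : ℕ → ℝ} (hf : ∀ k, 0 ≤ f k)
    (P : (ℕ × ℕ) × (ℕ × ℕ) → Prop) [DecidablePred P]
    (hP : ∀ q, P q → (q.2.1 = q.1.1 ∧ q.2.2 = q.1.2) ∨ (q.2.1 = q.1.2 ∧ q.2.2 = q.1.1)) :
    ∑ q ∈ (K ×ˢ K) ×ˢ (K ×ˢ K), (if P q then f q.1.1 * f q.1.2 * (f q.2.1 * f q.2.2) else 0) ≤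
      2 * (∑ k ∈ K, f k ^ 2) ^ 2 := by
  have h1 : ∀ q ∈ (K ×ˢ K) ×ˢ (K ×ˢ K),
      (if P q then f q.1.1 * f q.1.2 * (f q.2.1 * f q.2.2) else 0) ≤
      (if q.2 = q.1 then f q.1.1 * f q.1.2 * (f q.2.1 * f q.2.2) else 0) +
      (if q.2 = (q.1.2, q.1.1) then f q.1.1 * f q.1.2 * (f q.2.1 * f q.2.2) else 0) := by
    rintro ⟨⟨a, b⟩, ⟨c, d⟩⟩ _
    have h0 : 0 ≤ f a * f b * (f c * f d) :=
      mul_nonneg (mul_nonneg (hf _) (hf _)) (mul_nonneg (hf _) (hf _))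
    have := hP ((a, b), (c, d))
    simp only [Prod.mk.injEq] at this ⊢
    split_ifs <;> first | linarith | (exfalso; tauto)
  refine (Finset.sum_le_sum h1).trans (le_of_eq ?_)
  rw [Finset.sum_add_distrib, two_mul, sq, Finset.sum_mul_sum, ← Finset.sum_product']
  congr 1
  · rw [Finset.sum_product (K ×ˢ K)]
    refine Finset.sum_congr rfl fun p hp => ?_
    rw [Finset.sum_ite_eq', if_pos hp]
    ring
  · rw [Finset.sum_product (K ×ˢ K)]
    refine Finset.sum_congr rfl fun p hp => ?_
    dsimp only
    rw [Finset.sum_ite_eq', if_pos (by simp only [Finset.mem_product] at hp ⊢; tauto)]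
    ring

/-- The solution `∑ c_k e^{i(k+1)πx + i((k+1)π)⁴t}` of the free equation. -/
def freeSol (K : Finset ℕ) (c : ℕ → ℂ) (z : ℝ × ℝ) : ℂ :=
  ∑ k ∈ K, c k * expE k z.1 * Complex.exp (Complex.I * freq k * z.2)

theorem continuous_freeSol (K : Finset ℕ) (c : ℕ → ℂ) : Continuous (freeSol K c) := by
  unfold freeSol expE; fun_prop

/-- Expansion of |u|⁴ = u·u·ū·ū. The phases are written with integer multiples of π and π⁴ so that
the orthogonality integrals apply. -/
theorem norm_freeSol_pow_four (K : Finset ℕ) (c : ℕ → ℂ) (z : ℝ × ℝ) :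
    ((‖freeSol K c z‖ ^ 4 : ℝ) : ℂ) = ∑ q ∈ (K ×ˢ K) ×ˢ (K ×ˢ K),
      (c q.1.1 * c q.1.2 * ((starRingEnd ℂ) (c q.2.1) * (starRingEnd ℂ) (c q.2.2))) *
      (Complex.exp (Complex.I * Real.pi * ((q.1.1 + q.1.2 - (q.2.1 + q.2.2) : ℤ) : ℂ) * z.1) *
      Complex.exp (Complex.I * Real.pi ^ 4 *
        (((q.1.1 + 1) ^ 4 + (q.1.2 + 1) ^ 4 - ((q.2.1 + 1) ^ 4 + (q.2.2 + 1) ^ 4) : ℤ) : ℂ) *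
        z.2)) := by
  have h : ((‖freeSol K c z‖ ^ 4 : ℝ) : ℂ) = (freeSol K c z * freeSol K c z) *
      ((starRingEnd ℂ) (freeSol K c z) * (starRingEnd ℂ) (freeSol K c z)) := by
    have := Complex.mul_conj' (freeSol K c z)
    push_cast
    linear_combination (-(freeSol K c z * (starRingEnd ℂ) (freeSol K c z)) -
      (‖freeSol K c z‖ : ℂ) ^ 2) * this
  rw [h, freeSol, map_sum, Finset.sum_mul_sum, Finset.sum_mul_sum, ← Finset.sum_product',
    ← Finset.sum_product', Finset.sum_mul_sum, ← Finset.sum_product']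
  refine Finset.sum_congr rfl fun q _ => ?_
  simp only [map_mul, expE, ← Complex.exp_conj]
  rw [← Complex.exp_add]
  have e4 : ∀ A B C D a b c d a' b' c' d' : ℂ,
      A * Complex.exp a * Complex.exp a' * (B * Complex.exp b * Complex.exp b') *
      (C * Complex.exp c * Complex.exp c' * (D * Complex.exp d * Complex.exp d')) =
      A * B * (C * D) * Complex.exp (a + b + c + d + (a' + b' + c' + d')) := by
    intros
    simp only [Complex.exp_add]; ring
  rw [e4]
  congr 2
  simp only [Complex.conj_I, Complex.conj_ofReal, map_add, map_one, Complex.conj_natCast,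
    freq]
  push_cast
  ring

/-- Integration over full periods leaves only the resonant quadruples, which are trivial by
`eq_or_eq_of_add_eq_of_pow_four`. The constant is the area 6·2N/π³ times the factor 2 of
`sum_quadruples_le`. -/
theorem lintegral_freeSol_pow_four_le (K : Finset ℕ) (c : ℕ → ℂ) (N : ℕ) :
    ∫⁻ z, ‖freeSol K c z‖ₑ ^ 4 ∂((volume.restrict (Ioo (-3 : ℝ) 3)).prod
      (volume.restrict (Ioo (0 : ℝ) (2 * N / Real.pi ^ 3)))) ≤
      ENNReal.ofReal (24 * N / Real.pi ^ 3 * (∑ k ∈ K, ‖c k‖ ^ 2) ^ 2) := by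
  have hpi := Real.pi_pos
  set μ := (volume.restrict (Ioo (-3 : ℝ) 3)).prod
      (volume.restrict (Ioo (0 : ℝ) (2 * N / Real.pi ^ 3))) with hμ
  have hint : ∀ {E : Type} [NormedAddCommGroup E] {f : ℝ × ℝ → E}, Continuous f →
      Integrable f μ := by
    intro E _ f hf
    rw [hμ, Measure.prod_restrict, ← Measure.volume_eq_prod]
    exact (hf.continuousOn.integrableOn_compact (isCompact_Icc.prod isCompact_Icc)).mono_set
      (prod_mono Ioo_subset_Icc_self Ioo_subset_Icc_self)
  have hc4 : Continuous fun z => ‖freeSol K c z‖ ^ 4 := (continuous_freeSol K c).norm.pow 4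
  have h1 : ∫⁻ z, ‖freeSol K c z‖ₑ ^ 4 ∂μ = ENNReal.ofReal (∫ z, ‖freeSol K c z‖ ^ 4 ∂μ) := by
    rw [ofReal_integral_eq_lintegral_ofReal (hint hc4) (ae_of_all _ fun _ => by positivity)]
    refine lintegral_congr fun z => ?_
    rw [ENNReal.ofReal_pow (norm_nonneg _), ofReal_norm]
  rw [h1]
  refine ENNReal.ofReal_le_ofReal ?_
  have h2 : ((∫ z, ‖freeSol K c z‖ ^ 4 ∂μ : ℝ) : ℂ) = ∑ q ∈ (K ×ˢ K) ×ˢ (K ×ˢ K),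
      (c q.1.1 * c q.1.2 * ((starRingEnd ℂ) (c q.2.1) * (starRingEnd ℂ) (c q.2.2))) *
      ((if (q.1.1 + q.1.2 - (q.2.1 + q.2.2) : ℤ) = 0 then 6 else 0) *
      (if ((q.1.1 + 1) ^ 4 + (q.1.2 + 1) ^ 4 - ((q.2.1 + 1) ^ 4 + (q.2.2 + 1) ^ 4) : ℤ) = 0 then
        (2 * N / Real.pi ^ 3 : ℂ) else 0)) := by
    rw [← integral_complex_ofReal]
    simp_rw [norm_freeSol_pow_four]
    rw [integral_finsetSum _ fun q _ => ?_]
    · refine Finset.sum_congr rfl fun q _ => ?_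
      rw [integral_const_mul, hμ]
      congr 1
      rw [integral_prod_mul (fun x : ℝ => Complex.exp (Complex.I * Real.pi *
        ((q.1.1 + q.1.2 - (q.2.1 + q.2.2) : ℤ) : ℂ) * x))
        (fun t : ℝ => Complex.exp (Complex.I * Real.pi ^ 4 *
        (((q.1.1 + 1) ^ 4 + (q.1.2 + 1) ^ 4 - ((q.2.1 + 1) ^ 4 + (q.2.2 + 1) ^ 4) : ℤ) : ℂ) * t)),
        integral_exp_int_mul, integral_exp_int_mul_pi_pow_four]
    · exact hint (by fun_prop)
  have h3 : ∫ z, ‖freeSol K c z‖ ^ 4 ∂μ = ‖((∫ z, ‖freeSol K c z‖ ^ 4 ∂μ : ℝ) : ℂ)‖ := by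
    rw [Complex.norm_real, Real.norm_of_nonneg (integral_nonneg fun _ => by positivity)]
  rw [h3, h2]
  let P : (ℕ × ℕ) × (ℕ × ℕ) → Prop := fun q =>
    (q.1.1 + q.1.2 - (q.2.1 + q.2.2) : ℤ) = 0 ∧
    ((q.1.1 + 1) ^ 4 + (q.1.2 + 1) ^ 4 - ((q.2.1 + 1) ^ 4 + (q.2.2 + 1) ^ 4) : ℤ) = 0
  have h4 := sum_quadruples_le K (f := fun k => ‖c k‖) (fun _ => norm_nonneg _) P (by
    rintro ⟨⟨a, b⟩, ⟨d, e⟩⟩ ⟨hp1, hp2⟩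
    simp only at hp1 hp2 ⊢
    have := eq_or_eq_of_add_eq_of_pow_four (a := a + 1) (b := b + 1) (c := d + 1) (d := e + 1)
      (by positivity) (by positivity) (by linarith) (by linarith)
    omega)
  calc _ ≤ ∑ q ∈ (K ×ˢ K) ×ˢ (K ×ˢ K), 12 * N / Real.pi ^ 3 *
        (if P q then ‖c q.1.1‖ * ‖c q.1.2‖ * (‖c q.2.1‖ * ‖c q.2.2‖) else 0) := by
        refine (norm_sum_le _ _).trans (Finset.sum_le_sum fun q _ => ?_)
        have hpi' : ‖(2 * N / Real.pi ^ 3 : ℂ)‖ = 2 * N / Real.pi ^ 3 := by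
          simp [abs_of_pos hpi]
        rw [norm_mul, norm_mul, norm_mul, norm_mul, norm_mul, RCLike.norm_conj, RCLike.norm_conj]
        by_cases hq : P q
        · rw [if_pos hq, if_pos hq.1, if_pos hq.2, hpi']
          refine le_of_eq ?_
          simp; ring
        · rw [if_neg hq]
          simp only [P, not_and_or] at hq
          rcases hq with hq | hq <;> simp [hq]
    _ ≤ _ := by
        rw [← Finset.mul_sum]
        refine (mul_le_mul_of_nonneg_left h4 (by positivity)).trans (le_of_eq ?_)
        ring

/-- The `L⁴` inequality on `(-3,3) × (0,T)`. -/
theorem exists_lintegral_freeSol_le (T : ℝ) : ∃ C : ℝ, 0 < C ∧ ∀ (K : Finset ℕ) (c : ℕ → ℂ),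
    ∫⁻ z, ‖freeSol K c z‖ₑ ^ 4 ∂((volume.restrict (Ioo (-3 : ℝ) 3)).prod
      (volume.restrict (Ioo (0 : ℝ) T))) ≤ ENNReal.ofReal (C * (∑ k ∈ K, ‖c k‖ ^ 2)) ^ 2 := by
  have hpi := Real.pi_pos
  obtain ⟨N, hN⟩ := exists_nat_ge (T * Real.pi ^ 3 / 2)
  -- The time interval is enlarged to N full periods. The summand 1 keeps the constant positive when
  -- N = 0.
  refine ⟨√(24 * N / Real.pi ^ 3) + 1, by positivity, fun K c => ?_⟩
  calc _ ≤ ∫⁻ z, ‖freeSol K c z‖ₑ ^ 4 ∂((volume.restrict (Ioo (-3 : ℝ) 3)).prod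
      (volume.restrict (Ioo (0 : ℝ) (2 * N / Real.pi ^ 3)))) := by
        rw [Measure.prod_restrict, Measure.prod_restrict]
        refine lintegral_mono_set (prod_mono le_rfl (Ioo_subset_Ioo_right ?_))
        rw [le_div_iff₀ (by positivity)]
        linarith
    _ ≤ _ := lintegral_freeSol_pow_four_le K c N
    _ ≤ _ := by
        rw [← ENNReal.ofReal_pow (by positivity), mul_pow]
        refine ENNReal.ofReal_le_ofReal ?_
        gcongr
        nlinarith [Real.sq_sqrt (show 0 ≤ 24 * N / Real.pi ^ 3 by positivity),
          Real.sqrt_nonneg (24 * N / Real.pi ^ 3)]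

/-! ### The Duhamel kernel and its weights -/

/-- The kernel `∫₀ᵗ e^{iyτ} dτ`. -/
def kern (y t : ℝ) : ℂ := ∫ τ in (0 : ℝ)..t, Complex.exp (Complex.I * y * τ)

theorem norm_exp_I_mul_mul (y t : ℝ) : ‖Complex.exp (Complex.I * y * t)‖ = 1 := by
  have : Complex.I * y * t = ((y * t : ℝ) : ℂ) * Complex.I := by push_cast; ring
  rw [this, Complex.norm_exp_ofReal_mul_I]

theorem kern_eq {y : ℝ} (hy : y ≠ 0) (t : ℝ) :
    kern y t = (Complex.exp (Complex.I * y * t) - 1) / (Complex.I * y) := by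
  have hc : Complex.I * y ≠ 0 := by simp [hy]
  rw [kern, integral_exp_mul_complex hc]
  simp

theorem continuous_kern (t : ℝ) : Continuous fun y => kern y t := by
  unfold kern
  exact intervalIntegral.continuous_parametric_intervalIntegral_of_continuous' (by fun_prop) _ _

/-- The weight `(1 + |y|)^{-1/4}`. -/
def wt (y : ℝ) : ℝ := (1 + |y|) ^ (-(1 / 4) : ℝ)

theorem wt_pos (y : ℝ) : 0 < wt y := by unfold wt; positivity

theorem wt_pow (y : ℝ) (n : ℕ) : wt y ^ n = (1 + |y|) ^ (-(n / 4) : ℝ) := by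
  rw [wt, ← Real.rpow_mul_natCast (by positivity)]
  congr 1; ring

theorem continuous_wt : Continuous wt := by
  unfold wt
  refine Continuous.rpow_const (by fun_prop) fun x => Or.inl (by positivity)

/-- The trivial bound T and the bound 2/|y| from explicit integration add up to (1+|y|)‖K‖ ≤ T+2. -/
theorem norm_kern_le {T t : ℝ} (ht : t ∈ Icc 0 T) (y : ℝ) : ‖kern y t‖ ≤ (T + 2) * wt y ^ 4 := by
  have h1 : ‖kern y t‖ ≤ T := by
    have := intervalIntegral.norm_integral_le_of_norm_le_const (a := 0) (b := t) (C := 1)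
      (f := fun τ => Complex.exp (Complex.I * y * τ)) fun τ _ => (norm_exp_I_mul_mul y τ).le
    rw [sub_zero, one_mul, abs_of_nonneg ht.1] at this
    exact this.trans ht.2
  have h2 : |y| * ‖kern y t‖ ≤ 2 := by
    rcases eq_or_ne y 0 with rfl | hy
    · simp
    · rw [kern_eq hy, norm_div, norm_mul, Complex.norm_I, one_mul, Complex.norm_real,
        Real.norm_eq_abs, mul_div_cancel₀ _ (abs_ne_zero.2 hy)]
      refine (norm_sub_le _ _).trans ?_
      rw [norm_exp_I_mul_mul, norm_one]; norm_num
  rw [wt_pow]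
  norm_num
  rw [Real.rpow_neg_one, ← div_eq_mul_inv, le_div_iff₀ (by positivity)]
  nlinarith

theorem integrable_wt_pow_six : Integrable fun y => wt (2 * Real.pi * y) ^ 6 := by
  have h : Integrable fun y => wt y ^ 6 := by
    have := integrable_one_add_norm (E := ℝ) (μ := volume) (r := 3 / 2) (by simp; norm_num)
    refine this.congr (ae_of_all _ fun y => ?_)
    simp only [wt_pow, Real.norm_eq_abs]
    norm_num
  exact h.comp_mul_left' (by positivity)

/-- The terms are (1+|y-ω_k|)^{-1/2}. Since |ω_k-ω_l| ≥ (k-l)⁴, they decay like (k-k₀)⁻² away from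
the frequency nearest to y, with a sum independent of y. -/
theorem sum_wt_sq_le : ∃ C : ℝ, 0 < C ∧ ∀ (K : Finset ℕ) (y : ℝ),
    ∑ k ∈ K, wt (y - freq k) ^ 2 ≤ C := by
  have hsum : Summable fun n : ℤ => (2 : ℝ) * (1 / ((n : ℝ) ^ 2 + 1)) := by
    refine Summable.mul_left _ ?_
    refine Summable.of_nonneg_of_le (f := fun n : ℤ => 1 / (n : ℝ) ^ 2 + if n = 0 then 1 else 0)
      (fun n => by positivity) (fun n => ?_) ?_
    · rcases eq_or_ne n 0 with rfl | hn
      · simp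
      · rw [if_neg hn, add_zero]
        have : (n : ℝ) ≠ 0 := by exact_mod_cast hn
        gcongr
        linarith
    · refine (Real.summable_one_div_int_pow.2 (by norm_num)).add ?_
      exact (hasSum_ite_eq (0 : ℤ) (1 : ℝ)).summable
  refine ⟨∑' n : ℤ, (2 : ℝ) * (1 / ((n : ℝ) ^ 2 + 1)), ?_, fun K y => ?_⟩
  · exact hsum.tsum_pos (fun n => by positivity) 0 (by norm_num)
  rcases K.eq_empty_or_nonempty with rfl | hK
  · simp only [Finset.sum_empty]
    exact tsum_nonneg fun n => by positivity
  -- For the nearest frequency, |ω_k-ω_{k₀}| ≤ 2|y-ω_k|, so the separation of the frequencies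
  -- controls the distance to y.
  obtain ⟨k₀, _, hk₀⟩ := K.exists_min_image (fun k => |y - freq k|) hK
  have hsep : ∀ k : ℕ, ((k : ℝ) - k₀) ^ 4 ≤ |freq k - freq k₀| := by
    have aux : ∀ a b : ℕ, a ≤ b → ((b : ℝ) - a) ^ 4 ≤ |freq b - freq a| := by
      intro a b hab
      have hab' : (a : ℝ) ≤ b := by exact_mod_cast hab
      have ha : (0 : ℝ) ≤ a := a.cast_nonneg
      have hpi : 1 ≤ Real.pi ^ 4 := one_le_pow₀ (by linarith [Real.pi_gt_three])
      refine le_trans ?_ (le_abs_self _)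
      have e : freq b - freq a = (((b : ℝ) + 1) ^ 4 - ((a : ℝ) + 1) ^ 4) * Real.pi ^ 4 := by
        unfold freq; ring
      have hd : ((b : ℝ) - a) ^ 4 ≤ ((b : ℝ) + 1) ^ 4 - ((a : ℝ) + 1) ^ 4 := by
        obtain ⟨d, hd⟩ : ∃ d : ℝ, d = b - a := ⟨_, rfl⟩
        have hd0 : 0 ≤ d := by linarith
        have : (b : ℝ) + 1 = d + (a + 1) := by linarith
        rw [this, ← hd]
        have ha1 : (0 : ℝ) ≤ a + 1 := by linarith
        have : (d + ((a : ℝ) + 1)) ^ 4 - ((a : ℝ) + 1) ^ 4 - d ^ 4 =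
          4 * d ^ 3 * (a + 1) + 6 * d ^ 2 * (a + 1) ^ 2 + 4 * d * (a + 1) ^ 3 := by ring
        have h0 : (0 : ℝ) ≤ 4 * d ^ 3 * (a + 1) + 6 * d ^ 2 * (a + 1) ^ 2 + 4 * d * (a + 1) ^ 3 := by
          positivity
        linarith
      rw [e]
      have h0 : (0 : ℝ) ≤ ((b : ℝ) - a) ^ 4 := by positivity
      nlinarith
    intro k
    rcases le_total k₀ k with h | h
    · exact aux _ _ h
    · have := aux _ _ h
      rw [abs_sub_comm] at this
      calc _ = ((k₀ : ℝ) - k) ^ 4 := by ring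
        _ ≤ _ := this
  have hterm : ∀ k ∈ K, wt (y - freq k) ^ 2 ≤ 2 * (1 / ((((k : ℤ) - k₀ : ℤ) : ℝ) ^ 2 + 1)) := by
    intro k hk
    have h1 : ((k : ℝ) - k₀) ^ 4 ≤ 2 * |y - freq k| := by
      have h2 := hk₀ k hk
      have h3 : |freq k - freq k₀| ≤ |y - freq k| + |y - freq k₀| := by
        have := abs_sub_le (freq k) y (freq k₀)
        rwa [abs_sub_comm (freq k) y] at this
      linarith [hsep k]
    push_cast
    set d := (k : ℝ) - k₀
    rw [wt_pow, show (-((2 : ℕ) / 4) : ℝ) = -(1 / 2) by norm_num, Real.rpow_neg (by positivity),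
      ← Real.sqrt_eq_rpow, mul_one_div, ← one_div, div_le_div_iff₀ (by positivity) (by positivity)]
    have h4 : (d ^ 2 + 1) / 2 ≤ √(1 + |y - freq k|) := by
      apply Real.le_sqrt_of_sq_le
      nlinarith [sq_nonneg (d ^ 2 - 1)]
    linarith
  refine (Finset.sum_le_sum hterm).trans ?_
  have hinj : Function.Injective fun k : ℕ => (k : ℤ) - k₀ := fun a b h => by
    simpa using h
  have := hsum.sum_le_tsum (K.map ⟨_, hinj⟩) fun n _ => by positivity
  rw [Finset.sum_map] at this
  exact this

/-! ### Two integral inequalities -/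

theorem sq_lintegral_mul_le {α : Type*} [MeasurableSpace α] {μ : Measure α} {f g : α → ℝ≥0∞}
    (hf : AEMeasurable f μ) (hg : AEMeasurable g μ) :
    (∫⁻ a, f a * g a ∂μ) ^ 2 ≤ (∫⁻ a, f a ^ 2 ∂μ) * ∫⁻ a, g a ^ 2 ∂μ := by
  have h := ENNReal.lintegral_mul_le_Lp_mul_Lq μ Real.HolderConjugate.two_two hf hg
  have hr : ∀ x : ℝ≥0∞, (x ^ (1 / 2 : ℝ)) ^ 2 = x := fun x => by
    rw [← ENNReal.rpow_natCast, ← ENNReal.rpow_mul]; norm_num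
  calc _ ≤ _ := pow_le_pow_left' h 2
    _ = _ := by
      rw [mul_pow, hr, hr]
      simp

/-- Minkowski's integral inequality in L². The square is opened into a double integral, and each
pairing of two slices is estimated by Cauchy-Schwarz. -/
theorem lintegral_sq_lintegral_le {α β : Type*} [MeasurableSpace α] [MeasurableSpace β]
    {μ : Measure α} {ν : Measure β} [SFinite μ] [SFinite ν] {F : α → β → ℝ≥0∞}
    (hF : Measurable (Function.uncurry F)) {m : α → ℝ≥0∞} (hm : Measurable m)
    (h : ∀ a, ∫⁻ z, F a z ^ 2 ∂ν ≤ m a ^ 2) :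
    ∫⁻ z, (∫⁻ a, F a z ∂μ) ^ 2 ∂ν ≤ (∫⁻ a, m a ∂μ) ^ 2 := by
  have hFa : ∀ a, Measurable (F a) := fun a => hF.comp measurable_prodMk_left
  have hFz : ∀ z, Measurable fun a => F a z := fun z => hF.comp measurable_prodMk_right
  have hpair : ∀ a a', ∫⁻ z, F a z * F a' z ∂ν ≤ m a * m a' := by
    intro a a'
    have h1 := sq_lintegral_mul_le (μ := ν) (hFa a).aemeasurable (hFa a').aemeasurable
    have h2 : (∫⁻ z, F a z * F a' z ∂ν) ^ 2 ≤ (m a * m a') ^ 2 := by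
      rw [mul_pow]
      exact h1.trans (mul_le_mul' (h a) (h a'))
    exact (ENNReal.pow_le_pow_left_iff two_ne_zero).1 h2
  calc ∫⁻ z, (∫⁻ a, F a z ∂μ) ^ 2 ∂ν
      = ∫⁻ z, ∫⁻ a, ∫⁻ a', F a z * F a' z ∂μ ∂μ ∂ν := by
        refine lintegral_congr fun z => ?_
        rw [sq, ← lintegral_mul_const _ (hFz z)]
        refine lintegral_congr fun a => ?_
        rw [lintegral_const_mul _ (hFz z)]
    _ = ∫⁻ a, ∫⁻ z, ∫⁻ a', F a z * F a' z ∂μ ∂ν ∂μ := by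
        rw [lintegral_lintegral_swap]
        refine Measurable.aemeasurable ?_
        refine Measurable.lintegral_prod_right' (f := fun p : (β × α) × α =>
          F p.1.2 p.1.1 * F p.2 p.1.1) ?_
        exact (hF.comp (by fun_prop : Measurable fun p : (β × α) × α => (p.1.2, p.1.1))).mul
          (hF.comp (by fun_prop : Measurable fun p : (β × α) × α => (p.2, p.1.1)))
    _ = ∫⁻ a, ∫⁻ a', ∫⁻ z, F a z * F a' z ∂ν ∂μ ∂μ := by
        refine lintegral_congr fun a => ?_
        rw [lintegral_lintegral_swap]
        refine Measurable.aemeasurable ?_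
        exact (hF.comp (by fun_prop : Measurable fun p : β × α => (a, p.1))).mul
          (hF.comp (by fun_prop : Measurable fun p : β × α => (p.2, p.1)))
    _ ≤ ∫⁻ a, ∫⁻ a', m a * m a' ∂μ ∂μ :=
        lintegral_mono fun a => lintegral_mono fun a' => hpair a a'
    _ = _ := by
        rw [sq, ← lintegral_mul_const _ hm]
        refine lintegral_congr fun a => ?_
        rw [lintegral_const_mul _ hm]

/-! ### Families of coefficients with `ℓ²` and `L⁴` bounds -/

theorem lintegral_enorm_pow_eq {α : Type*} [MeasurableSpace α] {μ : Measure α} (f : α → ℂ)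
    {n : ℕ} (hn : n ≠ 0) : ∫⁻ x, ‖f x‖ₑ ^ n ∂μ = eLpNorm f n μ ^ n := by
  rw [eLpNorm_eq_lintegral_rpow_enorm_toReal (by simpa using hn) (by simp), ENNReal.toReal_natCast,
    ← ENNReal.rpow_natCast, ← ENNReal.rpow_mul, one_div, inv_mul_cancel₀ (by simpa using hn)]
  simp

/-- Coefficients `b_k(t)`, continuous in `t`, with a time-independent `ℓ²` majorant, such that the
exponential sums with coefficients `μ_k b_k`, `|μ_k| ≤ 1`, are bounded in `L⁴((-3,3) × (0,T))`. -/
structure GoodFamily (T B : ℝ) (b : ℝ → ℕ → ℂ) : Prop where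
  continuousOn : ∀ k, ContinuousOn (fun t => b t k) (Icc 0 T)
  bound : ∃ β : ℕ → ℝ, (∀ t ∈ Icc 0 T, ∀ k, ‖b t k‖ ≤ β k) ∧ (Summable fun k => β k ^ 2) ∧
    √(∑' k, β k ^ 2) ≤ B
  eLpNorm_le : ∀ (N : ℕ) (μ : ℕ → ℂ), (∀ k, ‖μ k‖ ≤ 1) →
    eLpNorm (fun z : ℝ × ℝ => ∑ k ∈ Finset.range N, μ k * b z.2 k * expE k z.1) 4
      ((volume.restrict (Ioo (-3) 3)).prod (volume.restrict (Ioo 0 T))) ≤ ENNReal.ofReal B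

/-- The time factor `∫ c_k(ξ) K(2πξ - ω_k, t) dξ`. -/
def duhamel (c : ℕ → ℝ → ℂ) (k : ℕ) (t : ℝ) : ℂ :=
  ∫ ξ, c k ξ * kern (2 * Real.pi * ξ - freq k) t

/-- The weighted `L²` norm of `g` centred at the frequency `ω_k`. -/
def wtNormSq (g : ℝ → ℂ) (k : ℕ) : ℝ≥0∞ :=
  ∫⁻ ξ, ENNReal.ofReal (wt (2 * Real.pi * ξ - freq k) ^ 2) * ‖g ξ‖ₑ ^ 2

/-- Centring the integral at ω_k/2π makes the kernel independent of k, so that a sum over k can be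
taken under the integral. -/
theorem duhamel_eq (c : ℕ → ℝ → ℂ) (k : ℕ) (t : ℝ) :
    duhamel c k t = ∫ η, c k (η + freq k / (2 * Real.pi)) * kern (2 * Real.pi * η) t := by
  rw [duhamel, ← integral_add_right_eq_self _ (freq k / (2 * Real.pi))]
  refine integral_congr_ae (ae_of_all _ fun η => ?_)
  have : 2 * Real.pi * (η + freq k / (2 * Real.pi)) - freq k = 2 * Real.pi * η := by
    have := Real.pi_ne_zero
    field_simp; ring
  simp only [this]

theorem wtNormSq_eq (g : ℝ → ℂ) (k : ℕ) : wtNormSq g k =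
    ∫⁻ η, ENNReal.ofReal (wt (2 * Real.pi * η) ^ 2) * ‖g (η + freq k / (2 * Real.pi))‖ₑ ^ 2 := by
  rw [wtNormSq, ← lintegral_add_right_eq_self _ (freq k / (2 * Real.pi))]
  refine lintegral_congr fun η => ?_
  have : 2 * Real.pi * (η + freq k / (2 * Real.pi)) - freq k = 2 * Real.pi * η := by
    have := Real.pi_ne_zero
    field_simp; ring
  simp only [this]

theorem measurable_wt : Measurable wt := continuous_wt.measurable

/-- Cauchy-Schwarz for w⁴ = w³·w. The power w⁶ decays like |η|^{-3/2} and is integrable, while w² is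
exactly the weight that `sum_wt_sq_le` can sum over k. -/
theorem sq_lintegral_wt_mul_le {f : ℝ → ℝ≥0∞} (hf : Measurable f) :
    (∫⁻ η, ENNReal.ofReal (wt (2 * Real.pi * η) ^ 4) * f η) ^ 2 ≤
      (∫⁻ η, ENNReal.ofReal (wt (2 * Real.pi * η) ^ 6)) *
        ∫⁻ η, ENNReal.ofReal (wt (2 * Real.pi * η) ^ 2) * f η ^ 2 := by
  have hw : Measurable fun η : ℝ => wt (2 * Real.pi * η) :=
    measurable_wt.comp (by fun_prop)
  have h := sq_lintegral_mul_le (μ := volume)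
    (f := fun η => ENNReal.ofReal (wt (2 * Real.pi * η) ^ 3))
    (g := fun η => ENNReal.ofReal (wt (2 * Real.pi * η)) * f η)
    (hw.pow_const 3).ennreal_ofReal.aemeasurable (hw.ennreal_ofReal.mul hf).aemeasurable
  have hp : ∀ η, 0 ≤ wt (2 * Real.pi * η) := fun η => (wt_pos _).le
  convert h using 3
  · funext η
    rw [← mul_assoc, ← ENNReal.ofReal_mul (pow_nonneg (hp η) _), ← pow_succ]
  · funext η
    rw [← ENNReal.ofReal_pow (pow_nonneg (hp _) _)]
    congr 1; ring
  · funext η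
    rw [mul_pow, ENNReal.ofReal_pow (hp _)]

theorem enorm_kern_le {T t : ℝ} (ht : t ∈ Icc 0 T) (y : ℝ) :
    ‖kern y t‖ₑ ≤ ENNReal.ofReal (T + 2) * ENNReal.ofReal (wt y ^ 4) := by
  have hT : 0 ≤ T := ht.1.trans ht.2
  rw [← ENNReal.ofReal_mul (by positivity), ← ofReal_norm]
  exact ENNReal.ofReal_le_ofReal (norm_kern_le ht y)

theorem enorm_integral_mul_kern_sq_le {T t : ℝ} (ht : t ∈ Icc 0 T) {f : ℝ → ℂ}
    (hf : Measurable f) :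
    ‖∫ η, f η * kern (2 * Real.pi * η) t‖ₑ ^ 2 ≤ ENNReal.ofReal (T + 2) ^ 2 *
      (∫⁻ η, ENNReal.ofReal (wt (2 * Real.pi * η) ^ 6)) *
        ∫⁻ η, ENNReal.ofReal (wt (2 * Real.pi * η) ^ 2) * ‖f η‖ₑ ^ 2 := by
  have h1 : ‖∫ η, f η * kern (2 * Real.pi * η) t‖ₑ ≤
      ENNReal.ofReal (T + 2) * ∫⁻ η, ENNReal.ofReal (wt (2 * Real.pi * η) ^ 4) * ‖f η‖ₑ := by
    refine (enorm_integral_le_lintegral_enorm _).trans ?_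
    rw [← lintegral_const_mul' _ _ (by simp)]
    refine lintegral_mono fun η => ?_
    rw [enorm_mul, mul_comm, ← mul_assoc]
    gcongr
    exact enorm_kern_le ht _
  refine (pow_le_pow_left' h1 2).trans ?_
  rw [mul_pow, mul_assoc]
  gcongr
  exact sq_lintegral_wt_mul_le hf.enorm

theorem lintegral_wt_pow_six_ne_top : ∫⁻ η, ENNReal.ofReal (wt (2 * Real.pi * η) ^ 6) ≠ ⊤ :=
  (integrable_wt_pow_six.lintegral_lt_top).ne

/-- The sum goes under the integral, where the weights add up to a bounded function. All k share the
same g without loss. -/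
theorem exists_sum_wtNormSq_le : ∃ C : ℝ, 0 < C ∧ ∀ (g : ℝ → ℂ), Measurable g →
    ∀ K : Finset ℕ, ∑ k ∈ K, wtNormSq g k ≤ ENNReal.ofReal C * ∫⁻ ξ, ‖g ξ‖ₑ ^ 2 := by
  obtain ⟨C, hC, h⟩ := sum_wt_sq_le
  refine ⟨C, hC, fun g hg K => ?_⟩
  unfold wtNormSq
  rw [← lintegral_finsetSum, ← lintegral_const_mul' _ _ (by simp)]
  · refine lintegral_mono fun ξ => ?_
    rw [← Finset.sum_mul, ← ENNReal.ofReal_sum_of_nonneg fun k _ => pow_nonneg (wt_pos _).le _]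
    gcongr
    exact h K _
  · intro k _
    have hw : Measurable fun ξ : ℝ => wt (2 * Real.pi * ξ - freq k) :=
      measurable_wt.comp (by fun_prop)
    exact (hw.pow_const 2).ennreal_ofReal.mul (hg.enorm.pow_const 2)

theorem enorm_duhamel_sq_le {T t : ℝ} (ht : t ∈ Icc 0 T) {c : ℕ → ℝ → ℂ} {k : ℕ}
    (hc : Measurable (c k)) {g : ℝ → ℂ} (hcg : ∀ ξ, ‖c k ξ‖ ≤ ‖g ξ‖) :
    ‖duhamel c k t‖ₑ ^ 2 ≤ ENNReal.ofReal (T + 2) ^ 2 *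
      (∫⁻ η, ENNReal.ofReal (wt (2 * Real.pi * η) ^ 6)) * wtNormSq g k := by
  rw [duhamel_eq, wtNormSq_eq]
  refine (enorm_integral_mul_kern_sq_le ht
    (f := fun η => c k (η + freq k / (2 * Real.pi))) (by fun_prop)).trans ?_
  gcongr with η
  exact enorm_le_iff_norm_le.2 (hcg _)

theorem measurable_freeSol_shift {c : ℕ → ℝ → ℂ} (hc : ∀ k, Measurable (c k)) (K : Finset ℕ) :
    Measurable fun p : ℝ × (ℝ × ℝ) =>
      freeSol K (fun k => c k (p.1 + freq k / (2 * Real.pi))) p.2 := by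
  unfold freeSol
  refine Finset.measurable_fun_sum _ fun k _ => ?_
  refine (((hc k).comp (by fun_prop)).mul ?_).mul ?_
  · exact (continuous_expE k).measurable.comp (by fun_prop)
  · exact Continuous.measurable (by fun_prop)

theorem measurable_freeSol_shift_left {c : ℕ → ℝ → ℂ} (hc : ∀ k, Measurable (c k))
    (K : Finset ℕ) (z : ℝ × ℝ) :
    Measurable fun η : ℝ => freeSol K (fun k => c k (η + freq k / (2 * Real.pi))) z := by
  unfold freeSol
  refine Finset.measurable_fun_sum _ fun k _ => ?_
  exact (((hc k).comp (by fun_prop)).mul measurable_const).mul measurable_const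

theorem memLp_kern {T t : ℝ} (ht : t ∈ Icc 0 T) :
    MemLp (fun η => kern (2 * Real.pi * η) t) 2 := by
  have hcont : Continuous fun η => kern (2 * Real.pi * η) t :=
    (continuous_kern t).comp (by fun_prop)
  refine (memLp_two_iff_integrable_sq_norm hcont.aestronglyMeasurable).2 ?_
  refine Integrable.mono' (integrable_wt_pow_six.const_mul ((T + 2) ^ 2))
    (hcont.norm.pow 2).aestronglyMeasurable (ae_of_all _ fun η => ?_)
  have h0 := wt_pos (2 * Real.pi * η)
  have h1 : wt (2 * Real.pi * η) ≤ 1 :=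
    Real.rpow_le_one_of_one_le_of_nonpos (by linarith [abs_nonneg (2 * Real.pi * η)])
      (by norm_num)
  rw [norm_pow, norm_norm]
  calc _ ≤ ((T + 2) * wt (2 * Real.pi * η) ^ 4) ^ 2 := by
        gcongr; exact norm_kern_le ht _
    _ = (T + 2) ^ 2 * wt (2 * Real.pi * η) ^ 8 := by ring
    _ ≤ _ := mul_le_mul_of_nonneg_left
        (pow_le_pow_of_le_one h0.le h1 (by norm_num)) (by positivity)

/-- The Duhamel sum is a superposition of free solutions, with data depending on η and one scalar
kernel. -/
theorem sum_exp_mul_duhamel_eq {T : ℝ} {c : ℕ → ℝ → ℂ} (hc : ∀ k, MemLp (c k) 2) (K : Finset ℕ)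
    {z : ℝ × ℝ} (hz : z.2 ∈ Icc 0 T) :
    ∑ k ∈ K, Complex.exp (Complex.I * freq k * z.2) * duhamel c k z.2 * expE k z.1 =
      ∫ η, freeSol K (fun k => c k (η + freq k / (2 * Real.pi))) z *
        kern (2 * Real.pi * η) z.2 := by
  unfold freeSol
  simp_rw [Finset.sum_mul]
  rw [integral_finsetSum]
  · refine Finset.sum_congr rfl fun k _ => ?_
    rw [duhamel_eq, mul_comm (Complex.exp _), mul_assoc, ← integral_mul_const]
    refine integral_congr_ae (ae_of_all _ fun η => ?_)
    simp only []; ring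
  · intro k _
    have hck : MemLp (fun η => c k (η + freq k / (2 * Real.pi))) 2 :=
      (hc k).comp_measurePreserving (measurePreserving_add_right volume _)
    have := (hck.integrable_mul (memLp_kern hz)).const_mul
      (expE k z.1 * Complex.exp (Complex.I * freq k * z.2))
    refine this.congr (ae_of_all _ fun η => ?_)
    simp only [Pi.mul_apply]; ring

/-- Cauchy-Schwarz in η bounds the square of the sum by ∫ w²|free solution|² dη. Minkowski in L² of
space-time, applied to this square, reduces the matter to the free L⁴ inequality for each η. -/
theorem exists_lintegral_duhamel_le (T : ℝ) : ∃ C : ℝ, 0 < C ∧ ∀ (g : ℝ → ℂ), Measurable g →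
    MemLp g 2 → ∀ c : ℕ → ℝ → ℂ, (∀ k, Measurable (c k)) → (∀ k ξ, ‖c k ξ‖ ≤ ‖g ξ‖) → ∀ N,
    ∫⁻ z, ‖∑ k ∈ Finset.range N, Complex.exp (Complex.I * freq k * z.2) * duhamel c k z.2 *
      expE k z.1‖ₑ ^ 4 ∂((volume.restrict (Ioo (-3 : ℝ) 3)).prod
      (volume.restrict (Ioo (0 : ℝ) T))) ≤ ENNReal.ofReal (C * ∫ ξ, ‖g ξ‖ ^ 2) ^ 2 := by
  obtain ⟨C₁, hC₁, hfree⟩ := exists_lintegral_freeSol_le T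
  obtain ⟨C₂, hC₂, hwt⟩ := exists_sum_wtNormSq_le
  set J := ∫⁻ η, ENNReal.ofReal (wt (2 * Real.pi * η) ^ 6) with hJ
  refine ⟨(T + 2) ^ 2 * J.toReal * (C₁ * C₂) + 1, by positivity, fun g hg hg2 c hc hcg N => ?_⟩
  set ρ := (volume.restrict (Ioo (-3 : ℝ) 3)).prod (volume.restrict (Ioo (0 : ℝ) T)) with hρ
  let c' : ℝ → ℕ → ℂ := fun η k => c k (η + freq k / (2 * Real.pi))
  have hc' : ∀ k, Measurable fun η => c' η k := fun k => by
    simp only [c']; fun_prop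
  have hw : Measurable fun η : ℝ => wt (2 * Real.pi * η) := measurable_wt.comp (by fun_prop)
  have hZ : Measurable fun p : ℝ × (ℝ × ℝ) => freeSol (Finset.range N) (c' p.1) p.2 :=
    measurable_freeSol_shift hc _
  have hgint : ∫⁻ ξ, ‖g ξ‖ₑ ^ 2 = ENNReal.ofReal (∫ ξ, ‖g ξ‖ ^ 2) := by
    rw [ofReal_integral_eq_lintegral_ofReal ((memLp_two_iff_integrable_sq_norm
      hg.aestronglyMeasurable).1 hg2) (ae_of_all _ fun _ => by positivity)]
    refine lintegral_congr fun ξ => ?_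
    rw [ENNReal.ofReal_pow (norm_nonneg _), ofReal_norm]
  have hpt : ∀ z : ℝ × ℝ, z.2 ∈ Icc 0 T →
      ‖∑ k ∈ Finset.range N, Complex.exp (Complex.I * freq k * z.2) * duhamel c k z.2 *
        expE k z.1‖ₑ ^ 2 ≤ ENNReal.ofReal (T + 2) ^ 2 * J *
      ∫⁻ η, ENNReal.ofReal (wt (2 * Real.pi * η) ^ 2) *
        ‖freeSol (Finset.range N) (c' η) z‖ₑ ^ 2 := by
    intro z hz
    rw [sum_exp_mul_duhamel_eq (fun k => hg2.of_le (hc k).aestronglyMeasurable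
      (ae_of_all _ (hcg k))) _ hz]
    exact enorm_integral_mul_kern_sq_le hz (measurable_freeSol_shift_left hc _ z)
  let A : ℝ≥0∞ := ENNReal.ofReal (T + 2) ^ 2 * J
  have hJt : J ≠ ⊤ := lintegral_wt_pow_six_ne_top
  have hA : A ≠ ⊤ := ENNReal.mul_ne_top (by simp) hJt
  let F : ℝ → ℝ × ℝ → ℝ≥0∞ := fun η z =>
    ENNReal.ofReal (wt (2 * Real.pi * η) ^ 2) * ‖freeSol (Finset.range N) (c' η) z‖ₑ ^ 2
  let m : ℝ → ℝ≥0∞ := fun η => ENNReal.ofReal (wt (2 * Real.pi * η) ^ 2) *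
    ENNReal.ofReal (C₁ * ∑ k ∈ Finset.range N, ‖c' η k‖ ^ 2)
  have hF : Measurable (Function.uncurry F) :=
    (((hw.comp measurable_fst).pow_const 2).ennreal_ofReal).mul (hZ.enorm.pow_const 2)
  have hm : Measurable m := by
    refine (hw.pow_const 2).ennreal_ofReal.mul (Measurable.ennreal_ofReal ?_)
    exact (Finset.measurable_fun_sum _ fun k _ => (hc' k).norm.pow_const 2).const_mul C₁
  have hFm : ∀ η, ∫⁻ z, F η z ^ 2 ∂ρ ≤ m η ^ 2 := by
    intro η
    simp only [F, m, mul_pow]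
    rw [lintegral_const_mul' _ _ (by simp)]
    gcongr
    simp_rw [← pow_mul]
    exact hfree _ _
  -- Integration in η undoes the translations, and the data norms become weighted norms of g centred
  -- at the different ω_k.
  have hmint : ∫⁻ η, m η ≤ ENNReal.ofReal (C₁ * C₂) * ∫⁻ ξ, ‖g ξ‖ₑ ^ 2 := by
    have : ∀ η, m η ≤ ENNReal.ofReal C₁ * ∑ k ∈ Finset.range N,
        ENNReal.ofReal (wt (2 * Real.pi * η) ^ 2) * ‖g (η + freq k / (2 * Real.pi))‖ₑ ^ 2 := by
      intro η
      simp only [m]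
      rw [ENNReal.ofReal_mul hC₁.le, ENNReal.ofReal_sum_of_nonneg (fun k _ => by positivity),
        mul_left_comm, Finset.mul_sum]
      gcongr with k _
      rw [ENNReal.ofReal_pow (norm_nonneg _), ofReal_norm]
      gcongr
      exact enorm_le_iff_norm_le.2 (hcg _ _)
    refine (lintegral_mono this).trans ?_
    rw [lintegral_const_mul' _ _ (by simp), lintegral_finsetSum]
    · simp_rw [← wtNormSq_eq]
      rw [ENNReal.ofReal_mul hC₁.le, mul_assoc]
      gcongr
      exact hwt g hg _
    · intro k _
      exact (hw.pow_const 2).ennreal_ofReal.mul ((hg.comp (by fun_prop)).enorm.pow_const 2)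
  have haez : ∀ᵐ z ∂ρ, z.2 ∈ Icc 0 T := by
    refine Measure.quasiMeasurePreserving_snd.ae ?_
    filter_upwards [ae_restrict_mem measurableSet_Ioo] with t ht using Ioo_subset_Icc_self ht
  calc _ ≤ ∫⁻ z, A ^ 2 * (∫⁻ η, F η z) ^ 2 ∂ρ := by
        refine lintegral_mono_ae ?_
        filter_upwards [haez] with z hz
        rw [show 4 = 2 * 2 by norm_num, pow_mul, ← mul_pow]
        exact pow_le_pow_left' (hpt z hz) 2
    _ = A ^ 2 * ∫⁻ z, (∫⁻ η, F η z) ^ 2 ∂ρ := lintegral_const_mul' _ _ (by simp [hA])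
    _ ≤ A ^ 2 * (ENNReal.ofReal (C₁ * C₂) * ∫⁻ ξ, ‖g ξ‖ₑ ^ 2) ^ 2 := by
        gcongr
        exact (lintegral_sq_lintegral_le hF hm hFm).trans (pow_le_pow_left' hmint 2)
    _ ≤ _ := by
        rw [← mul_pow, hgint, ← ENNReal.ofReal_mul (by positivity)]
        have hAr : A ≤ ENNReal.ofReal ((T + 2) ^ 2 * J.toReal) := by
          rw [ENNReal.ofReal_mul (by positivity), ENNReal.ofReal_toReal hJt]
          refine mul_le_mul_left ?_ _
          rw [← sq_abs (T + 2), ENNReal.ofReal_pow (abs_nonneg _)]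
          exact pow_le_pow_left' (ENNReal.ofReal_le_ofReal (le_abs_self _)) 2
        refine pow_le_pow_left' ((mul_le_mul_left hAr _).trans ?_) 2
        rw [← ENNReal.ofReal_mul (by positivity)]
        refine ENNReal.ofReal_le_ofReal ?_
        have : 0 ≤ ∫ ξ, ‖g ξ‖ ^ 2 := integral_nonneg fun _ => by positivity
        nlinarith

theorem summable_rpow_three_halves :
    Summable fun k : ℕ => ((k : ℝ) + 1) ^ (-(3 / 2) : ℝ) := by
  have := (summable_nat_add_iff 1).2 (Real.summable_nat_rpow (p := -(3 / 2)).2 (by norm_num))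
  simpa using this

theorem lintegral_enorm_sq_eq {g : ℝ → ℂ} (hg : MemLp g 2) :
    ∫⁻ ξ, ‖g ξ‖ₑ ^ 2 = ENNReal.ofReal (∫ ξ, ‖g ξ‖ ^ 2) := by
  rw [ofReal_integral_eq_lintegral_ofReal ((memLp_two_iff_integrable_sq_norm hg.1).1 hg)
    (ae_of_all _ fun _ => by positivity)]
  refine lintegral_congr fun ξ => ?_
  rw [ENNReal.ofReal_pow (norm_nonneg _), ofReal_norm]

theorem wtNormSq_le {C : ℝ} {g : ℝ → ℂ}
    (h : ∀ K : Finset ℕ, ∑ k ∈ K, wtNormSq g k ≤ ENNReal.ofReal C * ∫⁻ ξ, ‖g ξ‖ₑ ^ 2)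
    (hC : 0 ≤ C) (hg : MemLp g 2) :
    (∀ k, wtNormSq g k ≠ ⊤) ∧ (Summable fun k => (wtNormSq g k).toReal) ∧
      ∑' k, (wtNormSq g k).toReal ≤ C * ∫ ξ, ‖g ξ‖ ^ 2 := by
  rw [lintegral_enorm_sq_eq hg, ← ENNReal.ofReal_mul hC] at h
  have hfin : ∀ k, wtNormSq g k ≠ ⊤ := fun k => by
    have := h {k}
    rw [Finset.sum_singleton] at this
    exact (this.trans_lt ENNReal.ofReal_lt_top).ne
  have h0 : 0 ≤ C * ∫ ξ, ‖g ξ‖ ^ 2 := mul_nonneg hC (integral_nonneg fun _ => by positivity)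
  have hK : ∀ K : Finset ℕ, ∑ k ∈ K, (wtNormSq g k).toReal ≤ C * ∫ ξ, ‖g ξ‖ ^ 2 := fun K => by
    rw [← ENNReal.toReal_sum fun k _ => hfin k]
    exact ENNReal.toReal_le_of_le_ofReal h0 (h K)
  exact ⟨hfin, summable_of_sum_le (fun _ => ENNReal.toReal_nonneg) hK,
    Real.tsum_le_of_sum_le (fun _ => ENNReal.toReal_nonneg) hK⟩

theorem norm_duhamel_sq_le {T t : ℝ} (ht : t ∈ Icc 0 T) {c : ℕ → ℝ → ℂ} {k : ℕ}
    (hc : Measurable (c k)) {g : ℝ → ℂ} (hcg : ∀ ξ, ‖c k ξ‖ ≤ ‖g ξ‖) (hk : wtNormSq g k ≠ ⊤) :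
    ‖duhamel c k t‖ ^ 2 ≤ (T + 2) ^ 2 *
      (∫⁻ η, ENNReal.ofReal (wt (2 * Real.pi * η) ^ 6)).toReal * (wtNormSq g k).toReal := by
  have hT : 0 ≤ T := ht.1.trans ht.2
  have h := enorm_duhamel_sq_le ht hc hcg
  have := ENNReal.toReal_mono (ENNReal.mul_ne_top
    (ENNReal.mul_ne_top (by simp) lintegral_wt_pow_six_ne_top) hk) h
  simpa [ENNReal.toReal_mul, ENNReal.toReal_pow, toReal_enorm,
    ENNReal.toReal_ofReal (show 0 ≤ T + 2 by positivity)] using this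

theorem sq_sqrt_add_le {x y : ℝ} (hx : 0 ≤ x) : (√x + y) ^ 2 ≤ 2 * x + 2 * y ^ 2 := by
  nlinarith [Real.sq_sqrt hx, sq_nonneg (√x - y)]

theorem enorm_add_pow_four_le (x y : ℂ) : ‖x + y‖ₑ ^ 4 ≤ 8 * (‖x‖ₑ ^ 4 + ‖y‖ₑ ^ 4) := by
  have h : ‖x + y‖ ^ 4 ≤ 8 * (‖x‖ ^ 4 + ‖y‖ ^ 4) := by
    refine (pow_le_pow_left₀ (norm_nonneg _) (norm_add_le x y) 4).trans ?_
    have := add_pow_le (norm_nonneg x) (norm_nonneg y) 4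
    norm_num at this
    linarith
  have h' := ENNReal.ofReal_le_ofReal h
  rw [ENNReal.ofReal_pow (norm_nonneg _), ENNReal.ofReal_mul (by norm_num),
    ENNReal.ofReal_add (by positivity) (by positivity), ENNReal.ofReal_pow (norm_nonneg _),
    ENNReal.ofReal_pow (norm_nonneg _)] at h'
  simpa using h'

/-- The Duhamel part is handled by the L⁴ inequality. The remainder r is summable in k uniformly in
t, so its exponential sum is bounded pointwise and hence in L⁴ of a bounded region. -/
theorem exists_goodFamily_of_duhamel (T : ℝ) (hT : 0 ≤ T) : ∃ C : ℝ, 0 < C ∧ ∀ (g : ℝ → ℂ),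
    Measurable g → MemLp g 2 → ∀ (c : ℕ → ℝ → ℂ) (r b : ℝ → ℕ → ℂ),
    (∀ k, Measurable (c k)) → (∀ k ξ, ‖c k ξ‖ ≤ ‖g ξ‖) →
    (∀ t ∈ Icc 0 T, ∀ k, ‖r t k‖ ≤ √(∫ ξ, ‖g ξ‖ ^ 2) * ((k : ℝ) + 1) ^ (-(3 / 2) : ℝ)) →
    (∀ k, ContinuousOn (fun t => b t k) (Icc 0 T)) →
    (∀ t ∈ Icc 0 T, ∀ k, b t k = Complex.exp (Complex.I * freq k * t) * duhamel c k t + r t k) →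
    GoodFamily T (C * √(∫ ξ, ‖g ξ‖ ^ 2)) b := by
  obtain ⟨C₁, hC₁, hhi⟩ := exists_lintegral_duhamel_le T
  obtain ⟨C₂, hC₂, hwt⟩ := exists_sum_wtNormSq_le
  set J := (∫⁻ η, ENNReal.ofReal (wt (2 * Real.pi * η) ^ 6)).toReal with hJ
  have hJ0 : 0 ≤ J := ENNReal.toReal_nonneg
  set a : ℕ → ℝ := fun k => ((k : ℝ) + 1) ^ (-(3 / 2) : ℝ) with ha
  have ha0 : ∀ k, 0 ≤ a k := fun k => by positivity
  have ha1 : ∀ k, a k ≤ 1 := fun k =>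
    Real.rpow_le_one_of_one_le_of_nonpos (by linarith [k.cast_nonneg (α := ℝ)]) (by norm_num)
  have hsa : Summable a := summable_rpow_three_halves
  have hsa2 : Summable fun k => a k ^ 2 :=
    hsa.of_nonneg_of_le (fun _ => by positivity) fun k => by nlinarith [ha0 k, ha1 k]
  set A₁ := ∑' k, a k
  set A₂ := ∑' k, a k ^ 2
  have hA₁ : 0 ≤ A₁ := tsum_nonneg ha0
  have hA₂ : 0 ≤ A₂ := tsum_nonneg fun _ => by positivity
  set D := (T + 2) ^ 2 * J with hD
  have hD0 : 0 ≤ D := by positivity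
  -- The 8 comes from |x+y|⁴ ≤ 8(|x|⁴+|y|⁴), and 48T = 8·6T with 6T the area of (-3,3)×(0,T).
  set Q := 8 * C₁ ^ 2 + 48 * T * A₁ ^ 4 with hQ
  have hQ0 : 0 ≤ Q := by positivity
  refine ⟨√(2 * (D * C₂) + 2 * A₂) + (Q + 1), by positivity, fun g hg hg2 c r b hc hcg hr hb hbe => ?_⟩
  set G := √(∫ ξ, ‖g ξ‖ ^ 2) with hG
  have hG0 : 0 ≤ G := Real.sqrt_nonneg _
  have hG2 : G ^ 2 = ∫ ξ, ‖g ξ‖ ^ 2 := Real.sq_sqrt (integral_nonneg fun _ => by positivity)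
  obtain ⟨hfin, hqs, hqt⟩ := wtNormSq_le (hwt g hg) hC₂.le hg2
  rw [← hG2] at hqt
  refine ⟨hb, ⟨fun k => √(D * (wtNormSq g k).toReal) + G * a k, ?_, ?_, ?_⟩, ?_⟩
  · intro t ht k
    rw [hbe t ht k]
    refine (norm_add_le _ _).trans (add_le_add ?_ (hr t ht k))
    rw [norm_mul, norm_exp_I_mul_mul, one_mul]
    exact Real.le_sqrt_of_sq_le (norm_duhamel_sq_le ht (hc k) (hcg k) (hfin k))
  · refine Summable.of_nonneg_of_le (fun _ => by positivity) (fun k => sq_sqrt_add_le ?_)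
      (((hqs.mul_left D).mul_left 2).add (((hsa2.mul_left (G ^ 2)).congr fun k => ?_).mul_left 2))
    · positivity
    · ring
  · have hs2 : Summable fun k => 2 * (D * (wtNormSq g k).toReal) + 2 * (G ^ 2 * a k ^ 2) :=
      ((hqs.mul_left D).mul_left 2).add ((hsa2.mul_left (G ^ 2)).mul_left 2)
    have hle : ∀ k, (√(D * (wtNormSq g k).toReal) + G * a k) ^ 2 ≤
        2 * (D * (wtNormSq g k).toReal) + 2 * (G ^ 2 * a k ^ 2) := fun k => by
      rw [← mul_pow]; exact sq_sqrt_add_le (by positivity)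
    have h1 : ∑' k, (√(D * (wtNormSq g k).toReal) + G * a k) ^ 2 ≤
        (2 * (D * C₂) + 2 * A₂) * G ^ 2 := by
      refine ((hs2.of_nonneg_of_le (fun _ => by positivity) hle).tsum_le_tsum hle hs2).trans ?_
      rw [((hqs.mul_left D).mul_left 2).tsum_add ((hsa2.mul_left (G ^ 2)).mul_left 2),
        tsum_mul_left, tsum_mul_left, tsum_mul_left, tsum_mul_left]
      have := mul_le_mul_of_nonneg_left hqt hD0
      nlinarith
    calc _ ≤ √((2 * (D * C₂) + 2 * A₂) * G ^ 2) := Real.sqrt_le_sqrt h1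
      _ = √(2 * (D * C₂) + 2 * A₂) * G := by
        rw [Real.sqrt_mul (by positivity), Real.sqrt_sq hG0]
      _ ≤ _ := by gcongr; linarith
  · intro N μ hμ
    set ρ := (volume.restrict (Ioo (-3 : ℝ) 3)).prod (volume.restrict (Ioo (0 : ℝ) T)) with hρ
    have haez : ∀ᵐ z ∂ρ, z.2 ∈ Icc 0 T := by
      refine Measure.quasiMeasurePreserving_snd.ae ?_
      filter_upwards [ae_restrict_mem measurableSet_Ioo] with t ht using Ioo_subset_Icc_self ht
    -- Multipliers of modulus at most 1 are absorbed into the densities, whose domination by g is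
    -- unchanged.
    let c' : ℕ → ℝ → ℂ := fun k ξ => μ k * c k ξ
    have hc' : ∀ k, Measurable (c' k) := fun k => (hc k).const_mul _
    have hcg' : ∀ k ξ, ‖c' k ξ‖ ≤ ‖g ξ‖ := fun k ξ => by
      rw [norm_mul]
      exact (mul_le_of_le_one_left (norm_nonneg _) (hμ k)).trans (hcg k ξ)
    have hdu : ∀ k t, duhamel c' k t = μ k * duhamel c k t := fun k t => by
      simp only [duhamel, c', mul_assoc, integral_const_mul]
    have h1 := hhi g hg hg2 c' hc' hcg' N
    have hρu : ρ univ = ENNReal.ofReal (6 * T) := by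
      rw [hρ, ← univ_prod_univ, Measure.prod_prod]
      simp only [Measure.restrict_apply_univ, Real.volume_Ioo]
      rw [← ENNReal.ofReal_mul (by norm_num)]
      norm_num
    have h2 : ∫⁻ z, ‖∑ k ∈ Finset.range N, μ k * b z.2 k * expE k z.1‖ₑ ^ 4 ∂ρ ≤
        ENNReal.ofReal (Q * G ^ 4) := by
      calc _ ≤ ∫⁻ z, (8 * ‖∑ k ∈ Finset.range N, Complex.exp (Complex.I * freq k * z.2) *
            duhamel c' k z.2 * expE k z.1‖ₑ ^ 4 + ENNReal.ofReal (8 * (G * A₁) ^ 4)) ∂ρ := by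
            refine lintegral_mono_ae ?_
            filter_upwards [haez] with z hz
            have e : ∑ k ∈ Finset.range N, μ k * b z.2 k * expE k z.1 =
                ∑ k ∈ Finset.range N, Complex.exp (Complex.I * freq k * z.2) *
                  duhamel c' k z.2 * expE k z.1 +
                ∑ k ∈ Finset.range N, μ k * r z.2 k * expE k z.1 := by
              rw [← Finset.sum_add_distrib]
              refine Finset.sum_congr rfl fun k _ => ?_
              rw [hbe _ hz, hdu]; ring
            rw [e]
            refine (enorm_add_pow_four_le _ _).trans ?_
            rw [mul_add]
            gcongr
            rw [ENNReal.ofReal_mul (by norm_num), ENNReal.ofReal_pow (by positivity),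
              ENNReal.ofReal_ofNat]
            gcongr
            rw [← ofReal_norm]
            refine ENNReal.ofReal_le_ofReal ?_
            calc _ ≤ ∑ k ∈ Finset.range N, G * a k := by
                  refine (norm_sum_le _ _).trans (Finset.sum_le_sum fun k _ => ?_)
                  rw [norm_mul, norm_mul, norm_expE, mul_one]
                  exact (mul_le_of_le_one_left (norm_nonneg _) (hμ k)).trans (hr _ hz k)
              _ ≤ _ := by
                  rw [← Finset.mul_sum]
                  gcongr
                  exact hsa.sum_le_tsum _ fun k _ => ha0 k
        _ ≤ 8 * ENNReal.ofReal (C₁ * G ^ 2) ^ 2 + ENNReal.ofReal (8 * (G * A₁) ^ 4) *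
            ENNReal.ofReal (6 * T) := by
            rw [lintegral_add_right _ measurable_const, lintegral_const, hρu,
              lintegral_const_mul' _ _ (by norm_num), hG2]
            gcongr
        _ = _ := by
            rw [← ENNReal.ofReal_pow (by positivity), ← ENNReal.ofReal_mul (by positivity),
              ← ENNReal.ofReal_ofNat 8, ← ENNReal.ofReal_mul (by norm_num),
              ← ENNReal.ofReal_add (by positivity) (by positivity)]
            congr 1
            rw [hQ]; ring
    rw [lintegral_enorm_pow_eq _ (by norm_num)] at h2
    have h3 : ENNReal.ofReal (Q * G ^ 4) ≤
        ENNReal.ofReal ((√(2 * (D * C₂) + 2 * A₂) + (Q + 1)) * G) ^ 4 := by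
      rw [← ENNReal.ofReal_pow (by positivity), mul_pow]
      refine ENNReal.ofReal_le_ofReal ?_
      gcongr
      have h4 : Q + 1 ≤ √(2 * (D * C₂) + 2 * A₂) + (Q + 1) := by
        linarith [Real.sqrt_nonneg (2 * (D * C₂) + 2 * A₂)]
      calc Q ≤ (Q + 1) ^ 1 := by linarith
        _ ≤ (Q + 1) ^ 4 := pow_le_pow_right₀ (by linarith) (by norm_num)
        _ ≤ _ := by gcongr
    exact (ENNReal.pow_le_pow_left_iff (by norm_num)).1 (h2.trans h3)

/-! ### The Fourier transform on `L¹ ∩ L²` -/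

/-- Both transforms give the same integrals against smooth compactly supported functions, because in
each case the transform can be moved to the test function. -/
theorem coeFn_fourier_toLp {f : ℝ → ℂ} (hf : Integrable f) (hf2 : MemLp f 2) :
    ⇑(𝓕 (hf2.toLp f) : Lp ℂ 2 (volume : Measure ℝ)) =ᵐ[volume] 𝓕 f := by
  have hcont : Continuous (𝓕 f) := VectorFourier.fourierIntegral_continuous
    Real.continuous_fourierChar (by exact continuous_inner) hf
  refine ae_eq_of_integral_contDiff_smul_eq ((Lp.memLp _).locallyIntegrable (by norm_num))
    hcont.locallyIntegrable fun g g_smooth g_cpt => ?_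
  have hg₁ : HasCompactSupport (Complex.ofRealCLM ∘ g) := g_cpt.comp_left rfl
  have hg₂ : ContDiff ℝ ∞ (Complex.ofRealCLM ∘ g) := by fun_prop
  set γ : 𝓢(ℝ, ℂ) := hg₁.toSchwartzMap hg₂ with hγ
  have hγg : ∀ x, γ x = (g x : ℂ) := fun x => rfl
  have h1 := congrArg (fun u : 𝓢'(ℝ, ℂ) => u γ) (Lp.fourier_toTemperedDistribution_eq (hf2.toLp f))
  simp only [TemperedDistribution.fourier_apply, Lp.toTemperedDistribution_apply] at h1
  have h2 : ∫ x, (𝓕 γ) x • (hf2.toLp f) x = ∫ x, (𝓕 γ) x • f x := by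
    refine integral_congr_ae ?_
    filter_upwards [hf2.coeFn_toLp] with x hx
    rw [hx]
  have h3 : ∫ x, (𝓕 (γ : ℝ → ℂ)) x • f x = ∫ x, γ x • (𝓕 f) x := by
    have := VectorFourier.integral_fourierIntegral_smul_eq_flip (L := innerₗ ℝ)
      (f := (γ : ℝ → ℂ)) (g := f) Real.continuous_fourierChar (by exact continuous_inner)
      (γ.integrable (μ := volume)) hf
    rwa [flip_innerₗ] at this
  rw [h2, SchwartzMap.fourier_coe, h3] at h1
  simpa only [hγg, Complex.coe_smul] using h1.symm

theorem coeFn_fourierInv_toLp {f : ℝ → ℂ} (hf : Integrable f) (hf2 : MemLp f 2) :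
    ⇑(𝓕⁻ (hf2.toLp f) : Lp ℂ 2 (volume : Measure ℝ)) =ᵐ[volume] 𝓕⁻ f := by
  have hcont : Continuous (𝓕⁻ f) := VectorFourier.fourierIntegral_continuous
    Real.continuous_fourierChar (by exact (continuous_inner (𝕜 := ℝ) (E := ℝ)).neg) hf
  refine ae_eq_of_integral_contDiff_smul_eq ((Lp.memLp _).locallyIntegrable (by norm_num))
    hcont.locallyIntegrable fun g g_smooth g_cpt => ?_
  have hg₁ : HasCompactSupport (Complex.ofRealCLM ∘ g) := g_cpt.comp_left rfl
  have hg₂ : ContDiff ℝ ∞ (Complex.ofRealCLM ∘ g) := by fun_prop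
  set γ : 𝓢(ℝ, ℂ) := hg₁.toSchwartzMap hg₂ with hγ
  have hγg : ∀ x, γ x = (g x : ℂ) := fun x => rfl
  have h1 := congrArg (fun u : 𝓢'(ℝ, ℂ) => u γ)
    (Lp.fourierInv_toTemperedDistribution_eq (hf2.toLp f))
  simp only [TemperedDistribution.fourierInv_apply, Lp.toTemperedDistribution_apply] at h1
  have h2 : ∫ x, (𝓕⁻ γ) x • (hf2.toLp f) x = ∫ x, (𝓕⁻ γ) x • f x := by
    refine integral_congr_ae ?_
    filter_upwards [hf2.coeFn_toLp] with x hx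
    rw [hx]
  have h3 : ∫ x, (𝓕⁻ (γ : ℝ → ℂ)) x • f x = ∫ x, γ x • (𝓕⁻ f) x := by
    have := VectorFourier.integral_fourierIntegral_smul_eq_flip (L := -innerₗ ℝ)
      (f := (γ : ℝ → ℂ)) (g := f) Real.continuous_fourierChar
      (by exact (continuous_inner (𝕜 := ℝ) (E := ℝ)).neg) (γ.integrable (μ := volume)) hf
    have hflip : (-innerₗ ℝ : ℝ →ₗ[ℝ] ℝ →ₗ[ℝ] ℝ).flip = -innerₗ ℝ := by
      ext; simp
    rwa [hflip] at this
  rw [h2, SchwartzMap.fourierInv_coe, h3] at h1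
  simpa only [hγg, Complex.coe_smul] using h1.symm

/-- Parseval for F and the indicator of (0,t] times e^{iwτ}; the conjugate of the transform of the
latter is the kernel. -/
theorem integral_exp_mul_eq_integral_fourier (F : Lp ℂ 2 (volume : Measure ℝ)) (w : ℝ) {t : ℝ}
    (ht : 0 ≤ t) :
    ∫ τ in (0 : ℝ)..t, Complex.exp (-(Complex.I * w * τ)) * F τ =
      ∫ ξ, (𝓕 F : Lp ℂ 2 (volume : Measure ℝ)) ξ * kern (2 * Real.pi * ξ - w) t := by
  let φ : ℝ → ℂ := (Ioc 0 t).indicator fun τ => Complex.exp (Complex.I * w * τ)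
  have hφm : AEStronglyMeasurable φ volume :=
    (Continuous.aestronglyMeasurable (by fun_prop)).indicator measurableSet_Ioc
  have hφ1 : Integrable φ := by
    rw [integrable_indicator_iff measurableSet_Ioc]
    exact (Continuous.integrableOn_Icc (by fun_prop)).mono_set Ioc_subset_Icc_self
  have hφ2 : MemLp φ 2 := by
    refine (memLp_indicator_iff_restrict measurableSet_Ioc).2 ?_
    refine MemLp.of_bound (C := 1) (Continuous.aestronglyMeasurable (by fun_prop))
      (ae_of_all _ fun τ => ?_)
    rw [norm_exp_I_mul_mul]
  have h := Lp.inner_fourier_eq (hφ2.toLp φ) F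
  rw [L2.inner_def, L2.inner_def] at h
  have hr : ∫ a, inner ℂ ((hφ2.toLp φ) a) (F a) =
      ∫ τ in (0 : ℝ)..t, Complex.exp (-(Complex.I * w * τ)) * F τ := by
    rw [intervalIntegral.integral_of_le ht, ← integral_indicator measurableSet_Ioc]
    refine integral_congr_ae ?_
    filter_upwards [hφ2.coeFn_toLp] with τ hτ
    rw [hτ, RCLike.inner_apply]
    by_cases hm : τ ∈ Ioc 0 t
    · simp only [φ, indicator_of_mem hm]
      rw [← Complex.exp_conj, mul_comm]
      simp
    · simp [φ, indicator_of_notMem hm]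
  rw [← hr, ← h]
  refine integral_congr_ae ?_
  filter_upwards [coeFn_fourier_toLp hφ1 hφ2] with ξ hξ
  rw [hξ, RCLike.inner_apply]
  congr 1
  rw [Real.fourier_eq', ← integral_conj, kern, intervalIntegral.integral_of_le ht,
    ← integral_indicator measurableSet_Ioc]
  refine integral_congr_ae (ae_of_all _ fun τ => ?_)
  by_cases hm : τ ∈ Ioc 0 t
  · simp only [φ, indicator_of_mem hm, smul_eq_mul]
    rw [← Complex.exp_add, ← Complex.exp_conj]
    congr 1
    simp [show (starRingEnd ℂ) 2 = 2 from map_ofNat _ 2]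
    ring
  · simp [φ, indicator_of_notMem hm]

/-! ### Extensions in the Bessel potential space -/

/-- The Bessel weight `(1 + ξ²)^{σ/2}`. -/
def jap (σ ξ : ℝ) : ℝ := (1 + ξ ^ 2) ^ (σ / 2)

theorem jap_pos (σ ξ : ℝ) : 0 < jap σ ξ := by unfold jap; positivity

/-- The relation is inverted first: the symbol of order -σ is bounded, so the product with it stays
in L², and L² functions are determined by their distributions. -/
theorem coeFn_fourier_of_besselPotential {σ : ℝ} (hσ : 0 ≤ σ)
    {F g : Lp ℂ 2 (volume : Measure ℝ)}
    (h : TemperedDistribution.besselPotential ℝ ℂ σ (F : 𝓢'(ℝ, ℂ)) = (g : 𝓢'(ℝ, ℂ))) :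
    ⇑(𝓕 F : Lp ℂ 2 (volume : Measure ℝ)) =ᵐ[volume]
      fun ξ => (jap (-σ) ξ : ℂ) * (𝓕 g : Lp ℂ 2 (volume : Measure ℝ)) ξ := by
  have h1 : TemperedDistribution.besselPotential ℝ ℂ (-σ) (g : 𝓢'(ℝ, ℂ)) = (F : 𝓢'(ℝ, ℂ)) :=
    (TemperedDistribution.besselPotential_neg_apply_eq_iff σ _ _).2 h
  have h2 := congrArg (𝓕 : 𝓢'(ℝ, ℂ) → 𝓢'(ℝ, ℂ)) h1
  rw [TemperedDistribution.fourier_besselPotential_eq_smulLeftCLM_fourier_apply,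
    Lp.fourier_toTemperedDistribution_eq, Lp.fourier_toTemperedDistribution_eq] at h2
  have htg : Function.HasTemperateGrowth
      (fun x : ℝ => (((1 + ‖x‖ ^ 2) ^ (-σ / 2) : ℝ) : ℂ)) := by fun_prop
  have hb : MemLp (fun x : ℝ => (((1 + ‖x‖ ^ 2) ^ (-σ / 2) : ℝ) : ℂ)) ⊤ := by
    refine memLp_top_of_bound htg.1.continuous.aestronglyMeasurable 1 (ae_of_all _ fun x => ?_)
    rw [Complex.norm_real, Real.norm_of_nonneg (by positivity)]
    exact Real.rpow_le_one_of_one_le_of_nonpos (by nlinarith [sq_nonneg ‖x‖]) (by linarith)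
  rw [← Lp.toTemperedDistribution_smul_eq (p := ⊤) (q := 2) (r := 2) htg hb] at h2
  have h3 : (hb.toLp _) • (𝓕 g : Lp ℂ 2 (volume : Measure ℝ)) =
      (𝓕 F : Lp ℂ 2 (volume : Measure ℝ)) := by
    have hk := LinearMap.ker_eq_bot.1
      (Lp.ker_toTemperedDistributionCLM_eq_bot (F := ℂ) (μ := (volume : Measure ℝ)) (p := 2))
    exact hk h2
  rw [← h3]
  filter_upwards [Lp.coeFn_lpSMul (r := 2) (hb.toLp _) (𝓕 g : Lp ℂ 2 (volume : Measure ℝ)),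
    hb.coeFn_toLp] with ξ h4 h5
  rw [h4, Pi.smul_apply', h5, smul_eq_mul, jap]
  simp

theorem jap_mul (a b ξ : ℝ) : jap a ξ * jap b ξ = jap (a + b) ξ := by
  rw [jap, jap, jap, ← Real.rpow_add (by positivity)]
  congr 1; ring

theorem jap_le_rpow {a : ℝ} (ha : 0 ≤ a) (ξ : ℝ) : jap a ξ ≤ (1 + |ξ|) ^ a := by
  have h : 1 + ξ ^ 2 ≤ (1 + |ξ|) ^ 2 := by nlinarith [sq_abs ξ, abs_nonneg ξ]
  calc jap a ξ ≤ ((1 + |ξ|) ^ 2) ^ (a / 2) := by unfold jap; gcongr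
    _ = (1 + |ξ|) ^ a := by
      rw [← Real.rpow_natCast, ← Real.rpow_mul (by positivity)]
      congr 1; push_cast; ring

theorem jap_le_rpow_of_nonpos {a W ξ : ℝ} (ha : a ≤ 0) (hW : 0 < W) (h : W ≤ |ξ|) :
    jap a ξ ≤ W ^ a := by
  have h1 : W ^ 2 ≤ 1 + ξ ^ 2 := by nlinarith [sq_abs ξ, abs_nonneg ξ]
  calc jap a ξ ≤ (W ^ 2) ^ (a / 2) :=
        Real.rpow_le_rpow_of_nonpos (by positivity) h1 (by linarith)
    _ = W ^ a := by
      rw [← Real.rpow_natCast, ← Real.rpow_mul hW.le]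
      congr 1; push_cast; ring

theorem abs_le_jap_one (ξ : ℝ) : |ξ| ≤ jap 1 ξ := by
  rw [jap, ← Real.sqrt_eq_rpow]
  exact Real.abs_le_sqrt (by linarith)

theorem jap_neg_le_one {σ : ℝ} (hσ : 0 ≤ σ) (ξ : ℝ) : jap (-σ) ξ ≤ 1 :=
  Real.rpow_le_one_of_one_le_of_nonpos (by nlinarith [sq_nonneg ξ]) (by linarith)

theorem continuous_jap (σ : ℝ) : Continuous (jap σ) := by
  unfold jap
  exact Continuous.rpow_const (by fun_prop) fun ξ => Or.inl (by positivity)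

/-- An exponent α > 1/2 is needed here, and α < 3/4 to make the resulting remainders (k+1)^{-4(1-α)}
summable; 5/8 lies midway. It corresponds to the threshold s = 3/2. -/
theorem memLp_jap : MemLp (jap (-(5 / 8))) 2 := by
  refine (memLp_two_iff_integrable_sq_norm (continuous_jap _).aestronglyMeasurable).2 ?_
  have h := integrable_rpow_neg_one_add_norm_sq (E := ℝ) (μ := volume) (r := 5 / 4)
    (by simp; norm_num)
  refine h.congr (ae_of_all _ fun ξ => ?_)
  simp only [Real.norm_eq_abs, sq_abs]
  rw [sq (jap _ _), jap_mul, jap]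
  norm_num

/-- The fourth power `(k+1)⁴`, so that the time frequency is `π⁴ (k+1)⁴`. -/
def quart (k : ℕ) : ℝ := ((k : ℝ) + 1) ^ 4

theorem one_le_quart (k : ℕ) : 1 ≤ quart k := one_le_pow₀ (by linarith [k.cast_nonneg (α := ℝ)])

theorem freq_eq (k : ℕ) : freq k = Real.pi ^ 4 * quart k := by
  unfold freq quart; ring

theorem quart_rpow (k : ℕ) (a : ℝ) : quart k ^ a = ((k : ℝ) + 1) ^ (4 * a) := by
  have : (0 : ℝ) ≤ (k : ℝ) + 1 := by positivity
  rw [quart, ← Real.rpow_natCast, ← Real.rpow_mul this]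
  norm_num

theorem quart_le_abs {k : ℕ} {ξ : ℝ} (h : freq k / 2 ≤ |2 * Real.pi * ξ|) : quart k ≤ |ξ| := by
  have hpi := Real.pi_gt_three
  rw [abs_mul, abs_of_pos (by positivity : 0 < 2 * Real.pi), freq_eq] at h
  have h0 := one_le_quart k
  have h3 : 27 * quart k ≤ Real.pi ^ 3 * quart k := by
    gcongr
    nlinarith [pow_le_pow_left₀ (by norm_num) hpi.le 3]
  have h4 : Real.pi ^ 3 * quart k ≤ 4 * |ξ| := by
    have : Real.pi * (Real.pi ^ 3 * quart k) ≤ Real.pi * (4 * |ξ|) := by nlinarith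
    exact le_of_mul_le_mul_left this (by positivity)
  linarith

theorem abs_le_quart {k : ℕ} {ξ : ℝ} (h : |2 * Real.pi * ξ| < freq k / 2) :
    1 + |ξ| ≤ 17 * quart k := by
  have hpi := Real.pi_gt_three
  have hpi4 := Real.pi_le_four
  rw [abs_mul, abs_of_pos (by positivity : 0 < 2 * Real.pi), freq_eq] at h
  have h0 := one_le_quart k
  have h3 : Real.pi ^ 3 * quart k ≤ 64 * quart k := by
    gcongr
    nlinarith [pow_le_pow_left₀ (by positivity) hpi4 3]
  have h4 : 4 * |ξ| ≤ Real.pi ^ 3 * quart k := by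
    have : Real.pi * (4 * |ξ|) ≤ Real.pi * (Real.pi ^ 3 * quart k) := by nlinarith
    exact le_of_mul_le_mul_left this (by positivity)
  linarith

/-- `F`, with `(1 - (2π)⁻²∂²)^{σ/2} F = g`, is an extension of `h` from `I` to an element of
`H^σ(ℝ)`. -/
structure IsExtension (σ : ℝ) (I : Set ℝ) (h : ℝ → ℂ) (F g : Lp ℂ 2 (volume : Measure ℝ)) :
    Prop where
  ae_eq : F =ᵐ[volume.restrict I] h
  bessel : TemperedDistribution.besselPotential ℝ ℂ σ (F : 𝓢'(ℝ, ℂ)) = (g : 𝓢'(ℝ, ℂ))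

/-- The Fourier transform of the function `g ∈ L²`. -/
abbrev ftL2 (g : Lp ℂ 2 (volume : Measure ℝ)) : Lp ℂ 2 (volume : Measure ℝ) := 𝓕 g

theorem integral_norm_sq_ftL2 (g : Lp ℂ 2 (volume : Measure ℝ)) :
    √(∫ ξ, ‖ftL2 g ξ‖ ^ 2) = ‖g‖ := by
  have h := Lp.norm_fourier_eq g
  rw [← h, Lp.norm_def, eLpNorm_eq_lintegral_rpow_enorm_toReal (by norm_num) (by norm_num)]
  have h2 := lintegral_enorm_sq_eq (Lp.memLp (ftL2 g))
  simp only [ENNReal.toReal_ofNat, ENNReal.rpow_ofNat]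
  rw [h2, ← ENNReal.toReal_rpow, ENNReal.toReal_ofReal (integral_nonneg fun _ => by positivity),
    Real.sqrt_eq_rpow]

theorem IsExtension.ae_eq_Ioc {σ T : ℝ} {h : ℝ → ℂ} {F g : Lp ℂ 2 (volume : Measure ℝ)}
    (H : IsExtension σ (Ioo 0 T) h F g) : F =ᵐ[volume.restrict (Ioc 0 T)] h := by
  rw [← restrict_Ioo_eq_restrict_Ioc]; exact H.ae_eq

theorem IsExtension.integral_exp_mul {σ T : ℝ} {h : ℝ → ℂ} {F g : Lp ℂ 2 (volume : Measure ℝ)}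
    (hσ : 0 ≤ σ) (H : IsExtension σ (Ioo 0 T) h F g) (w : ℝ) {t : ℝ} (ht : t ∈ Icc 0 T) :
    ∫ τ in (0 : ℝ)..t, Complex.exp (-(Complex.I * w * τ)) * h τ =
      ∫ ξ, (jap (-σ) ξ : ℂ) * ftL2 g ξ * kern (2 * Real.pi * ξ - w) t := by
  have h1 : ∫ τ in (0 : ℝ)..t, Complex.exp (-(Complex.I * w * τ)) * h τ =
      ∫ τ in (0 : ℝ)..t, Complex.exp (-(Complex.I * w * τ)) * F τ := by
    rw [intervalIntegral.integral_of_le ht.1, intervalIntegral.integral_of_le ht.1]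
    refine integral_congr_ae ?_
    have := ae_mono (Measure.restrict_mono (Ioc_subset_Ioc_right ht.2) le_rfl) H.ae_eq_Ioc
    filter_upwards [this] with τ hτ
    rw [hτ]
  rw [h1, integral_exp_mul_eq_integral_fourier F w ht.1]
  refine integral_congr_ae ?_
  filter_upwards [coeFn_fourier_of_besselPotential hσ H.bessel] with ξ hξ
  rw [hξ]

theorem coeffW2_succ_eq (h : ℝ → ℂ) (t : ℝ) (k : ℕ) :
    coeffW2 h t (k + 1) = -2 * Complex.I * Real.pi * ((k : ℂ) + 1) *
      (Complex.exp (Complex.I * freq k * t) *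
        ∫ τ in (0 : ℝ)..t, Complex.exp (-(Complex.I * freq k * τ)) * h τ) := by
  rw [coeffW2]
  have : ∀ τ : ℝ, Complex.exp (Complex.I * (((k + 1 : ℕ) : ℂ) * Real.pi) ^ 4 * (t - τ)) * h τ =
      Complex.exp (Complex.I * freq k * t) *
        (Complex.exp (-(Complex.I * freq k * τ)) * h τ) := fun τ => by
    rw [← mul_assoc, ← Complex.exp_add]
    congr 2
    simp only [freq]; push_cast; ring
  simp_rw [this]
  rw [intervalIntegral.integral_const_mul]
  push_cast; ring

theorem IsExtension.continuousOn_coeffW2 {σ T : ℝ} (hT : 0 ≤ T) {h : ℝ → ℂ}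
    {F g : Lp ℂ 2 (volume : Measure ℝ)} (H : IsExtension σ (Ioo 0 T) h F g) (k : ℕ) :
    ContinuousOn (fun t => coeffW2 h t (k + 1)) (Icc 0 T) := by
  simp_rw [coeffW2_succ_eq]
  refine ContinuousOn.mul (by fun_prop) (ContinuousOn.mul (by fun_prop) ?_)
  have hF : IntegrableOn F (Icc 0 T) :=
    ((Lp.memLp F).locallyIntegrable (by norm_num)).integrableOn_isCompact isCompact_Icc
  have hint : IntegrableOn (fun τ : ℝ => Complex.exp (-(Complex.I * freq k * τ)) * h τ) (Icc 0 T) := by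
    rw [integrableOn_Icc_iff_integrableOn_Ioc]
    have h1 : IntegrableOn (fun τ : ℝ => Complex.exp (-(Complex.I * freq k * τ)) * F τ) (Ioc 0 T) := by
      refine Integrable.bdd_mul (c := 1) (hF.mono_set Ioc_subset_Icc_self)
        (Continuous.aestronglyMeasurable (by fun_prop)) (ae_of_all _ fun τ => ?_)
      have := norm_exp_I_mul_mul (-freq k) τ
      push_cast at this
      rw [← this]
      apply le_of_eq; congr 2; ring
    refine h1.congr ?_
    filter_upwards [H.ae_eq_Ioc] with τ hτ
    rw [hτ]
  have := intervalIntegral.continuousOn_primitive_interval (a := 0) (b := T) (μ := volume)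
    (by rwa [uIcc_of_le hT])
  rwa [uIcc_of_le hT] at this

theorem integral_jap_mul_le {g : ℝ → ℂ} (hg2 : MemLp g 2) :
    ∫ ξ, jap (-(5 / 8)) ξ * ‖g ξ‖ ≤
      √(∫ ξ, jap (-(5 / 8)) ξ ^ 2) * √(∫ ξ, ‖g ξ‖ ^ 2) := by
  have h := integral_mul_le_Lp_mul_Lq_of_nonneg (μ := volume) Real.HolderConjugate.two_two
    (f := jap (-(5 / 8))) (g := fun ξ => ‖g ξ‖) (ae_of_all _ fun ξ => (jap_pos _ ξ).le)
    (ae_of_all _ fun ξ => norm_nonneg _) (by simpa using memLp_jap) (by simpa using hg2.norm)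
  simpa [Real.sqrt_eq_rpow] using h

/-- The power -3/8 of (k+1)⁴ is the summable (k+1)^{-3/2}, and Cauchy-Schwarz against (1+ξ²)^{-5/16}
turns the integrated remainder into a multiple of the L² norm of g. -/
theorem exists_goodFamily_of_split {T : ℝ} (hT : 0 ≤ T) {C₀ : ℝ} (hC₀ : 0 < C₀) :
    ∃ C : ℝ, 0 < C ∧ ∀ (g : ℝ → ℂ), Measurable g → MemLp g 2 →
    ∀ (c : ℕ → ℝ → ℂ) (m : ℝ → ℕ → ℝ → ℂ) (b : ℝ → ℕ → ℂ),
    (∀ k, Measurable (c k)) → (∀ k ξ, ‖c k ξ‖ ≤ C₀ * ‖g ξ‖) →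
    (∀ t ∈ Icc 0 T, ∀ k ξ, ‖m t k ξ‖ ≤
      C₀ * quart k ^ (-(3 / 8) : ℝ) * (jap (-(5 / 8)) ξ * ‖g ξ‖)) →
    (∀ k, ContinuousOn (fun t => b t k) (Icc 0 T)) →
    (∀ t ∈ Icc 0 T, ∀ k,
      b t k = Complex.exp (Complex.I * freq k * t) * duhamel c k t + ∫ ξ, m t k ξ) →
    GoodFamily T (C * √(∫ ξ, ‖g ξ‖ ^ 2)) b := by
  obtain ⟨C, hC, h⟩ := exists_goodFamily_of_duhamel T hT
  set J := √(∫ ξ, jap (-(5 / 8)) ξ ^ 2) with hJ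
  have hJ0 : 0 ≤ J := Real.sqrt_nonneg _
  -- Scaling g by M covers both requirements: the 1 dominates the densities and J dominates the
  -- remainder.
  set M := C₀ * (1 + J) with hM
  have hM0 : 0 < M := by positivity
  refine ⟨C * M, by positivity, fun g hg hg2 c m b hc hcg hm hb hbe => ?_⟩
  have hnorm : √(∫ ξ, ‖(M : ℂ) * g ξ‖ ^ 2) = M * √(∫ ξ, ‖g ξ‖ ^ 2) := by
    simp_rw [norm_mul, mul_pow, integral_const_mul]
    rw [Complex.norm_real, Real.norm_of_nonneg hM0.le, Real.sqrt_mul (by positivity),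
      Real.sqrt_sq hM0.le]
  have hMg : ∀ ξ, ‖(M : ℂ) * g ξ‖ = M * ‖g ξ‖ := fun ξ => by
    rw [norm_mul, Complex.norm_real, Real.norm_of_nonneg hM0.le]
  have := h (fun ξ => (M : ℂ) * g ξ) (hg.const_mul _) (hg2.const_mul _) c
    (fun t k => ∫ ξ, m t k ξ) b hc (fun k ξ => ?_) (fun t ht k => ?_) hb hbe
  · rwa [hnorm, ← mul_assoc] at this
  · rw [hMg]
    refine (hcg k ξ).trans ?_
    gcongr
    nlinarith
  · rw [hnorm]
    have hint : Integrable fun ξ => jap (-(5 / 8)) ξ * ‖g ξ‖ :=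
      memLp_jap.integrable_mul hg2.norm
    have h1 : ‖∫ ξ, m t k ξ‖ ≤ ∫ ξ, C₀ * quart k ^ (-(3 / 8) : ℝ) * (jap (-(5 / 8)) ξ * ‖g ξ‖) :=
      norm_integral_le_of_norm_le (hint.const_mul _) (ae_of_all _ fun ξ => hm t ht k ξ)
    rw [integral_const_mul] at h1
    have hq : quart k ^ (-(3 / 8) : ℝ) = ((k : ℝ) + 1) ^ (-(3 / 2) : ℝ) := by
      rw [quart_rpow]; norm_num
    rw [← hq]
    have hq0 : 0 ≤ quart k ^ (-(3 / 8) : ℝ) :=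
      Real.rpow_nonneg (by linarith [one_le_quart k]) _
    calc _ ≤ C₀ * quart k ^ (-(3 / 8) : ℝ) * (J * √(∫ ξ, ‖g ξ‖ ^ 2)) := by
          refine h1.trans ?_
          gcongr
          exact integral_jap_mul_le hg2
      _ = (C₀ * J) * √(∫ ξ, ‖g ξ‖ ^ 2) * quart k ^ (-(3 / 8) : ℝ) := by ring
      _ ≤ _ := by
          gcongr
          nlinarith

/-- The frequencies `ξ` at least comparable to `ω_k`. -/
def highFreq (k : ℕ) : Set ℝ := {ξ | freq k / 2 ≤ |2 * Real.pi * ξ|}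

theorem measurableSet_highFreq (k : ℕ) : MeasurableSet (highFreq k) :=
  measurableSet_le measurable_const (by fun_prop)

/-- The factor `-2πi (k+1) (k+1)^s`, where `4σ = 1 + s`. -/
def ampl (s : ℝ) (k : ℕ) : ℂ := -2 * Complex.I * Real.pi * ((k : ℂ) + 1) * (((k : ℝ) + 1) ^ s : ℝ)

theorem norm_ampl {s : ℝ} (hs : 0 ≤ s) (k : ℕ) : ‖ampl s k‖ = 2 * Real.pi * quart k ^ ((1 + s) / 4) := by
  have hk : (0 : ℝ) < (k : ℝ) + 1 := by positivity
  have h1 : ‖(k : ℂ) + 1‖ = (k : ℝ) + 1 := by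
    rw [← Complex.ofReal_natCast, ← Complex.ofReal_one, ← Complex.ofReal_add, Complex.norm_real,
      Real.norm_of_nonneg hk.le]
  rw [ampl, quart_rpow, norm_mul, norm_mul, h1, Complex.norm_real,
    Real.norm_of_nonneg (by positivity)]
  simp only [norm_mul, norm_neg, Complex.norm_I, Complex.norm_real,
    Real.norm_of_nonneg Real.pi_pos.le, RCLike.norm_ofNat]
  rw [mul_one, mul_assoc, ← Real.rpow_one_add' hk.le, show 4 * ((1 + s) / 4) = 1 + s by ring]
  linarith

/-- The high-frequency part of the integrand. -/
def highPart (s : ℝ) (γ : ℝ → ℂ) (k : ℕ) : ℝ → ℂ :=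
  (highFreq k).indicator fun ξ => ampl s k * ((jap (-((1 + s) / 4)) ξ : ℂ) * γ ξ)

theorem quart_rpow_mul_jap_le {a b : ℝ} (hb : b ≤ 0) {k : ℕ} {ξ : ℝ} (h : ξ ∈ highFreq k) :
    quart k ^ a * jap b ξ ≤ quart k ^ (a + b) := by
  have hq : 0 < quart k := by linarith [one_le_quart k]
  rw [Real.rpow_add hq]
  gcongr
  exact jap_le_rpow_of_nonpos hb hq (quart_le_abs h)

/-- At low frequencies 1+|ξ| ≤ 17(k+1)⁴, and 289 = 17². -/
theorem jap_le_of_notMem_highFreq {b : ℝ} (hb : 0 ≤ b) (hb2 : b ≤ 2) {k : ℕ} {ξ : ℝ}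
    (h : ξ ∉ highFreq k) : jap b ξ ≤ 289 * quart k ^ b := by
  have hq : 0 < quart k := by linarith [one_le_quart k]
  have h1 : 1 + |ξ| ≤ 17 * quart k := abs_le_quart (not_le.1 h)
  calc jap b ξ ≤ (1 + |ξ|) ^ b := jap_le_rpow hb ξ
    _ ≤ (17 * quart k) ^ b := by gcongr
    _ = 17 ^ b * quart k ^ b := Real.mul_rpow (by norm_num) hq.le
    _ ≤ _ := by
      gcongr
      calc (17 : ℝ) ^ b ≤ 17 ^ (2 : ℝ) := Real.rpow_le_rpow_of_exponent_le (by norm_num) hb2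
        _ = 289 := by norm_num

theorem norm_ofReal_jap (σ ξ : ℝ) : ‖(jap σ ξ : ℂ)‖ = jap σ ξ := by
  rw [Complex.norm_real, Real.norm_of_nonneg (jap_pos _ _).le]

/-- On the support |ξ| ≥ (k+1)⁴, so the Bessel weight of order (1+s)/4 cancels the growth
(k+1)^{1+s} of the amplitude and leaves 2π ≤ 8. -/
theorem norm_highPart_le {s : ℝ} (hs : 0 ≤ s) (γ : ℝ → ℂ) (k : ℕ) (ξ : ℝ) :
    ‖highPart s γ k ξ‖ ≤ 8 * ‖γ ξ‖ := by
  by_cases h : ξ ∈ highFreq k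
  · rw [highPart, indicator_of_mem h, norm_mul, norm_mul, norm_ampl hs, norm_ofReal_jap, ← mul_assoc,
      mul_assoc (2 * Real.pi)]
    have h1 := quart_rpow_mul_jap_le (a := (1 + s) / 4) (b := -((1 + s) / 4)) (by linarith) h
    rw [add_neg_cancel, Real.rpow_zero] at h1
    have hpi := Real.pi_le_four
    gcongr
    calc _ ≤ 2 * Real.pi * 1 := by have := Real.pi_pos; gcongr
      _ ≤ 8 := by linarith
  · rw [highPart, indicator_of_notMem h, norm_zero]
    positivity

theorem measurable_highPart {s : ℝ} {γ : ℝ → ℂ} (hγ : Measurable γ) (k : ℕ) :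
    Measurable (highPart s γ k) := by
  refine Measurable.indicator ?_ (measurableSet_highFreq k)
  have := (continuous_jap (-((1 + s) / 4))).measurable
  exact ((Complex.measurable_ofReal.comp this).mul hγ).const_mul _

theorem half_freq_le {k : ℕ} {ξ : ℝ} (h : ξ ∉ highFreq k) :
    freq k / 2 ≤ |2 * Real.pi * ξ - freq k| := by
  have h1 : |2 * Real.pi * ξ| < freq k / 2 := not_le.1 h
  have := (abs_lt.1 h1).2
  rw [abs_sub_comm]
  exact le_trans (by linarith) (le_abs_self _)

theorem quart_le_freq (k : ℕ) : 81 * quart k ≤ freq k := by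
  rw [freq_eq]
  have := one_le_quart k
  have := pow_le_pow_left₀ (by norm_num) Real.pi_gt_three.le 4
  norm_num at this
  gcongr

theorem exp_mul_kern {k : ℕ} {ξ : ℝ} (h : 2 * Real.pi * ξ - freq k ≠ 0) (t : ℝ) :
    Complex.exp (Complex.I * freq k * t) * kern (2 * Real.pi * ξ - freq k) t =
      (Complex.exp (Complex.I * (2 * Real.pi * ξ : ℝ) * t) -
        Complex.exp (Complex.I * freq k * t)) /
        (Complex.I * ((2 * Real.pi * ξ : ℝ) - freq k)) := by
  rw [kern_eq h, mul_div_assoc', mul_sub, ← Complex.exp_add, mul_one]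
  congr 3
  · push_cast; ring
  · push_cast; ring

theorem norm_exp_sub_exp_le (y w t : ℝ) :
    ‖Complex.exp (Complex.I * y * t) - Complex.exp (Complex.I * w * t)‖ ≤ 2 := by
  refine (norm_sub_le _ _).trans ?_
  rw [norm_exp_I_mul_mul, norm_exp_I_mul_mul]; norm_num

theorem memLp_kern_sub {T t : ℝ} (ht : t ∈ Icc 0 T) (w : ℝ) :
    MemLp (fun ξ => kern (2 * Real.pi * ξ - w) t) 2 := by
  have h := (memLp_kern ht).comp_measurePreserving
    (measurePreserving_sub_right volume (w / (2 * Real.pi)))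
  refine h.ae_eq (ae_of_all _ fun ξ => ?_)
  have := Real.pi_ne_zero
  simp only [Function.comp]
  congr 1
  field_simp

theorem memLp_jap_mul {σ : ℝ} (hσ : 0 ≤ σ) {γ : ℝ → ℂ} (hγ : MemLp γ 2) :
    MemLp (fun ξ => (jap (-σ) ξ : ℂ) * γ ξ) 2 := by
  refine hγ.of_le (AEStronglyMeasurable.mul ?_ hγ.1) (ae_of_all _ fun ξ => ?_)
  · exact (Complex.continuous_ofReal.comp (continuous_jap _)).aestronglyMeasurable
  · rw [norm_mul, norm_ofReal_jap]
    exact mul_le_of_le_one_left (norm_nonneg _) (jap_neg_le_one hσ ξ)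

/-- The high frequencies give the Duhamel part. At low frequencies |2πξ-ω_k| ≥ ω_k/2, so the kernel
gains a factor (k+1)⁻⁴. The vanishing of h at time 0 is not needed in this range. -/
theorem IsExtension.exists_goodFamily_low {T : ℝ} (hT : 0 ≤ T) {s : ℝ} (hs : 0 ≤ s)
    (hs2 : s ≤ 3 / 2) : ∃ C : ℝ, 0 < C ∧ ∀ (h : ℝ → ℂ) (F g : Lp ℂ 2 (volume : Measure ℝ)),
    IsExtension ((1 + s) / 4) (Ioo 0 T) h F g →
    GoodFamily T (C * ‖g‖) (fun t k => (((k : ℝ) + 1) ^ s : ℝ) * coeffW2 h t (k + 1)) := by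
  -- The constants that occur are 8 and 578π; any common upper bound will do.
  obtain ⟨C, hC, hgood⟩ := exists_goodFamily_of_split hT (C₀ := 10000) (by norm_num)
  refine ⟨C, hC, fun h F g H => ?_⟩
  rw [← integral_norm_sq_ftL2]
  set γ : ℝ → ℂ := ⇑(ftL2 g) with hγ
  have hγm : Measurable γ := (Lp.stronglyMeasurable _).measurable
  have hγ2 : MemLp γ 2 := Lp.memLp _
  refine hgood γ hγm hγ2 (highPart s γ)
    (fun t k ξ => Complex.exp (Complex.I * freq k * t) *
      (ampl s k * ((jap (-((1 + s) / 4)) ξ : ℂ) * γ ξ) * kern (2 * Real.pi * ξ - freq k) t -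
        highPart s γ k ξ * kern (2 * Real.pi * ξ - freq k) t)) _
    (fun k => measurable_highPart hγm k) (fun k ξ => ?_) (fun t ht k ξ => ?_)
    (fun k => (H.continuousOn_coeffW2 hT k).const_mul _) (fun t ht k => ?_)
  · refine (norm_highPart_le hs γ k ξ).trans ?_
    gcongr; norm_num
  · have hq : 0 < quart k := by linarith [one_le_quart k]
    by_cases hξ : ξ ∈ highFreq k
    · simp only [highPart, indicator_of_mem hξ, sub_self, mul_zero, norm_zero]
      have := jap_pos (-(5 / 8)) ξ
      positivity
    · simp only [highPart, indicator_of_notMem hξ, zero_mul, sub_zero]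
      have h81 := quart_le_freq k
      have hd := half_freq_le hξ
      have hne : 2 * Real.pi * ξ - freq k ≠ 0 := by
        intro h0
        rw [h0, abs_zero] at hd
        linarith
      rw [mul_left_comm, exp_mul_kern hne, norm_mul, norm_mul, norm_mul, norm_ampl hs,
        norm_ofReal_jap, norm_div, norm_mul, Complex.norm_I, one_mul, ← Complex.ofReal_sub,
        Complex.norm_real, Real.norm_eq_abs]
      have e1 : ‖Complex.exp (Complex.I * (2 * Real.pi * ξ : ℝ) * t) -
          Complex.exp (Complex.I * freq k * t)‖ / |2 * Real.pi * ξ - freq k| ≤ (quart k)⁻¹ := by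
        rw [div_le_iff₀ (by linarith), inv_mul_eq_div, le_div_iff₀ hq]
        calc _ ≤ 2 * quart k := by gcongr; exact norm_exp_sub_exp_le _ _ _
          _ ≤ _ := by linarith
      -- The weight of order σ is traded for the square-integrable one of order 5/8 at the price of
      -- (k+1)^{4(5/8-σ)}; here σ ≤ 5/8, that is s ≤ 3/2, is used.
      have e2 : jap (-((1 + s) / 4)) ξ ≤
          jap (-(5 / 8)) ξ * (289 * quart k ^ (5 / 8 - (1 + s) / 4)) := by
        rw [show -((1 + s) / 4) = -(5 / 8) + (5 / 8 - (1 + s) / 4) by ring, ← jap_mul]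
        have := jap_pos (-(5 / 8)) ξ
        gcongr
        exact jap_le_of_notMem_highFreq (by linarith) (by linarith) hξ
      have hpi := Real.pi_pos
      have hpi4 := Real.pi_le_four
      have hj := jap_pos (-(5 / 8)) ξ
      have e3 : quart k ^ ((1 + s) / 4) * quart k ^ (5 / 8 - (1 + s) / 4) * (quart k)⁻¹ =
          quart k ^ (-(3 / 8) : ℝ) := by
        rw [← Real.rpow_neg_one, ← Real.rpow_add hq, ← Real.rpow_add hq]
        congr 1; ring
      calc _ ≤ 2 * Real.pi * quart k ^ ((1 + s) / 4) * (jap (-(5 / 8)) ξ *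
            (289 * quart k ^ (5 / 8 - (1 + s) / 4)) * ‖γ ξ‖) * (quart k)⁻¹ := by gcongr
        _ = 578 * Real.pi * (quart k ^ ((1 + s) / 4) * quart k ^ (5 / 8 - (1 + s) / 4) *
            (quart k)⁻¹) * (jap (-(5 / 8)) ξ * ‖γ ξ‖) := by ring
        _ ≤ _ := by
            rw [e3]
            gcongr
            linarith
  · have hk := memLp_kern_sub ht (freq k)
    have i1 : Integrable fun ξ => ampl s k * ((jap (-((1 + s) / 4)) ξ : ℂ) * γ ξ) *
        kern (2 * Real.pi * ξ - freq k) t :=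
      ((memLp_jap_mul (by linarith) hγ2).const_mul _).integrable_mul hk
    have i2 : Integrable fun ξ => highPart s γ k ξ * kern (2 * Real.pi * ξ - freq k) t := by
      have : MemLp (highPart s γ k) 2 := (hγ2.norm.const_mul 8).of_le
        (measurable_highPart hγm k).aestronglyMeasurable (ae_of_all _ fun ξ => by
          refine (norm_highPart_le hs γ k ξ).trans (le_abs_self _))
      exact this.integrable_mul hk
    rw [integral_const_mul, integral_sub i1 i2, duhamel, mul_sub, add_sub_cancel,
      coeffW2_succ_eq, H.integral_exp_mul (by linarith) _ ht]
    simp_rw [mul_assoc (ampl s k), integral_const_mul]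
    rw [ampl]
    ring

/-! ### Continuous representatives in time and removal of the boundary term -/

/-- The continuous representative of an extension, at time `t`. -/
def extVal (σ : ℝ) (g : Lp ℂ 2 (volume : Measure ℝ)) (t : ℝ) : ℂ :=
  ∫ ξ, (jap (-σ) ξ : ℂ) * ftL2 g ξ * Complex.exp (Complex.I * (2 * Real.pi * ξ : ℝ) * t)

theorem jap_neg_le {σ : ℝ} (hσ : 5 / 8 ≤ σ) (ξ : ℝ) : jap (-σ) ξ ≤ jap (-(5 / 8)) ξ := by
  rw [show -σ = -(5 / 8) + -(σ - 5 / 8) by ring, ← jap_mul]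
  exact mul_le_of_le_one_right (jap_pos _ _).le (jap_neg_le_one (by linarith) ξ)

theorem integrable_jap_mul {σ : ℝ} (hσ : 5 / 8 ≤ σ) {γ : ℝ → ℂ} (hγ : MemLp γ 2) :
    Integrable fun ξ => (jap (-σ) ξ : ℂ) * γ ξ := by
  refine (memLp_jap.integrable_mul hγ.norm).mono' (AEStronglyMeasurable.mul ?_ hγ.1)
    (ae_of_all _ fun ξ => ?_)
  · exact (Complex.continuous_ofReal.comp (continuous_jap _)).aestronglyMeasurable
  · rw [norm_mul, norm_ofReal_jap]
    exact mul_le_mul_of_nonneg_right (jap_neg_le hσ ξ) (norm_nonneg _)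

theorem integrable_jap_mul_exp {σ : ℝ} (hσ : 5 / 8 ≤ σ) {γ : ℝ → ℂ} (hγ : MemLp γ 2) (t : ℝ) :
    Integrable fun ξ => (jap (-σ) ξ : ℂ) * γ ξ *
      Complex.exp (Complex.I * (2 * Real.pi * ξ : ℝ) * t) :=
  (integrable_jap_mul hσ hγ).mul_bdd (c := 1)
    (Continuous.aestronglyMeasurable (by fun_prop))
    (ae_of_all _ fun ξ => (norm_exp_I_mul_mul _ _).le)

theorem continuous_extVal {σ : ℝ} (hσ : 5 / 8 ≤ σ) (g : Lp ℂ 2 (volume : Measure ℝ)) :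
    Continuous (extVal σ g) := by
  refine continuous_of_dominated (bound := fun ξ => ‖(jap (-σ) ξ : ℂ) * ftL2 g ξ‖)
    (fun t => (integrable_jap_mul_exp hσ (Lp.memLp _) t).1) (fun t => ae_of_all _ fun ξ => ?_)
    (integrable_jap_mul hσ (Lp.memLp _)).norm (ae_of_all _ fun ξ => by fun_prop)
  rw [norm_mul _ (Complex.exp _), norm_exp_I_mul_mul, mul_one]

theorem exists_norm_extVal_le {σ : ℝ} (hσ : 5 / 8 ≤ σ) : ∃ C : ℝ, 0 < C ∧
    ∀ (g : Lp ℂ 2 (volume : Measure ℝ)) (t : ℝ), ‖extVal σ g t‖ ≤ C * ‖g‖ := by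
  refine ⟨√(∫ ξ, jap (-(5 / 8)) ξ ^ 2) + 1, by positivity, fun g t => ?_⟩
  have hγ : MemLp (ftL2 g) 2 := Lp.memLp _
  calc ‖extVal σ g t‖ ≤ ∫ ξ, jap (-(5 / 8)) ξ * ‖ftL2 g ξ‖ := by
        refine norm_integral_le_of_norm_le (memLp_jap.integrable_mul hγ.norm)
          (ae_of_all _ fun ξ => ?_)
        rw [norm_mul, norm_exp_I_mul_mul, mul_one, norm_mul, norm_ofReal_jap]
        exact mul_le_mul_of_nonneg_right (jap_neg_le hσ ξ) (norm_nonneg _)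
    _ ≤ √(∫ ξ, jap (-(5 / 8)) ξ ^ 2) * ‖g‖ := by
        rw [← integral_norm_sq_ftL2 g]
        exact integral_jap_mul_le hγ
    _ ≤ _ := by gcongr; linarith

/-- With y = 2πξ this is 1/(y-ω) + 1/ω = y/((y-ω)ω): adding the boundary term to the kernel replaces
one factor 1/ω by y/ω², a gain at low frequencies. -/
theorem low_freq_identity {k : ℕ} {ξ : ℝ} (h : 2 * Real.pi * ξ - freq k ≠ 0) (t : ℝ) :
    Complex.exp (Complex.I * freq k * t) * kern (2 * Real.pi * ξ - freq k) t +
      (Complex.exp (Complex.I * (2 * Real.pi * ξ : ℝ) * t) - Complex.exp (Complex.I * freq k * t)) /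
        (Complex.I * freq k) =
      (Complex.exp (Complex.I * (2 * Real.pi * ξ : ℝ) * t) - Complex.exp (Complex.I * freq k * t)) *
        (2 * Real.pi * ξ : ℝ) / (Complex.I * ((2 * Real.pi * ξ - freq k : ℝ) * freq k)) := by
  have hf : (freq k : ℂ) ≠ 0 := by
    have := one_le_freq k
    exact_mod_cast (by linarith : freq k ≠ 0)
  rw [exp_mul_kern h]
  have h' : ((2 * Real.pi * ξ : ℝ) : ℂ) - freq k ≠ 0 := by exact_mod_cast h
  have hI := Complex.I_ne_zero
  rw [Complex.ofReal_sub]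
  field_simp
  ring

/-- For `s ≥ 3/2` the coefficients satisfy the estimates after a multiple of `h(t) (k+1)⁻³` has been
subtracted. -/
theorem IsExtension.exists_goodFamily_high {T : ℝ} (hT : 0 ≤ T) {s : ℝ} (hs : 3 / 2 ≤ s)
    (hs4 : s ≤ 4) : ∃ C : ℝ, 0 < C ∧ ∀ (h : ℝ → ℂ) (F g : Lp ℂ 2 (volume : Measure ℝ)),
    IsExtension ((1 + s) / 4) (Ioo 0 T) h F g → extVal ((1 + s) / 4) g 0 = 0 →
    GoodFamily T (C * ‖g‖) (fun t k => (((k : ℝ) + 1) ^ s : ℝ) * (coeffW2 h t (k + 1) -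
      2 / Real.pi ^ 3 * extVal ((1 + s) / 4) g t / ((k : ℂ) + 1) ^ 3)) := by
  obtain ⟨C, hC, hgood⟩ := exists_goodFamily_of_split hT (C₀ := 10000) (by norm_num)
  refine ⟨C, hC, fun h F g H hq0 => ?_⟩
  have hs0 : 0 ≤ s := by linarith
  rw [← integral_norm_sq_ftL2]
  set γ : ℝ → ℂ := ⇑(ftL2 g) with hγ
  have hγm : Measurable γ := (Lp.stronglyMeasurable _).measurable
  have hγ2 : MemLp γ 2 := Lp.memLp _
  refine hgood γ hγm hγ2 (highPart s γ)
    (fun t k ξ => Complex.exp (Complex.I * freq k * t) *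
      (ampl s k * ((jap (-((1 + s) / 4)) ξ : ℂ) * γ ξ) * kern (2 * Real.pi * ξ - freq k) t -
        highPart s γ k ξ * kern (2 * Real.pi * ξ - freq k) t) +
      ampl s k / (Complex.I * freq k) *
        ((jap (-((1 + s) / 4)) ξ : ℂ) * γ ξ * Complex.exp (Complex.I * (2 * Real.pi * ξ : ℝ) * t) -
        (jap (-((1 + s) / 4)) ξ : ℂ) * γ ξ * Complex.exp (Complex.I * freq k * t))) _
    (fun k => measurable_highPart hγm k) (fun k ξ => ?_) (fun t ht k ξ => ?_)
    (fun k => ?_) (fun t ht k => ?_)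
  · refine (norm_highPart_le hs0 γ k ξ).trans ?_
    gcongr; norm_num
  · have hq : 0 < quart k := by linarith [one_le_quart k]
    have h81 := quart_le_freq k
    have hpi := Real.pi_pos
    have hpi4 := Real.pi_le_four
    have hj := jap_pos (-(5 / 8)) ξ
    have hfn : ‖(freq k : ℂ)‖ = freq k := by
      rw [Complex.norm_real, Real.norm_of_nonneg (by linarith)]
    have hqq : 0 ≤ quart k ^ (-(3 / 8) : ℝ) := Real.rpow_nonneg hq.le _
    by_cases hξ : ξ ∈ highFreq k
    · simp only [highPart, indicator_of_mem hξ, sub_self, mul_zero, zero_add]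
      rw [← mul_sub, norm_mul, norm_div, norm_ampl hs0, norm_mul Complex.I, Complex.norm_I, one_mul,
        hfn, norm_mul, norm_mul, norm_ofReal_jap]
      -- At high frequencies the boundary term itself must be estimated; σ ≥ 5/8 lets the surplus of
      -- the Bessel weight absorb the amplitude.
      have e1 : quart k ^ ((1 + s) / 4 - 1) * jap (-((1 + s) / 4)) ξ ≤
          jap (-(5 / 8)) ξ * quart k ^ (-(3 / 8) : ℝ) := by
        rw [show -((1 + s) / 4) = -(5 / 8) + (5 / 8 - (1 + s) / 4) by ring, ← jap_mul,
          mul_left_comm]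
        gcongr
        refine (quart_rpow_mul_jap_le (by linarith) hξ).trans (le_of_eq ?_)
        congr 1; ring
      have e2 : quart k ^ ((1 + s) / 4) / freq k ≤ quart k ^ ((1 + s) / 4 - 1) := by
        rw [Real.rpow_sub_one hq.ne']
        gcongr
        linarith
      calc _ ≤ 2 * Real.pi * quart k ^ ((1 + s) / 4) / freq k *
            (jap (-((1 + s) / 4)) ξ * ‖γ ξ‖ * 2) := by
            have := norm_exp_sub_exp_le (2 * Real.pi * ξ) (freq k) t
            have := jap_pos (-((1 + s) / 4)) ξ
            have : 0 < freq k := by linarith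
            gcongr
        _ = 4 * Real.pi * (quart k ^ ((1 + s) / 4) / freq k * jap (-((1 + s) / 4)) ξ) * ‖γ ξ‖ := by
            ring
        _ ≤ 4 * Real.pi * (jap (-(5 / 8)) ξ * quart k ^ (-(3 / 8) : ℝ)) * ‖γ ξ‖ := by
            have := jap_pos (-((1 + s) / 4)) ξ
            refine mul_le_mul_of_nonneg_right (mul_le_mul_of_nonneg_left ?_ (by positivity))
              (norm_nonneg _)
            exact (mul_le_mul_of_nonneg_right e2 this.le).trans e1
        _ = 4 * Real.pi * quart k ^ (-(3 / 8) : ℝ) * (jap (-(5 / 8)) ξ * ‖γ ξ‖) := by ring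
        _ ≤ _ := by
            gcongr
            linarith
    · simp only [highPart, indicator_of_notMem hξ, zero_mul, sub_zero]
      have hd := half_freq_le hξ
      have hne : 2 * Real.pi * ξ - freq k ≠ 0 := by
        intro h0
        rw [h0, abs_zero] at hd
        linarith
      have e0 : ∀ a b c d e f j : ℂ, c * (a * b * d) + a / j * (b * e - b * f) =
          a * b * (c * d + (e - f) / j) := by intros; ring
      rw [e0, low_freq_identity hne, norm_mul, norm_mul, norm_mul, norm_ampl hs0, norm_ofReal_jap,
        norm_div, norm_mul, norm_mul Complex.I, norm_mul, hfn, Complex.norm_I, one_mul,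
        Complex.norm_real, Complex.norm_real, Real.norm_eq_abs, Real.norm_eq_abs]
      have hf0 : 0 < freq k := by linarith
      have e1 : ‖Complex.exp (Complex.I * (2 * Real.pi * ξ : ℝ) * t) -
          Complex.exp (Complex.I * freq k * t)‖ * |2 * Real.pi * ξ| /
          (|2 * Real.pi * ξ - freq k| * freq k) ≤ |ξ| * (quart k ^ 2)⁻¹ := by
        rw [div_le_iff₀ (by nlinarith), ← div_eq_mul_inv, div_mul_eq_mul_div,
          le_div_iff₀ (by positivity)]
        have hx := norm_exp_sub_exp_le (2 * Real.pi * ξ) (freq k) t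
        have h1 : (81 * quart k) ^ 2 / 2 ≤ |2 * Real.pi * ξ - freq k| * freq k := by
          calc (81 * quart k) ^ 2 / 2 ≤ freq k ^ 2 / 2 := by gcongr
            _ = freq k / 2 * freq k := by ring
            _ ≤ _ := by gcongr
        rw [abs_mul (2 * Real.pi), abs_of_pos (by positivity : 0 < 2 * Real.pi)]
        calc _ ≤ 2 * (2 * Real.pi * |ξ|) * quart k ^ 2 := by gcongr
          _ = |ξ| * (4 * Real.pi * quart k ^ 2) := by ring
          _ ≤ _ := by
            refine mul_le_mul_of_nonneg_left (le_trans ?_ h1) (abs_nonneg ξ)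
            nlinarith [sq_nonneg (quart k)]
      -- The factor ξ costs one order, so the exponent left over is 13/8-σ. It is nonnegative
      -- because s ≤ 4.
      have e2 : jap (-((1 + s) / 4)) ξ * |ξ| ≤
          jap (-(5 / 8)) ξ * (289 * quart k ^ (13 / 8 - (1 + s) / 4)) := by
        calc _ ≤ jap (-((1 + s) / 4)) ξ * jap 1 ξ :=
              mul_le_mul_of_nonneg_left (abs_le_jap_one ξ) (jap_pos _ _).le
          _ = jap (-(5 / 8)) ξ * jap (13 / 8 - (1 + s) / 4) ξ := by
              rw [jap_mul, jap_mul]; congr 1; ring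
          _ ≤ _ := by
              gcongr
              exact jap_le_of_notMem_highFreq (by linarith) (by linarith) hξ
      have e3 : quart k ^ ((1 + s) / 4) * quart k ^ (13 / 8 - (1 + s) / 4) * (quart k ^ 2)⁻¹ =
          quart k ^ (-(3 / 8) : ℝ) := by
        rw [← Real.rpow_natCast, ← Real.rpow_neg hq.le, ← Real.rpow_add hq, ← Real.rpow_add hq]
        congr 1; push_cast; ring
      have hj2 := jap_pos (-((1 + s) / 4)) ξ
      calc _ ≤ 2 * Real.pi * quart k ^ ((1 + s) / 4) * (jap (-((1 + s) / 4)) ξ * ‖γ ξ‖) *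
            (|ξ| * (quart k ^ 2)⁻¹) := by gcongr
        _ = 2 * Real.pi * quart k ^ ((1 + s) / 4) * ((jap (-((1 + s) / 4)) ξ * |ξ|) * ‖γ ξ‖) *
            (quart k ^ 2)⁻¹ := by ring
        _ ≤ 2 * Real.pi * quart k ^ ((1 + s) / 4) * ((jap (-(5 / 8)) ξ *
            (289 * quart k ^ (13 / 8 - (1 + s) / 4))) * ‖γ ξ‖) * (quart k ^ 2)⁻¹ := by gcongr
        _ = 578 * Real.pi * (quart k ^ ((1 + s) / 4) * quart k ^ (13 / 8 - (1 + s) / 4) *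
            (quart k ^ 2)⁻¹) * (jap (-(5 / 8)) ξ * ‖γ ξ‖) := by ring
        _ ≤ _ := by
            rw [e3]
            gcongr
            linarith
  · refine continuousOn_const.mul ((H.continuousOn_coeffW2 hT k).sub ?_)
    have := (continuous_extVal (σ := (1 + s) / 4) (by linarith) g).continuousOn (s := Icc 0 T)
    exact ((this.const_mul _).div_const _)
  · have hk := memLp_kern_sub ht (freq k)
    have i1 : Integrable fun ξ => ampl s k * ((jap (-((1 + s) / 4)) ξ : ℂ) * γ ξ) *
        kern (2 * Real.pi * ξ - freq k) t :=
      ((memLp_jap_mul (by linarith) hγ2).const_mul _).integrable_mul hk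
    have i2 : Integrable fun ξ => highPart s γ k ξ * kern (2 * Real.pi * ξ - freq k) t := by
      have : MemLp (highPart s γ k) 2 := (hγ2.norm.const_mul 8).of_le
        (measurable_highPart hγm k).aestronglyMeasurable (ae_of_all _ fun ξ => by
          refine (norm_highPart_le hs0 γ k ξ).trans (le_abs_self _))
      exact this.integrable_mul hk
    have i3 := integrable_jap_mul_exp (σ := (1 + s) / 4) (by linarith) hγ2 t
    have i4 : Integrable fun ξ => (jap (-((1 + s) / 4)) ξ : ℂ) * γ ξ *
        Complex.exp (Complex.I * freq k * t) :=
      (integrable_jap_mul (σ := (1 + s) / 4) (by linarith) hγ2).mul_const _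
    -- This integral is the value of the extension at time 0; its vanishing removes the boundary
    -- contribution with e^{iω_k t}.
    have hz : ∫ ξ, (jap (-((1 + s) / 4)) ξ : ℂ) * γ ξ = 0 := by
      rw [← hq0, extVal]
      simp
      rfl
    have i12 : Integrable fun ξ => Complex.exp (Complex.I * freq k * t) *
        (ampl s k * ((jap (-((1 + s) / 4)) ξ : ℂ) * γ ξ) * kern (2 * Real.pi * ξ - freq k) t -
          highPart s γ k ξ * kern (2 * Real.pi * ξ - freq k) t) := (i1.sub i2).const_mul _
    have i34 : Integrable fun ξ => ampl s k / (Complex.I * freq k) *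
        ((jap (-((1 + s) / 4)) ξ : ℂ) * γ ξ * Complex.exp (Complex.I * (2 * Real.pi * ξ : ℝ) * t) -
          (jap (-((1 + s) / 4)) ξ : ℂ) * γ ξ * Complex.exp (Complex.I * freq k * t)) :=
      (i3.sub i4).const_mul _
    rw [integral_add i12 i34,
      integral_const_mul, integral_const_mul, integral_sub i1 i2, integral_sub i3 i4,
      integral_mul_const, hz, zero_mul, sub_zero, duhamel, mul_sub,
      coeffW2_succ_eq, H.integral_exp_mul (by linarith) _ ht]
    simp_rw [mul_assoc (ampl s k), integral_const_mul]
    have hf : freq k = (((k : ℝ) + 1) * Real.pi) ^ 4 := rfl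
    have hpi : (Real.pi : ℂ) ≠ 0 := by exact_mod_cast Real.pi_ne_zero
    have hk1 : (k : ℂ) + 1 ≠ 0 := Nat.cast_add_one_ne_zero k
    -- Source of the constant 2/π³: -2πi(k+1)^{1+s} divided by iπ⁴(k+1)⁴.
    have hamp : ampl s k / (Complex.I * freq k) =
        -((((k : ℝ) + 1) ^ s : ℝ) * (2 / Real.pi ^ 3 / ((k : ℂ) + 1) ^ 3)) := by
      rw [ampl, hf]
      push_cast
      have hI := Complex.I_ne_zero
      field_simp
    rw [hamp, extVal, ampl]
    ring

/-! ### Admissible systems of functions -/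

/-- `sin((k+1)πx + δ)`. -/
def sinPh (δ : ℝ) (k : ℕ) (x : ℝ) : ℂ := (Real.sin (((k : ℝ) + 1) * Real.pi * x + δ) : ℂ)

theorem continuous_sinPh (δ : ℝ) (k : ℕ) : Continuous (sinPh δ k) := by
  unfold sinPh; fun_prop

theorem sinPh_eq (δ : ℝ) (k : ℕ) (x : ℝ) : sinPh δ k x =
    Complex.exp (Complex.I * δ) / (2 * Complex.I) * expE k x -
      Complex.exp (-(Complex.I * δ)) / (2 * Complex.I) * expE k (-x) := by
  have hI := Complex.I_ne_zero
  rw [sinPh, Complex.ofReal_sin, Complex.sin, expE, expE]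
  rw [div_mul_eq_mul_div, div_mul_eq_mul_div, ← Complex.exp_add, ← Complex.exp_add, div_sub_div_same,
    div_eq_div_iff two_ne_zero (by simp)]
  have e1 : -((((k : ℝ) + 1) * Real.pi * x + δ : ℝ) : ℂ) * Complex.I =
      -(Complex.I * δ) + Complex.I * Real.pi * (k + 1) * ((-x : ℝ) : ℂ) := by push_cast; ring
  have e2 : ((((k : ℝ) + 1) * Real.pi * x + δ : ℝ) : ℂ) * Complex.I =
      (Complex.I * δ) + Complex.I * Real.pi * (k + 1) * (x : ℂ) := by push_cast; ring
  rw [e1, e2]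
  linear_combination (-2 * (Complex.exp (Complex.I * δ + Complex.I * Real.pi * (k + 1) * (x : ℂ)) -
    Complex.exp (-(Complex.I * δ) + Complex.I * Real.pi * (k + 1) * ((-x : ℝ) : ℂ)))) *
      Complex.I_mul_I

theorem enorm_exp_div_two_I (δ : ℝ) : ‖Complex.exp (Complex.I * δ) / (2 * Complex.I)‖ = 1 / 2 := by
  rw [norm_div, mul_comm Complex.I, Complex.norm_exp_ofReal_mul_I]
  simp

/-- Euler's formula. The second exponential sum is the first one reflected, so on the symmetric
interval (-3,3) it has the same norms and the phase δ plays no role. -/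
theorem norm_sum_mul_sinPh_le (δ : ℝ) (K : Finset ℕ) (c : ℕ → ℂ) (x : ℝ) :
    ‖∑ k ∈ K, c k * sinPh δ k x‖ ≤
      1 / 2 * (‖∑ k ∈ K, c k * expE k x‖ + ‖∑ k ∈ K, c k * expE k (-x)‖) := by
  have h : ∑ k ∈ K, c k * sinPh δ k x =
      Complex.exp (Complex.I * δ) / (2 * Complex.I) * ∑ k ∈ K, c k * expE k x -
      Complex.exp (Complex.I * (-δ : ℝ)) / (2 * Complex.I) * ∑ k ∈ K, c k * expE k (-x) := by
    rw [Finset.mul_sum, Finset.mul_sum, ← Finset.sum_sub_distrib]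
    refine Finset.sum_congr rfl fun k _ => ?_
    rw [sinPh_eq]; push_cast; ring_nf
  rw [h]
  refine (norm_sub_le _ _).trans ?_
  rw [norm_mul, norm_mul, enorm_exp_div_two_I, enorm_exp_div_two_I, mul_add]

theorem measurePreserving_neg_Ioo :
    MeasurePreserving (fun x : ℝ => -x) (volume.restrict (Ioo (-3 : ℝ) 3))
      (volume.restrict (Ioo (-3 : ℝ) 3)) := by
  have h := (Measure.measurePreserving_neg (volume : Measure ℝ)).restrict_preimage
    (s := Ioo (-3 : ℝ) 3) measurableSet_Ioo
  have e : Neg.neg ⁻¹' Ioo (-3 : ℝ) 3 = Ioo (-3 : ℝ) 3 := by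
    ext x; simp only [mem_preimage, mem_Ioo]; constructor <;> rintro ⟨h1, h2⟩ <;> constructor <;> linarith
  rwa [e] at h

theorem eLpNorm_le_of_norm_le_half_add {α : Type*} [MeasurableSpace α] {μ : Measure α} {p : ℝ≥0∞}
    (hp : 1 ≤ p) {f F : α → ℂ} (hF : AEStronglyMeasurable F μ) {φ : α → α}
    (hφ : MeasurePreserving φ μ μ) (h : ∀ a, ‖f a‖ ≤ 1 / 2 * (‖F a‖ + ‖F (φ a)‖)) :
    eLpNorm f p μ ≤ eLpNorm F p μ := by
  calc eLpNorm f p μ ≤ eLpNorm (((1 / 2 : ℝ)) • ((fun a => ‖F a‖) + fun a => ‖(F ∘ φ) a‖)) p μ :=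
        eLpNorm_mono_real fun a => by simpa using h a
    _ = ENNReal.ofReal (1 / 2) * eLpNorm ((fun a => ‖F a‖) + fun a => ‖(F ∘ φ) a‖) p μ := by
        rw [eLpNorm_const_smul, Real.enorm_eq_ofReal (by norm_num)]
    _ ≤ ENNReal.ofReal (1 / 2) * (eLpNorm F p μ + eLpNorm F p μ) := by
        gcongr
        refine (eLpNorm_add_le hF.norm (hF.comp_measurePreserving hφ).norm hp).trans ?_
        rw [eLpNorm_norm, eLpNorm_norm, eLpNorm_comp_measurePreserving hF hφ]
    _ = eLpNorm F p μ := by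
        rw [← two_mul, ← mul_assoc, ← ENNReal.ofReal_ofNat, ← ENNReal.ofReal_mul (by norm_num)]
        norm_num

/-- A system of functions `w_k` on the line for which the sums `∑ c_k w_k` are bounded in `L²` for
`c ∈ ℓ²`, and in `L⁴` of space-time if the coefficients form a good family. -/
structure Admissible (T : ℝ) (μ : Measure ℝ) (w : ℕ → ℝ → ℂ) (A : ℝ) : Prop where
  nonneg : 0 ≤ A
  stronglyMeasurable : ∀ k, StronglyMeasurable (w k)
  eLpNorm_two_le : ∀ (K : Finset ℕ) (c : ℕ → ℂ),
    eLpNorm (fun x => ∑ k ∈ K, c k * w k x) 2 μ ≤ ENNReal.ofReal (A * √(∑ k ∈ K, ‖c k‖ ^ 2))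
  eLpNorm_four_le : ∀ (B : ℝ) (b : ℝ → ℕ → ℂ), 0 ≤ B → GoodFamily T B b → ∀ N,
    eLpNorm (fun z : ℝ × ℝ => ∑ k ∈ Finset.range N, b z.2 k * w k z.1) 4
      (μ.prod (volume.restrict (Ioo 0 T))) ≤ ENNReal.ofReal (A * B)

theorem GoodFamily.mul_left {T B : ℝ} {b : ℝ → ℕ → ℂ} (hb : GoodFamily T B b) {ν : ℕ → ℂ}
    (hν : ∀ k, ‖ν k‖ ≤ 1) : GoodFamily T B (fun t k => ν k * b t k) := by
  obtain ⟨β, h1, h2, h3⟩ := hb.bound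
  refine ⟨fun k => continuousOn_const.mul (hb.continuousOn k), ⟨β, fun t ht k => ?_, h2, h3⟩,
    fun N μ hμ => ?_⟩
  · rw [norm_mul]
    exact (mul_le_of_le_one_left (norm_nonneg _) (hν k)).trans (h1 t ht k)
  · have := hb.eLpNorm_le N (fun k => μ k * ν k) fun k => by
      rw [norm_mul]
      exact mul_le_one₀ (hμ k) (norm_nonneg _) (hν k)
    simpa only [mul_assoc] using this

theorem GoodFamily.aestronglyMeasurable {T B : ℝ} {b : ℝ → ℕ → ℂ} (hb : GoodFamily T B b)
    {μ : Measure ℝ} [SFinite μ] {w : ℕ → ℝ → ℂ} (hw : ∀ k, StronglyMeasurable (w k)) (N : ℕ) :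
    AEStronglyMeasurable (fun z : ℝ × ℝ => ∑ k ∈ Finset.range N, b z.2 k * w k z.1)
      (μ.prod (volume.restrict (Ioo 0 T))) := by
  refine Finset.aestronglyMeasurable_fun_sum _ fun k _ => ?_
  refine AEStronglyMeasurable.mul ?_ ((hw k).comp_measurable measurable_fst).aestronglyMeasurable
  have : AEStronglyMeasurable (fun t => b t k) (volume.restrict (Ioo 0 T)) :=
    ((hb.continuousOn k).mono Ioo_subset_Icc_self).aestronglyMeasurable measurableSet_Ioo
  exact this.comp_snd

theorem eLpNorm_two_sum_expE (K : Finset ℕ) (c : ℕ → ℂ) :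
    eLpNorm (fun x => ∑ k ∈ K, c k * expE k x) 2 (volume.restrict (Ioo (-3 : ℝ) 3)) ≤
      ENNReal.ofReal (3 * √(∑ k ∈ K, ‖c k‖ ^ 2)) := by
  have hcont : Continuous fun x => ∑ k ∈ K, c k * expE k x := by unfold expE; fun_prop
  have h1 : ∫⁻ x in Ioo (-3 : ℝ) 3, ‖∑ k ∈ K, c k * expE k x‖ₑ ^ 2 =
      ENNReal.ofReal (6 * ∑ k ∈ K, ‖c k‖ ^ 2) := by
    have hi : Integrable (fun x => ‖∑ k ∈ K, c k * expE k x‖ ^ 2)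
        (volume.restrict (Ioo (-3 : ℝ) 3)) :=
      ((hcont.norm.pow 2).integrableOn_Icc).mono_set Ioo_subset_Icc_self
    rw [← integral_norm_sq_sum_expE, ofReal_integral_eq_lintegral_ofReal hi
      (ae_of_all _ fun _ => sq_nonneg _)]
    refine lintegral_congr fun x => ?_
    rw [ENNReal.ofReal_pow (norm_nonneg _), ofReal_norm]
  rw [lintegral_enorm_pow_eq _ (by norm_num)] at h1
  refine (ENNReal.pow_le_pow_left_iff (n := 2) (by norm_num)).1 (h1.le.trans ?_)
  rw [← ENNReal.ofReal_pow (by positivity), mul_pow,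
    Real.sq_sqrt (Finset.sum_nonneg fun _ _ => by positivity)]
  refine ENNReal.ofReal_le_ofReal ?_
  gcongr
  norm_num

theorem admissible_sinPh (T δ : ℝ) :
    Admissible T (volume.restrict (Ioo (-3 : ℝ) 3)) (sinPh δ) 3 where
  nonneg := by norm_num
  stronglyMeasurable k := (continuous_sinPh δ k).stronglyMeasurable
  eLpNorm_two_le K c := by
    refine le_trans ?_ (eLpNorm_two_sum_expE K c)
    refine eLpNorm_le_of_norm_le_half_add (by norm_num) ?_ measurePreserving_neg_Ioo
      fun x => norm_sum_mul_sinPh_le δ K c x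
    exact Continuous.aestronglyMeasurable (by unfold expE; fun_prop)
  eLpNorm_four_le B b hB hb N := by
    have h := hb.eLpNorm_le N (fun _ => 1) (by simp)
    simp only [one_mul] at h
    refine (le_trans ?_ h).trans (ENNReal.ofReal_le_ofReal (by linarith))
    refine eLpNorm_le_of_norm_le_half_add (φ := Prod.map (fun x : ℝ => -x) id) (by norm_num)
      (hb.aestronglyMeasurable (fun k => (continuous_expE k).stronglyMeasurable) N)
      (measurePreserving_neg_Ioo.prod (MeasurePreserving.id _))
      fun z => norm_sum_mul_sinPh_le δ _ (b z.2) z.1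

theorem Admissible.mono_measure {T A : ℝ} {μ μ' : Measure ℝ} [SFinite μ] [SFinite μ']
    {w : ℕ → ℝ → ℂ}
    (h : Admissible T μ w A) (hμ : μ' ≤ μ) : Admissible T μ' w A where
  nonneg := h.nonneg
  stronglyMeasurable := h.stronglyMeasurable
  eLpNorm_two_le K c := (eLpNorm_mono_measure _ hμ).trans (h.eLpNorm_two_le K c)
  eLpNorm_four_le B b hB hb N :=
    (eLpNorm_mono_measure _ (Measure.prod_mono hμ le_rfl)).trans (h.eLpNorm_four_le B b hB hb N)

theorem Admissible.mul_left {T A : ℝ} {μ : Measure ℝ} {w : ℕ → ℝ → ℂ}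
    (h : Admissible T μ w A) {ν : ℕ → ℂ} (hν : ∀ k, ‖ν k‖ ≤ 1) :
    Admissible T μ (fun k x => ν k * w k x) A where
  nonneg := h.nonneg
  stronglyMeasurable k := (h.stronglyMeasurable k).const_mul _
  eLpNorm_two_le K c := by
    have := h.eLpNorm_two_le K (fun k => ν k * c k)
    have e : ∀ x, ∑ k ∈ K, c k * (ν k * w k x) = ∑ k ∈ K, ν k * c k * w k x := fun x =>
      Finset.sum_congr rfl fun k _ => by ring
    simp_rw [e]
    refine this.trans (ENNReal.ofReal_le_ofReal ?_)
    have := h.nonneg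
    gcongr with k _
    rw [norm_mul]
    exact mul_le_of_le_one_left (norm_nonneg _) (hν k)
  eLpNorm_four_le B b hB hb N := by
    have := h.eLpNorm_four_le B _ hB (hb.mul_left hν) N
    refine le_of_eq_of_le ?_ this
    congr 1; funext z
    exact Finset.sum_congr rfl fun k _ => by ring

theorem Admissible.const_mul {T A : ℝ} {μ : Measure ℝ} {w : ℕ → ℝ → ℂ}
    (h : Admissible T μ w A) (a : ℂ) :
    Admissible T μ (fun k x => a * w k x) (‖a‖ * A) where
  nonneg := mul_nonneg (norm_nonneg _) h.nonneg
  stronglyMeasurable k := (h.stronglyMeasurable k).const_mul _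
  eLpNorm_two_le K c := by
    have e : (fun x => ∑ k ∈ K, c k * (a * w k x)) = a • fun x => ∑ k ∈ K, c k * w k x := by
      funext x
      rw [Pi.smul_apply, smul_eq_mul, Finset.mul_sum]
      exact Finset.sum_congr rfl fun k _ => by ring
    rw [e, eLpNorm_const_smul, mul_assoc, ENNReal.ofReal_mul (norm_nonneg _), ofReal_norm]
    gcongr
    exact h.eLpNorm_two_le K c
  eLpNorm_four_le B b hB hb N := by
    have e : (fun z : ℝ × ℝ => ∑ k ∈ Finset.range N, b z.2 k * (a * w k z.1)) =
        a • fun z : ℝ × ℝ => ∑ k ∈ Finset.range N, b z.2 k * w k z.1 := by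
      funext x
      rw [Pi.smul_apply, smul_eq_mul, Finset.mul_sum]
      exact Finset.sum_congr rfl fun k _ => by ring
    rw [e, eLpNorm_const_smul, mul_assoc, ENNReal.ofReal_mul (norm_nonneg _), ofReal_norm]
    gcongr
    exact h.eLpNorm_four_le B b hB hb N

theorem Admissible.add {T A A' : ℝ} {μ : Measure ℝ} [SFinite μ] {w w' : ℕ → ℝ → ℂ}
    (h : Admissible T μ w A) (h' : Admissible T μ w' A') :
    Admissible T μ (fun k x => w k x + w' k x) (A + A') where
  nonneg := add_nonneg h.nonneg h'.nonneg
  stronglyMeasurable k := (h.stronglyMeasurable k).add (h'.stronglyMeasurable k)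
  eLpNorm_two_le K c := by
    have e : (fun x => ∑ k ∈ K, c k * (w k x + w' k x)) =
        (fun x => ∑ k ∈ K, c k * w k x) + fun x => ∑ k ∈ K, c k * w' k x := by
      funext x
      simp only [Pi.add_apply, mul_add, Finset.sum_add_distrib]
    rw [e, add_mul, ENNReal.ofReal_add (mul_nonneg h.nonneg (Real.sqrt_nonneg _))
      (mul_nonneg h'.nonneg (Real.sqrt_nonneg _))]
    refine (eLpNorm_add_le ?_ ?_ (by norm_num)).trans
      (add_le_add (h.eLpNorm_two_le K c) (h'.eLpNorm_two_le K c))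
    · exact (Finset.stronglyMeasurable_fun_sum _ fun k _ =>
        (h.stronglyMeasurable k).const_mul _).aestronglyMeasurable
    · exact (Finset.stronglyMeasurable_fun_sum _ fun k _ =>
        (h'.stronglyMeasurable k).const_mul _).aestronglyMeasurable
  eLpNorm_four_le B b hB hb N := by
    have e : (fun z : ℝ × ℝ => ∑ k ∈ Finset.range N, b z.2 k * (w k z.1 + w' k z.1)) =
        (fun z : ℝ × ℝ => ∑ k ∈ Finset.range N, b z.2 k * w k z.1) +
        fun z : ℝ × ℝ => ∑ k ∈ Finset.range N, b z.2 k * w' k z.1 := by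
      funext x
      simp only [Pi.add_apply, mul_add, Finset.sum_add_distrib]
    rw [e, add_mul, ENNReal.ofReal_add (mul_nonneg h.nonneg hB) (mul_nonneg h'.nonneg hB)]
    exact (eLpNorm_add_le (hb.aestronglyMeasurable h.stronglyMeasurable N)
      (hb.aestronglyMeasurable h'.stronglyMeasurable N) (by norm_num)).trans
      (add_le_add (h.eLpNorm_four_le B b hB hb N) (h'.eLpNorm_four_le B b hB hb N))

/-- Multiplication by a cut-off function extends an admissible system on `(-3,3)` to the line. -/
theorem Admissible.cutoff {T A : ℝ} {w : ℕ → ℝ → ℂ}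
    (h : Admissible T (volume.restrict (Ioo (-3 : ℝ) 3)) w A) {χ : ℝ → ℂ}
    (hχ : StronglyMeasurable χ) (hχ1 : ∀ x, ‖χ x‖ ≤ 1) (hχ0 : ∀ x ∉ Ioo (-3 : ℝ) 3, χ x = 0) :
    Admissible T volume (fun k x => χ x * w k x) A where
  nonneg := h.nonneg
  stronglyMeasurable k := hχ.mul (h.stronglyMeasurable k)
  eLpNorm_two_le K c := by
    refine le_trans ?_ (h.eLpNorm_two_le K c)
    have e : (fun x => ∑ k ∈ K, c k * (χ x * w k x)) =
        fun x => χ x * ∑ k ∈ K, c k * w k x := by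
      funext x
      rw [Finset.mul_sum]
      exact Finset.sum_congr rfl fun k _ => by ring
    rw [e, ← eLpNorm_indicator_eq_eLpNorm_restrict measurableSet_Ioo]
    refine eLpNorm_mono fun x => ?_
    by_cases hx : x ∈ Ioo (-3 : ℝ) 3
    · rw [indicator_of_mem hx, norm_mul]
      exact mul_le_of_le_one_left (norm_nonneg _) (hχ1 x)
    · simp [hχ0 x hx]
  eLpNorm_four_le B b hB hb N := by
    refine le_trans ?_ (h.eLpNorm_four_le B b hB hb N)
    have e : (fun z : ℝ × ℝ => ∑ k ∈ Finset.range N, b z.2 k * (χ z.1 * w k z.1)) =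
        fun z => χ z.1 * ∑ k ∈ Finset.range N, b z.2 k * w k z.1 := by
      funext x
      rw [Finset.mul_sum]
      exact Finset.sum_congr rfl fun k _ => by ring
    have hr : (volume.restrict (Ioo (-3 : ℝ) 3)).prod (volume.restrict (Ioo (0 : ℝ) T)) =
        ((volume : Measure ℝ).prod (volume.restrict (Ioo (0 : ℝ) T))).restrict
          (Ioo (-3 : ℝ) 3 ×ˢ univ) := by
      rw [← Measure.prod_restrict, Measure.restrict_univ]
    rw [e, hr, ← eLpNorm_indicator_eq_eLpNorm_restrict (measurableSet_Ioo.prod MeasurableSet.univ)]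
    refine eLpNorm_mono fun z => ?_
    by_cases hx : z.1 ∈ Ioo (-3 : ℝ) 3
    · rw [indicator_of_mem (by simpa using hx), norm_mul]
      exact mul_le_of_le_one_left (norm_nonneg _) (hχ1 z.1)
    · simp [hχ0 z.1 hx]

theorem eLpNorm_four_mul_le {T : ℝ} (hT : 0 ≤ T) {r : ℝ → ℂ} (hr : StronglyMeasurable r) {a : ℝ}
    (ha : 0 ≤ a) (hra : eLpNorm r 4 volume ≤ ENNReal.ofReal a) {f : ℝ → ℂ} {β : ℝ} (hβ : 0 ≤ β)
    (hf : ∀ t ∈ Icc 0 T, ‖f t‖ ≤ β) :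
    eLpNorm (fun z : ℝ × ℝ => f z.2 * r z.1) 4
      ((volume : Measure ℝ).prod (volume.restrict (Ioo 0 T))) ≤
        ENNReal.ofReal ((T + 1) * (β * a)) := by
  have hra4 : ∫⁻ x, ‖r x‖ₑ ^ 4 ≤ ENNReal.ofReal a ^ 4 := by
    rw [lintegral_enorm_pow_eq r (n := 4) (by norm_num)]
    exact pow_le_pow_left₀ zero_le (by exact_mod_cast hra) 4
  have haez : ∀ᵐ z ∂((volume : Measure ℝ).prod (volume.restrict (Ioo 0 T))), z.2 ∈ Icc 0 T := by
    refine Measure.quasiMeasurePreserving_snd.ae ?_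
    filter_upwards [ae_restrict_mem measurableSet_Ioo] with t ht using Ioo_subset_Icc_self ht
  have hm : Measurable fun z : ℝ × ℝ => ‖r z.1‖ₑ ^ 4 :=
    (hr.measurable.comp measurable_fst).enorm.pow_const 4
  -- The true factor is T^{1/4}; T+1 is used instead to avoid fractional powers.
  have hT4 : T ≤ (T + 1) ^ 4 := by
    calc T ≤ (T + 1) ^ 1 := by linarith
      _ ≤ _ := pow_le_pow_right₀ (by linarith) (by norm_num)
  have hmain : ∫⁻ z, ‖f z.2 * r z.1‖ₑ ^ 4
      ∂((volume : Measure ℝ).prod (volume.restrict (Ioo 0 T))) ≤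
      ENNReal.ofReal ((T + 1) * (β * a)) ^ 4 := by
    calc _ ≤ ∫⁻ z, ENNReal.ofReal β ^ 4 * ‖r z.1‖ₑ ^ 4
            ∂((volume : Measure ℝ).prod (volume.restrict (Ioo 0 T))) := by
          refine lintegral_mono_ae ?_
          filter_upwards [haez] with z hz
          rw [enorm_mul, mul_pow, ← ofReal_norm (f z.2)]
          exact mul_le_mul_left (pow_le_pow_left₀ zero_le
            (ENNReal.ofReal_le_ofReal (hf _ hz)) 4) _
      _ = ENNReal.ofReal β ^ 4 * ((∫⁻ x, ‖r x‖ₑ ^ 4) * ENNReal.ofReal T) := by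
          rw [lintegral_const_mul _ hm, lintegral_prod _ hm.aemeasurable]
          simp only [lintegral_const, Measure.restrict_apply_univ, Real.volume_Ioo, sub_zero]
          rw [lintegral_mul_const _ (hr.measurable.enorm.pow_const 4)]
      _ ≤ ENNReal.ofReal β ^ 4 * (ENNReal.ofReal a ^ 4 * ENNReal.ofReal T) := by gcongr
      _ = ENNReal.ofReal (T * (β * a) ^ 4) := by
          rw [← ENNReal.ofReal_pow hβ, ← ENNReal.ofReal_pow ha,
            ← ENNReal.ofReal_mul (by positivity), ← ENNReal.ofReal_mul (by positivity)]
          ring_nf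
      _ ≤ ENNReal.ofReal (((T + 1) * (β * a)) ^ 4) := by
          refine ENNReal.ofReal_le_ofReal ?_
          rw [mul_pow (T + 1)]
          exact mul_le_mul_of_nonneg_right hT4 (by positivity)
      _ = _ := ENNReal.ofReal_pow (by positivity) _
  rw [lintegral_enorm_pow_eq _ (n := 4) (by norm_num)] at hmain
  have h4 := (ENNReal.pow_le_pow_left_iff (n := 4) (by norm_num)).1 hmain
  exact_mod_cast h4

theorem eLpNorm_two_sum_le {r : ℕ → ℝ → ℂ}
    (hr : ∀ k, StronglyMeasurable (r k)) {a : ℕ → ℝ} (ha : ∀ k, 0 ≤ a k)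
    (ha2 : Summable fun k => a k ^ 2) (h2 : ∀ k, eLpNorm (r k) 2 volume ≤ ENNReal.ofReal (a k))
    (K : Finset ℕ) (c : ℕ → ℂ) :
    eLpNorm (fun x => ∑ k ∈ K, c k * r k x) 2 volume ≤
      ENNReal.ofReal (√(∑' k, a k ^ 2) * √(∑ k ∈ K, ‖c k‖ ^ 2)) := by
  have e : (fun x => ∑ k ∈ K, c k * r k x) = ∑ k ∈ K, c k • r k := by
    funext x; simp
  rw [e]
  calc _ ≤ ∑ k ∈ K, eLpNorm (c k • r k) 2 volume :=
        eLpNorm_sum_le (fun k _ => ((hr k).const_smul _).aestronglyMeasurable) (by norm_num)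
    _ ≤ ∑ k ∈ K, ENNReal.ofReal (‖c k‖ * a k) := by
        refine Finset.sum_le_sum fun k _ => ?_
        rw [eLpNorm_const_smul, ENNReal.ofReal_mul (norm_nonneg _), ofReal_norm]
        gcongr
        exact h2 k
    _ = ENNReal.ofReal (∑ k ∈ K, ‖c k‖ * a k) :=
        (ENNReal.ofReal_sum_of_nonneg fun k _ => mul_nonneg (norm_nonneg _) (ha k)).symm
    _ ≤ _ := by
        refine ENNReal.ofReal_le_ofReal ?_
        calc _ ≤ √(∑ k ∈ K, ‖c k‖ ^ 2) * √(∑ k ∈ K, a k ^ 2) :=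
              Real.sum_mul_le_sqrt_mul_sqrt _ _ _
          _ ≤ √(∑ k ∈ K, ‖c k‖ ^ 2) * √(∑' k, a k ^ 2) := by
              gcongr
              exact ha2.sum_le_tsum _ fun _ _ => by positivity
          _ = √(∑' k, a k ^ 2) * √(∑ k ∈ K, ‖c k‖ ^ 2) := mul_comm _ _

theorem eLpNorm_four_sum_le {T : ℝ} (hT : 0 ≤ T) {r : ℕ → ℝ → ℂ}
    (hr : ∀ k, StronglyMeasurable (r k)) {a : ℕ → ℝ} (ha : ∀ k, 0 ≤ a k)
    (ha2 : Summable fun k => a k ^ 2)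
    (h4 : ∀ k, eLpNorm (r k) 4 volume ≤ ENNReal.ofReal (a k)) {B : ℝ} {b : ℝ → ℕ → ℂ}
    (hb : GoodFamily T B b) (N : ℕ) :
    eLpNorm (fun z : ℝ × ℝ => ∑ k ∈ Finset.range N, b z.2 k * r k z.1) 4
      ((volume : Measure ℝ).prod (volume.restrict (Ioo 0 T))) ≤
      ENNReal.ofReal ((T + 1) * √(∑' k, a k ^ 2) * B) := by
  obtain ⟨β, hβ1, hβ2, hβ3⟩ := hb.bound
  have hβ0 : ∀ k, 0 ≤ β k := fun k => (norm_nonneg _).trans (hβ1 0 ⟨le_rfl, hT⟩ k)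
  have hreal : ∑ k ∈ Finset.range N, β k * a k ≤ √(∑' k, a k ^ 2) * B := by
    calc _ ≤ √(∑ k ∈ Finset.range N, β k ^ 2) * √(∑ k ∈ Finset.range N, a k ^ 2) :=
          Real.sum_mul_le_sqrt_mul_sqrt _ _ _
      _ ≤ √(∑' k, β k ^ 2) * √(∑' k, a k ^ 2) :=
          mul_le_mul (Real.sqrt_le_sqrt (hβ2.sum_le_tsum _ fun _ _ => sq_nonneg _))
            (Real.sqrt_le_sqrt (ha2.sum_le_tsum _ fun _ _ => sq_nonneg _))
            (Real.sqrt_nonneg _) (Real.sqrt_nonneg _)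
      _ ≤ B * √(∑' k, a k ^ 2) := mul_le_mul_of_nonneg_right hβ3 (Real.sqrt_nonneg _)
      _ = _ := mul_comm _ _
  have hm : ∀ k, AEStronglyMeasurable (fun z : ℝ × ℝ => b z.2 k * r k z.1)
      ((volume : Measure ℝ).prod (volume.restrict (Ioo 0 T))) := fun k => by
    have : AEStronglyMeasurable (fun t => b t k) (volume.restrict (Ioo 0 T)) :=
      ((hb.continuousOn k).mono Ioo_subset_Icc_self).aestronglyMeasurable measurableSet_Ioo
    exact this.comp_snd.mul ((hr k).comp_measurable measurable_fst).aestronglyMeasurable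
  have e : (fun z : ℝ × ℝ => ∑ k ∈ Finset.range N, b z.2 k * r k z.1) =
      ∑ k ∈ Finset.range N, fun z : ℝ × ℝ => b z.2 k * r k z.1 := by
    funext x
    rw [Finset.sum_apply]
  have h1 : eLpNorm (∑ k ∈ Finset.range N, fun z : ℝ × ℝ => b z.2 k * r k z.1) 4
      ((volume : Measure ℝ).prod (volume.restrict (Ioo 0 T))) ≤
      ∑ k ∈ Finset.range N, eLpNorm (fun z : ℝ × ℝ => b z.2 k * r k z.1) 4
        ((volume : Measure ℝ).prod (volume.restrict (Ioo 0 T))) :=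
    eLpNorm_sum_le (fun k _ => hm k) (by norm_num)
  have h2 : ∑ k ∈ Finset.range N, eLpNorm (fun z : ℝ × ℝ => b z.2 k * r k z.1) 4
        ((volume : Measure ℝ).prod (volume.restrict (Ioo 0 T))) ≤
      ∑ k ∈ Finset.range N, ENNReal.ofReal ((T + 1) * (β k * a k)) :=
    Finset.sum_le_sum fun k _ =>
      eLpNorm_four_mul_le (f := fun t => b t k) hT (hr k) (ha k) (h4 k) (hβ0 k)
        fun t ht => hβ1 t ht k
  rw [e]
  refine h1.trans (h2.trans ?_)
  rw [← ENNReal.ofReal_sum_of_nonneg fun k _ =>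
    mul_nonneg (add_nonneg hT zero_le_one) (mul_nonneg (hβ0 k) (ha k)), ← Finset.mul_sum, mul_assoc]
  exact ENNReal.ofReal_le_ofReal
    (mul_le_mul_of_nonneg_left hreal (add_nonneg hT zero_le_one))

/-- For square-summable norms no orthogonality is needed: the triangle inequality and Cauchy-Schwarz
in k suffice. This disposes of the commutator remainders. -/
theorem admissible_of_summable {T : ℝ} (hT : 0 ≤ T) {r : ℕ → ℝ → ℂ}
    (hr : ∀ k, StronglyMeasurable (r k)) {a : ℕ → ℝ} (ha : ∀ k, 0 ≤ a k)
    (ha2 : Summable fun k => a k ^ 2) (h2 : ∀ k, eLpNorm (r k) 2 volume ≤ ENNReal.ofReal (a k))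
    (h4 : ∀ k, eLpNorm (r k) 4 volume ≤ ENNReal.ofReal (a k)) :
    Admissible T volume r ((T + 1) * √(∑' k, a k ^ 2)) where
  nonneg := by positivity
  stronglyMeasurable := hr
  eLpNorm_two_le K c := (eLpNorm_two_sum_le hr ha ha2 h2 K c).trans (ENNReal.ofReal_le_ofReal (by
    gcongr
    exact le_mul_of_one_le_left (Real.sqrt_nonneg _) (by linarith)))
  eLpNorm_four_le _ _ _ hb N := eLpNorm_four_sum_le hT hr ha ha2 h4 hb N

/-! ### Curves in `L²` with coefficients in a good family -/

section Curves

variable {T A : ℝ} {μ : Measure ℝ} {w : ℕ → ℝ → ℂ} {v : ℕ → Lp ℂ 2 μ}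

theorem Admissible.besselBound (h : Admissible T μ w A) (hvw : ∀ k, v k =ᵐ[μ] w k) :
    BesselBound v A := by
  refine ⟨h.nonneg, fun K c => ?_⟩
  rw [Lp.norm_def]
  refine ENNReal.toReal_le_of_le_ofReal (mul_nonneg h.nonneg (Real.sqrt_nonneg _)) ?_
  refine le_of_eq_of_le (eLpNorm_congr_ae ?_) (h.eLpNorm_two_le K c)
  have h2 : ∀ᵐ x ∂μ, ∀ k, (c k • v k : Lp ℂ 2 μ) x = c k * w k x := by
    rw [ae_all_iff]
    intro k
    filter_upwards [Lp.coeFn_smul (c k) (v k), hvw k] with x h3 h4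
    rw [h3, Pi.smul_apply, h4, smul_eq_mul]
  filter_upwards [Lp.coeFn_finsetSum (p := 2) (μ := μ) K (fun k => c k • v k), h2] with x h3 h4
  rw [h3, Finset.sum_apply]
  exact Finset.sum_congr rfl fun k _ => h4 k

variable {B : ℝ} {b : ℝ → ℕ → ℂ}

theorem Admissible.summable_smul (h : Admissible T μ w A) (hvw : ∀ k, v k =ᵐ[μ] w k)
    (hb : GoodFamily T B b) {t : ℝ} (ht : t ∈ Icc 0 T) : Summable fun k => b t k • v k := by
  obtain ⟨β, h1, h2, -⟩ := hb.bound
  exact (h.besselBound hvw).summable (summable_sq_of_norm_le (h1 t ht) h2)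

theorem Admissible.continuousOn_tsum (h : Admissible T μ w A) (hvw : ∀ k, v k =ᵐ[μ] w k)
    (hb : GoodFamily T B b) : ContinuousOn (fun t => ∑' k, b t k • v k) (Icc 0 T) := by
  obtain ⟨β, h1, h2, -⟩ := hb.bound
  exact (h.besselBound hvw).continuousOn_tsum hb.continuousOn h1 h2

theorem Admissible.norm_tsum_le (h : Admissible T μ w A) (hvw : ∀ k, v k =ᵐ[μ] w k)
    (hb : GoodFamily T B b) {t : ℝ} (ht : t ∈ Icc 0 T) : ‖∑' k, b t k • v k‖ ≤ A * B := by
  obtain ⟨β, h1, h2, h3⟩ := hb.bound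
  refine ((h.besselBound hvw).norm_tsum_le (summable_sq_of_norm_le (h1 t ht) h2)).trans ?_
  refine mul_le_mul_of_nonneg_left (le_trans (Real.sqrt_le_sqrt ?_) h3) h.nonneg
  exact (summable_sq_of_norm_le (h1 t ht) h2).tsum_le_tsum
    (fun k => pow_le_pow_left₀ (norm_nonneg _) (h1 t ht k) 2) h2

theorem Admissible.exists_slices [SFinite μ] (h : Admissible T μ w A) (hvw : ∀ k, v k =ᵐ[μ] w k)
    (hT : 0 ≤ T) (hB : 0 ≤ B) (hb : GoodFamily T B b) :
    ∃ u : ℝ × ℝ → ℂ, StronglyMeasurable u ∧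
      (∀ᵐ t ∂(volume.restrict (Ioo 0 T)),
        (fun x => u (x, t)) =ᵐ[μ] (∑' k, b t k • v k : Lp ℂ 2 μ)) ∧
      eLpNorm u 4 (μ.prod (volume.restrict (Ioo 0 T))) ≤ ENNReal.ofReal (A * B) := by
  obtain ⟨β, h1, h2, -⟩ := hb.bound
  exact (h.besselBound hvw).exists_slices hT h.stronglyMeasurable hvw hb.continuousOn h1 h2
    (h.eLpNorm_four_le B b hB hb)

end Curves

theorem restrict_Omega (T : ℝ) : (volume : Measure (ℝ × ℝ)).restrict (Omega T) =
    (volume.restrict (Ioo (0 : ℝ) 1)).prod (volume.restrict (Ioo 0 T)) := by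
  rw [Measure.prod_restrict]; rfl

/-- The function `sin(kπx + δ)` in `L²(0,1)`. -/
theorem memLp_sinPh (δ : ℝ) (k : ℕ) : MemLp (sinPh δ k) 2 (volume.restrict (Ioo (0 : ℝ) 1)) := by
  refine MemLp.of_bound (C := 1) (continuous_sinPh δ k).aestronglyMeasurable (ae_of_all _ fun x => ?_)
  rw [sinPh, Complex.norm_real]
  exact Real.abs_sin_le_one _

/-- `sin((k+1)πx + δ)` as an element of `L²(0,1)`. -/
def sinVec (δ : ℝ) (k : ℕ) : L2 := (memLp_sinPh δ k).toLp _

theorem coeFn_sinVec (δ : ℝ) (k : ℕ) :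
    sinVec δ k =ᵐ[volume.restrict (Ioo (0 : ℝ) 1)] sinPh δ k := (memLp_sinPh δ k).coeFn_toLp

theorem sinVec_zero (k : ℕ) : sinVec 0 k = sinL2 (k + 1) := by
  refine Lp.ext ?_
  filter_upwards [coeFn_sinVec 0 k, (memLp_sin (k + 1)).coeFn_toLp] with x h1 h2
  rw [h1, sinL2, h2, sinPh]
  push_cast
  rw [add_zero]

theorem admissible_sinPh_unit (T δ : ℝ) :
    Admissible T (volume.restrict (Ioo (0 : ℝ) 1)) (sinPh δ) 3 :=
  (admissible_sinPh T δ).mono_measure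
    (Measure.restrict_mono (Ioo_subset_Ioo (by norm_num) (by norm_num)) le_rfl)

theorem Admissible.l4NormLE {T A B : ℝ} {w : ℕ → ℝ → ℂ} {v : ℕ → L2}
    (h : Admissible T (volume.restrict (Ioo (0 : ℝ) 1)) w A)
    (hvw : ∀ k, v k =ᵐ[volume.restrict (Ioo (0 : ℝ) 1)] w k) (hT : 0 ≤ T) (hB : 0 ≤ B)
    {b : ℝ → ℕ → ℂ} (hb : GoodFamily T B b) :
    L4NormLE T (fun t => ∑' k, b t k • v k) (ENNReal.ofReal (A * B)) := by
  obtain ⟨u, h1, h2, h3⟩ := h.exists_slices hvw hT hB hb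
  rw [← restrict_Omega] at h3
  exact ⟨u, ⟨h1.aestronglyMeasurable, h3.trans_lt ENNReal.ofReal_lt_top⟩, h2, h3⟩

theorem L4NormLE.mono {T : ℝ} {U : ℝ → L2} {B B' : ℝ≥0∞} (h : L4NormLE T U B) (hB : B ≤ B') :
    L4NormLE T U B' := by
  obtain ⟨u, h1, h2, h3⟩ := h
  exact ⟨u, h1, h2, h3.trans hB⟩

theorem L4HsNormLE.mono {s T : ℝ} {U : ℝ → L2} {B B' : ℝ≥0∞} (h : L4HsNormLE s T U B)
    (hB : B ≤ B') : L4HsNormLE s T U B' := by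
  obtain ⟨g, h1, h2, h3⟩ := h
  exact ⟨g, h1, h2, h3.trans hB⟩

theorem eLpNorm_four_Omega_le {T : ℝ} (hT : 0 ≤ T) {f : ℝ × ℝ → ℂ} {D : ℝ} (hD : 0 ≤ D)
    (h : ∀ z ∈ Omega T, ‖f z‖ ≤ D) :
    eLpNorm f 4 (volume.restrict (Omega T)) ≤ ENNReal.ofReal ((T + 1) * D) := by
  have hm : MeasurableSet (Omega T) := measurableSet_Ioo.prod measurableSet_Ioo
  have hv : (volume.restrict (Omega T)) univ = ENNReal.ofReal T := by
    rw [Measure.restrict_apply_univ, Omega, Measure.volume_eq_prod, Measure.prod_prod]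
    simp
  have h1 := eLpNorm_le_of_ae_bound (p := 4) (μ := volume.restrict (Omega T)) (C := D)
    ((ae_restrict_mem hm).mono h)
  rw [hv, ENNReal.toReal_ofNat, ENNReal.ofReal_rpow_of_nonneg hT (by norm_num),
    ← ENNReal.ofReal_mul (by positivity)] at h1
  refine h1.trans (ENNReal.ofReal_le_ofReal (mul_le_mul_of_nonneg_right ?_ hD))
  calc T ^ ((4 : ℝ)⁻¹) ≤ (T + 1) ^ ((4 : ℝ)⁻¹) :=
        Real.rpow_le_rpow hT (by linarith) (by norm_num)
    _ ≤ (T + 1) ^ (1 : ℝ) := Real.rpow_le_rpow_of_exponent_le (by linarith) (by norm_num)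
    _ = T + 1 := Real.rpow_one _

/-- Addition of a multiple, continuous in time, of a bounded function. -/
theorem L4NormLE.add_smul {T : ℝ} (hT : 0 ≤ T) {U : ℝ → L2} {B : ℝ≥0∞} (hU : L4NormLE T U B)
    {q : ℝ → ℂ} (hq : Continuous q) {M D : ℝ} (hM : 0 ≤ M)
    (hqM : ∀ t ∈ Icc 0 T, ‖q t‖ ≤ M) {f : ℝ → ℂ}
    (hf : Continuous f) (hD : ∀ x ∈ Icc (0 : ℝ) 1, ‖f x‖ ≤ D) {V : L2}
    (hV : V =ᵐ[volume.restrict (Ioo (0 : ℝ) 1)] f) :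
    L4NormLE T (fun t => U t + q t • V) (B + ENNReal.ofReal ((T + 1) * (M * D))) := by
  obtain ⟨u, h1, h2, h3⟩ := hU
  have hD0 : 0 ≤ D := (norm_nonneg _).trans (hD 0 ⟨le_rfl, zero_le_one⟩)
  obtain ⟨r, hr⟩ : ∃ r : ℝ × ℝ → ℂ, ∀ z, r z = q z.2 * f z.1 := ⟨_, fun _ => rfl⟩
  have hc : Continuous r := by
    rw [show r = fun z => q z.2 * f z.1 from funext hr]
    fun_prop
  have hb : eLpNorm r 4 (volume.restrict (Omega T)) ≤ ENNReal.ofReal ((T + 1) * (M * D)) := by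
    refine eLpNorm_four_Omega_le hT (mul_nonneg hM hD0) fun z hz => ?_
    rw [hr, norm_mul]
    exact mul_le_mul (hqM _ (Ioo_subset_Icc_self hz.2)) (hD _ (Ioo_subset_Icc_self hz.1))
      (norm_nonneg _) hM
  have hmem : MemLp r 4 (volume.restrict (Omega T)) :=
    ⟨hc.aestronglyMeasurable, hb.trans_lt ENNReal.ofReal_lt_top⟩
  refine ⟨u + r, h1.add hmem, ?_,
    (eLpNorm_add_le h1.1 hmem.1 (by norm_num)).trans (add_le_add h3 hb)⟩
  filter_upwards [h2] with t ht
  filter_upwards [ht, hV, Lp.coeFn_add (U t) (q t • V), Lp.coeFn_smul (q t) V] with x h4 h5 h6 h7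
  rw [h6, Pi.add_apply, Pi.add_apply, h7, Pi.smul_apply, h5, ← h4, smul_eq_mul, hr]
open scoped FourierTransform

/-! ### Bessel potentials of modulated cut-off functions -/

/-- The Bessel potential operator on Schwartz functions. -/
def besselS (s : ℝ) : 𝓢(ℝ, ℂ) →L[ℂ] 𝓢(ℝ, ℂ) :=
  SchwartzMap.fourierMultiplierCLM ℂ fun x : ℝ => (((1 + ‖x‖ ^ 2) ^ (s / 2) : ℝ) : ℂ)

theorem besselPotential_toLp (s : ℝ) (p : ℝ≥0∞) [Fact (1 ≤ p)] (f : 𝓢(ℝ, ℂ)) :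
    TemperedDistribution.besselPotential ℝ ℂ s ((f.toLp p : Lp ℂ p (volume : Measure ℝ)) : 𝓢'(ℝ, ℂ)) =
      (((besselS s f).toLp p : Lp ℂ p (volume : Measure ℝ)) : 𝓢'(ℝ, ℂ)) := by
  rw [TemperedDistribution.besselPotential, Lp.toTemperedDistribution_toLp_eq,
    Lp.toTemperedDistribution_toLp_eq,
    TemperedDistribution.fourierMultiplierCLM_toTemperedDistributionCLM_eq (by fun_prop)]
  rfl

theorem fourier_besselS (s : ℝ) (f : 𝓢(ℝ, ℂ)) (ξ : ℝ) :
    𝓕 (besselS s f) ξ = (jap s ξ : ℂ) * 𝓕 f ξ := by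
  rw [besselS, SchwartzMap.fourierMultiplierCLM_apply, FourierTransform.fourier_fourierInv_eq,
    SchwartzMap.smulLeftCLM_apply_apply (by fun_prop), smul_eq_mul, jap]
  simp

/-- A smooth cut-off function that is `1` on `[0,1]` and vanishes outside `(-3,3)`. -/
def cut : ContDiffBump (1 / 2 : ℝ) := ⟨1, 2, by norm_num, by norm_num⟩

theorem cut_eq_one {x : ℝ} (hx : x ∈ Icc (0 : ℝ) 1) : cut x = 1 := by
  refine cut.one_of_mem_closedBall ?_
  rw [Metric.mem_closedBall, Real.dist_eq]
  change |x - 1 / 2| ≤ 1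
  rw [abs_le]; constructor <;> linarith [hx.1, hx.2]

theorem cut_eq_zero {x : ℝ} (hx : x ∉ Ioo (-3 : ℝ) 3) : cut x = 0 := by
  refine cut.zero_of_le_dist ?_
  rw [Real.dist_eq]
  change 2 ≤ |x - 1 / 2|
  rw [le_abs]
  by_contra! h
  exact hx ⟨by linarith [h.2], by linarith [h.1]⟩

/-- The product of the cut-off function with a smooth function. -/
def cutMul (f : ℝ → ℂ) (hf : ContDiff ℝ ∞ f) : 𝓢(ℝ, ℂ) :=
  HasCompactSupport.toSchwartzMap (f := fun x => (cut x : ℂ) * f x)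
    (cut.hasCompactSupport.comp_left (g := fun y : ℝ => (y : ℂ)) Complex.ofReal_zero).mul_right
    ((Complex.ofRealCLM.contDiff.comp cut.contDiff).mul hf)

theorem cutMul_apply (f : ℝ → ℂ) (hf : ContDiff ℝ ∞ f) (x : ℝ) :
    cutMul f hf x = (cut x : ℂ) * f x := rfl

theorem contDiff_cexp (m : ℝ) : ContDiff ℝ ∞ fun x : ℝ => Complex.exp (Complex.I * (2 * Real.pi * m) * x) :=
  (contDiff_const.mul Complex.ofRealCLM.contDiff).cexp

/-- The cut-off function times `e^{2πimx}`. -/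
def cutExp (m : ℝ) : 𝓢(ℝ, ℂ) := cutMul _ (contDiff_cexp m)

/-- Modulation becomes translation, so one rapidly decreasing profile controls all m. -/
theorem fourier_cutExp (m ξ : ℝ) : 𝓕 (cutExp m) ξ = 𝓕 (cutExp 0) (ξ - m) := by
  rw [SchwartzMap.fourier_coe, SchwartzMap.fourier_coe, Real.fourier_eq', Real.fourier_eq']
  refine integral_congr_ae (ae_of_all _ fun x => ?_)
  simp only [cutExp, cutMul_apply, smul_eq_mul]
  rw [mul_left_comm, mul_left_comm (Complex.exp _) (cut x : ℂ), ← Complex.exp_add, ← Complex.exp_add]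
  congr 2
  simp only [RCLike.inner_apply, conj_trivial]
  push_cast
  ring

/-- By scaling B = 1, and y^a lies between 1 and y. -/
theorem abs_rpow_sub_rpow_le {A B a : ℝ} (hA : 0 ≤ A) (hB : 0 < B) (ha : 0 ≤ a) (ha1 : a ≤ 1) :
    |A ^ a - B ^ a| ≤ B ^ (a - 1) * |A - B| := by
  have h : ∀ y : ℝ, 0 ≤ y → |y ^ a - 1| ≤ |y - 1| := by
    intro y hy
    rcases le_total 1 y with h | h
    · have h1 : y ^ a ≤ y ^ (1 : ℝ) := Real.rpow_le_rpow_of_exponent_le h ha1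
      have h2 : 1 ≤ y ^ a := Real.one_le_rpow h ha
      rw [Real.rpow_one] at h1
      rw [abs_of_nonneg (by linarith), abs_of_nonneg (by linarith)]
      linarith
    · have h1 : y ^ (1 : ℝ) ≤ y ^ a := Real.rpow_le_rpow_of_exponent_ge' hy h ha ha1
      have h2 : y ^ a ≤ 1 := Real.rpow_le_one hy h ha
      rw [Real.rpow_one] at h1
      rw [abs_of_nonpos (by linarith), abs_of_nonpos (by linarith)]
      linarith
  have h1 := h (A / B) (by positivity)
  have e1 : A ^ a - B ^ a = B ^ a * ((A / B) ^ a - 1) := by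
    rw [Real.div_rpow hA hB.le]; field_simp
  have e2 : A - B = B * (A / B - 1) := by field_simp
  rw [e1, e2, abs_mul, abs_mul, abs_of_pos hB, abs_of_pos (Real.rpow_pos_of_pos hB a), ← mul_assoc,
    Real.rpow_sub_one hB.ne', div_mul_cancel₀ _ hB.ne']
  gcongr

/-- Both symbols are powers s/4 ≤ 1, of (1+ξ²)² and of m⁴, so `abs_rpow_sub_rpow_le` reduces the
claim to polynomials. The gain of one power of |m| is paid for by (1+|ξ-m|)⁴, harmless against a
Schwartz profile. -/
theorem abs_jap_sub_le {s : ℝ} (hs : 0 ≤ s) (hs4 : s ≤ 4) {m : ℝ} (hm : 1 / 2 ≤ |m|) (ξ : ℝ) :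
    |jap s ξ - |m| ^ s| ≤ 12 * |m| ^ (s - 1) * (1 + |ξ - m|) ^ 4 := by
  have hm0 : 0 < |m| := by linarith
  have e1 : jap s ξ = ((1 + ξ ^ 2) ^ 2) ^ (s / 4) := by
    rw [jap, ← Real.rpow_natCast (1 + ξ ^ 2) 2, ← Real.rpow_mul (by positivity)]
    congr 1; push_cast; ring
  have e2 : |m| ^ s = (|m| ^ 4) ^ (s / 4) := by
    rw [← Real.rpow_natCast, ← Real.rpow_mul (by positivity)]
    congr 1; push_cast; ring
  have e3 : (|m| ^ 4) ^ (s / 4 - 1) * |m| ^ 3 = |m| ^ (s - 1) := by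
    rw [← Real.rpow_natCast, ← Real.rpow_natCast, ← Real.rpow_mul (by positivity),
      ← Real.rpow_add hm0]
    congr 1; push_cast; ring
  have h1 := abs_rpow_sub_rpow_le (A := (1 + ξ ^ 2) ^ 2) (B := |m| ^ 4) (a := s / 4)
    (by positivity) (by positivity) (by linarith) (by linarith)
  rw [e1, e2]
  refine h1.trans ?_
  -- Difference of two squares: the factors are bounded by 2|m|(1+|η|)² and 6|m|²(1+|η|)², and |m| ≥
  -- 1/2 absorbs the lower-order terms.
  have h2 : |(1 + ξ ^ 2) ^ 2 - |m| ^ 4| ≤ 12 * |m| ^ 3 * (1 + |ξ - m|) ^ 4 := by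
    set η := ξ - m with hη
    have hξ : ξ = m + η := by rw [hη]; ring
    have hq : |m| ^ 2 = m ^ 2 := sq_abs m
    have hq2 : |η| ^ 2 = η ^ 2 := sq_abs η
    have ha : |2 * m * η| = 2 * |m| * |η| := by rw [abs_mul, abs_mul]; norm_num
    have hη0 := abs_nonneg η
    have f1 : |1 + ξ ^ 2 - m ^ 2| ≤ 2 * |m| * (1 + |η|) ^ 2 := by
      have : 1 + ξ ^ 2 - m ^ 2 = 1 + 2 * m * η + η ^ 2 := by rw [hξ]; ring
      rw [this]
      calc _ ≤ |1 + 2 * m * η| + |η ^ 2| := abs_add_le _ _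
        _ ≤ 1 + 2 * |m| * |η| + |η| ^ 2 := by
          rw [abs_pow]
          have := abs_add_le (1 : ℝ) (2 * m * η)
          rw [ha, abs_one] at this
          linarith
        _ ≤ _ := by nlinarith [mul_nonneg hm0.le hη0, sq_nonneg |η|]
    have f2 : |1 + ξ ^ 2 + m ^ 2| ≤ 6 * |m| ^ 2 * (1 + |η|) ^ 2 := by
      rw [abs_of_nonneg (by positivity)]
      have h3 : 2 * m * η ≤ 2 * |m| * |η| := ha ▸ le_abs_self _
      have h4 : 1 ≤ 4 * |m| ^ 2 := by nlinarith
      have h5 : |m| ≤ 2 * |m| ^ 2 := by nlinarith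
      calc 1 + ξ ^ 2 + m ^ 2 = 1 + 2 * m ^ 2 + 2 * m * η + η ^ 2 := by rw [hξ]; ring
        _ ≤ 4 * |m| ^ 2 + 2 * |m| ^ 2 + 2 * (2 * |m| ^ 2) * |η| + 4 * |m| ^ 2 * |η| ^ 2 := by
          have h6 := mul_le_mul_of_nonneg_right h5 hη0
          have h7 := mul_le_mul_of_nonneg_right h4 (sq_nonneg |η|)
          rw [hq2, ← hq] at *
          linarith
        _ ≤ _ := by nlinarith [mul_nonneg (sq_nonneg |m|) hη0, mul_nonneg (sq_nonneg |m|) (sq_nonneg |η|)]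
    have e : (1 + ξ ^ 2) ^ 2 - |m| ^ 4 = (1 + ξ ^ 2 - m ^ 2) * (1 + ξ ^ 2 + m ^ 2) := by
      rw [show |m| ^ 4 = (|m| ^ 2) ^ 2 by ring, hq]; ring
    rw [e, abs_mul]
    calc _ ≤ 2 * |m| * (1 + |η|) ^ 2 * (6 * |m| ^ 2 * (1 + |η|) ^ 2) :=
          mul_le_mul f1 f2 (abs_nonneg _) (by positivity)
      _ = _ := by ring
  calc _ ≤ (|m| ^ 4) ^ (s / 4 - 1) * (12 * |m| ^ 3 * (1 + |ξ - m|) ^ 4) := by gcongr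
    _ = 12 * ((|m| ^ 4) ^ (s / 4 - 1) * |m| ^ 3) * (1 + |ξ - m|) ^ 4 := by ring
    _ = _ := by rw [e3]

/-- The commutator `J^s(χ e^{2πimx}) - |m|^s χ e^{2πimx}`. -/
def commExp (s m : ℝ) : 𝓢(ℝ, ℂ) := besselS s (cutExp m) - ((|m| ^ s : ℝ) : ℂ) • cutExp m

theorem fourier_commExp (s m ξ : ℝ) :
    𝓕 (commExp s m) ξ = ((jap s ξ - |m| ^ s : ℝ) : ℂ) * 𝓕 (cutExp 0) (ξ - m) := by
  have h : 𝓕 (commExp s m) = 𝓕 (besselS s (cutExp m)) - ((|m| ^ s : ℝ) : ℂ) • 𝓕 (cutExp m) := by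
    rw [commExp, ← FourierTransform.fourierCLM_apply (R := ℂ), map_sub, map_smul]
    rfl
  rw [h, sub_apply, smul_apply, fourier_besselS, fourier_cutExp, smul_eq_mul]
  push_cast; ring

theorem norm_fourier_commExp_le {s : ℝ} (hs : 0 ≤ s) (hs4 : s ≤ 4) {m : ℝ} (hm : 1 / 2 ≤ |m|)
    (ξ : ℝ) : ‖𝓕 (commExp s m) ξ‖ ≤
      12 * |m| ^ (s - 1) * ((1 + |ξ - m|) ^ 4 * ‖𝓕 (cutExp 0) (ξ - m)‖) := by
  rw [fourier_commExp, norm_mul, Complex.norm_real, Real.norm_eq_abs, ← mul_assoc]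
  gcongr
  exact abs_jap_sub_le hs hs4 hm ξ
open scoped FourierTransform

/-! ### Norms of the commutator from bounds on its Fourier transform -/

theorem exists_weighted_integrable (f : 𝓢(ℝ, ℂ)) :
    Integrable (fun η : ℝ => (1 + |η|) ^ 4 * ‖f η‖) ∧
      Integrable (fun η : ℝ => ((1 + |η|) ^ 4 * ‖f η‖) ^ 2) := by
  obtain ⟨C, hC0, hC⟩ : ∃ C : ℝ, 0 ≤ C ∧ ∀ η : ℝ, (1 + |η|) ^ 6 * ‖f η‖ ≤ C := by
    have h := fun η : ℝ =>
      SchwartzMap.one_add_le_sup_seminorm_apply (𝕜 := ℝ) (m := (6, 0)) (k := 6) (n := 0) le_rfl le_rfl f η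
    simp only [norm_iteratedFDeriv_zero] at h
    exact ⟨_, le_trans (by positivity) (h 0), h⟩
  have hcont : Continuous fun η : ℝ => (1 + |η|) ^ 4 * ‖f η‖ := by
    have := f.continuous
    fun_prop
  have hb : ∀ η : ℝ, (1 + |η|) ^ 4 * ‖f η‖ ≤ C * (1 + ‖η‖) ^ (-2 : ℝ) := by
    intro η
    have h0 : 0 < 1 + |η| := by positivity
    rw [Real.norm_eq_abs, Real.rpow_neg h0.le, ← div_eq_mul_inv, le_div_iff₀ (by positivity)]
    refine le_of_eq_of_le ?_ (hC η)
    rw [show (2 : ℝ) = ((2 : ℕ) : ℝ) by norm_num, Real.rpow_natCast]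
    ring
  have h1 : Integrable (fun η : ℝ => (1 + |η|) ^ 4 * ‖f η‖) := by
    refine ((integrable_one_add_norm (E := ℝ) (r := 2) (by simp)).const_mul C).mono'
      hcont.aestronglyMeasurable (ae_of_all _ fun η => ?_)
    rw [Real.norm_of_nonneg (by positivity)]
    exact hb η
  refine ⟨h1, (h1.const_mul C).mono' (hcont.pow 2).aestronglyMeasurable (ae_of_all _ fun η => ?_)⟩
  rw [Real.norm_of_nonneg (by positivity), sq]
  refine mul_le_mul_of_nonneg_right (le_trans ?_ (hC η)) (by positivity)
  gcongr
  · linarith [abs_nonneg η]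
  · norm_num

theorem norm_le_integral_norm_fourier (f : 𝓢(ℝ, ℂ)) (x : ℝ) : ‖f x‖ ≤ ∫ ξ, ‖𝓕 f ξ‖ := by
  have h := SchwartzMap.norm_fourier_apply_le_toLp_one (𝓕 f) (-x)
  rw [SchwartzMap.norm_toLp_one] at h
  refine le_of_eq_of_le ?_ h
  congr 1
  have e : 𝓕⁻ (𝓕 f) = f := FourierTransform.fourierInv_fourier_eq f
  conv_lhs => rw [← e]
  rw [SchwartzMap.fourierInv_apply_eq]
  rfl

/-- Plancherel gives L², the L¹ norm of the transform gives L^∞, and |f|⁴ ≤ a²|f|² gives L⁴. -/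
theorem eLpNorm_le_of_fourier (f : 𝓢(ℝ, ℂ)) {a : ℝ} (ha : 0 ≤ a) (h1 : ∫ ξ, ‖𝓕 f ξ‖ ≤ a)
    (h2 : ∫ ξ, ‖𝓕 f ξ‖ ^ 2 ≤ a ^ 2) :
    eLpNorm f 2 volume ≤ ENNReal.ofReal a ∧ eLpNorm f 4 volume ≤ ENNReal.ofReal a := by
  have hl2 : ∫⁻ x, ‖f x‖ₑ ^ 2 ≤ ENNReal.ofReal a ^ 2 := by
    rw [lintegral_enorm_sq_eq (f.memLp 2 volume), ← ENNReal.ofReal_pow ha]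
    refine ENNReal.ofReal_le_ofReal ?_
    rwa [← SchwartzMap.integral_norm_sq_fourier]
  constructor
  · rw [lintegral_enorm_pow_eq f (n := 2) (by norm_num)] at hl2
    exact_mod_cast (ENNReal.pow_le_pow_left_iff (n := 2) (by norm_num)).1 hl2
  · have hl4 : ∫⁻ x, ‖f x‖ₑ ^ 4 ≤ ENNReal.ofReal a ^ 4 := by
      calc ∫⁻ x, ‖f x‖ₑ ^ 4 ≤ ∫⁻ x, ENNReal.ofReal a ^ 2 * ‖f x‖ₑ ^ 2 := by
            refine lintegral_mono fun x => ?_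
            rw [show (4 : ℕ) = 2 + 2 by rfl, pow_add]
            refine mul_le_mul_left (pow_le_pow_left₀ zero_le ?_ 2) _
            rw [← ofReal_norm]
            exact ENNReal.ofReal_le_ofReal ((norm_le_integral_norm_fourier f x).trans h1)
        _ = ENNReal.ofReal a ^ 2 * ∫⁻ x, ‖f x‖ₑ ^ 2 :=
            lintegral_const_mul' _ _ (by simp)
        _ ≤ ENNReal.ofReal a ^ 2 * ENNReal.ofReal a ^ 2 := by gcongr
        _ = _ := by rw [← pow_add]
    rw [lintegral_enorm_pow_eq f (n := 4) (by norm_num)] at hl4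
    exact_mod_cast (ENNReal.pow_le_pow_left_iff (n := 4) (by norm_num)).1 hl4

/-- The majorant of the transform is a fixed profile translated by m, so its integrals do not depend
on m. -/
theorem exists_eLpNorm_commExp_le {s : ℝ} (hs : 0 ≤ s) (hs4 : s ≤ 4) : ∃ K : ℝ, 0 < K ∧
    ∀ m : ℝ, 1 / 2 ≤ |m| →
      eLpNorm (commExp s m) 2 volume ≤ ENNReal.ofReal (K * |m| ^ (s - 1)) ∧
      eLpNorm (commExp s m) 4 volume ≤ ENNReal.ofReal (K * |m| ^ (s - 1)) := by
  obtain ⟨hi1, hi2⟩ := exists_weighted_integrable (𝓕 (cutExp 0))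
  set w : ℝ → ℝ := fun η => (1 + |η|) ^ 4 * ‖𝓕 (cutExp 0) η‖ with hw
  have hw0 : ∀ η, 0 ≤ w η := fun η => by positivity
  set K₁ := ∫ η, w η
  set K₂ := ∫ η, w η ^ 2
  have hK₁ : 0 ≤ K₁ := integral_nonneg hw0
  have hK₂ : 0 ≤ K₂ := integral_nonneg fun η => sq_nonneg _
  refine ⟨12 * (K₁ + K₂ + 1), by positivity, fun m hm => ?_⟩
  have hp : 0 ≤ |m| ^ (s - 1) := by positivity
  have hle := norm_fourier_commExp_le hs hs4 hm
  have e1 : ∫ ξ, w (ξ - m) = K₁ := integral_sub_right_eq_self w m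
  have e2 : ∫ ξ, w (ξ - m) ^ 2 = K₂ := integral_sub_right_eq_self (fun η => w η ^ 2) m
  refine eLpNorm_le_of_fourier _ (by positivity) ?_ ?_
  · calc _ ≤ ∫ ξ, 12 * |m| ^ (s - 1) * w (ξ - m) :=
          integral_mono_of_nonneg (ae_of_all _ fun _ => norm_nonneg _)
            ((hi1.comp_sub_right m).const_mul _) (ae_of_all _ hle)
      _ = 12 * |m| ^ (s - 1) * K₁ := by rw [integral_const_mul, e1]
      _ ≤ _ := by nlinarith
  · calc _ ≤ ∫ ξ, (12 * |m| ^ (s - 1)) ^ 2 * w (ξ - m) ^ 2 := by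
          refine integral_mono_of_nonneg (ae_of_all _ fun _ => sq_nonneg _)
            ((hi2.comp_sub_right m).const_mul _) (ae_of_all _ fun ξ => ?_)
          change _ ≤ (12 * |m| ^ (s - 1)) ^ 2 * w (ξ - m) ^ 2
          rw [← mul_pow]
          exact pow_le_pow_left₀ (norm_nonneg _) (hle ξ) 2
      _ = (12 * |m| ^ (s - 1)) ^ 2 * K₂ := by rw [integral_const_mul, e2]
      _ ≤ (12 * |m| ^ (s - 1)) ^ 2 * (K₁ + K₂ + 1) ^ 2 := by
          refine mul_le_mul_of_nonneg_left ?_ (sq_nonneg _)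
          nlinarith
      _ = _ := by ring

/-! ### Bessel potentials of the cut-off sines -/

theorem contDiff_sinPh (δ : ℝ) (k : ℕ) : ContDiff ℝ ∞ (sinPh δ k) :=
  Complex.ofRealCLM.contDiff.comp
    (Real.contDiff_sin.comp ((contDiff_const.mul contDiff_id).add contDiff_const))

/-- The extension `(k+1)^{-s} χ(x) sin((k+1)πx)` of the normalized sine functions. -/
def extSin (s : ℝ) (k : ℕ) : 𝓢(ℝ, ℂ) :=
  ((((k : ℝ) + 1) ^ (-s) : ℝ) : ℂ) • cutMul (sinPh 0 k) (contDiff_sinPh 0 k)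

theorem extSin_apply (s : ℝ) (k : ℕ) (x : ℝ) :
    extSin s k x = ((((k : ℝ) + 1) ^ (-s) : ℝ) : ℂ) * ((cut x : ℂ) * sinPh 0 k x) := rfl

theorem norm_rpow_neg_le_one {s : ℝ} (hs : 0 ≤ s) (k : ℕ) :
    ‖((((k : ℝ) + 1) ^ (-s) : ℝ) : ℂ)‖ ≤ 1 := by
  rw [Complex.norm_real, Real.norm_of_nonneg (by positivity)]
  exact Real.rpow_le_one_of_one_le_of_nonpos (by linarith [k.cast_nonneg (α := ℝ)]) (by linarith)

theorem admissible_cut_sin (T : ℝ) :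
    Admissible T volume (fun k x => (cut x : ℂ) * sinPh 0 k x) 3 :=
  (admissible_sinPh T 0).cutoff
    (Complex.continuous_ofReal.comp cut.continuous).stronglyMeasurable
    (fun x => by rw [Complex.norm_real, Real.norm_of_nonneg cut.nonneg]; exact cut.le_one)
    fun x hx => by rw [cut_eq_zero hx, Complex.ofReal_zero]

theorem admissible_extSin (T : ℝ) {s : ℝ} (hs : 0 ≤ s) :
    Admissible T volume (fun k => ⇑(extSin s k)) 3 :=
  (admissible_cut_sin T).mul_left (norm_rpow_neg_le_one hs)

theorem cutMul_sinPh_eq (k : ℕ) : cutMul (sinPh 0 k) (contDiff_sinPh 0 k) =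
    (1 / (2 * Complex.I)) • (cutExp (((k : ℝ) + 1) / 2) - cutExp (-(((k : ℝ) + 1) / 2))) := by
  ext x
  rw [smul_apply, sub_apply, cutExp, cutExp, cutMul_apply, cutMul_apply,
    cutMul_apply, sinPh_eq, expE, expE, smul_eq_mul]
  have e1 : Complex.I * Real.pi * (k + 1) * (x : ℂ) =
    Complex.I * (2 * Real.pi * ((((k : ℝ) + 1) / 2 : ℝ) : ℂ)) * x := by push_cast; ring
  have e2 : Complex.I * Real.pi * (k + 1) * ((-x : ℝ) : ℂ) =
    Complex.I * (2 * Real.pi * ((-(((k : ℝ) + 1) / 2) : ℝ) : ℂ)) * x := by push_cast; ring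
  rw [e1, e2]
  simp only [Complex.ofReal_zero, mul_zero, neg_zero, Complex.exp_zero]
  ring

/-- The remainder in the Bessel potential of `extSin`. -/
def remSin (s : ℝ) (k : ℕ) : 𝓢(ℝ, ℂ) :=
  (((((k : ℝ) + 1) ^ (-s) : ℝ) : ℂ) * (1 / (2 * Complex.I))) •
    (commExp s (((k : ℝ) + 1) / 2) - commExp s (-(((k : ℝ) + 1) / 2)))

/-- The sine has frequencies m = ±(k+1)/2, so |m|^s against the normalization (k+1)^{-s} leaves the
constant 2^{-s}. -/
theorem besselS_extSin (s : ℝ) (k : ℕ) (x : ℝ) :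
    besselS s (extSin s k) x =
      ((2 ^ (-s) : ℝ) : ℂ) * ((cut x : ℂ) * sinPh 0 k x) + remSin s k x := by
  have hk : (0 : ℝ) < (k : ℝ) + 1 := by positivity
  have hm : |((k : ℝ) + 1) / 2| = ((k : ℝ) + 1) / 2 := abs_of_pos (by positivity)
  have e : ((((k : ℝ) + 1) ^ (-s) : ℝ) : ℂ) * (((((k : ℝ) + 1) / 2) ^ s : ℝ) : ℂ) =
      ((2 ^ (-s) : ℝ) : ℂ) := by
    rw [← Complex.ofReal_mul, Real.div_rpow hk.le (by norm_num), Real.rpow_neg hk.le,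
      Real.rpow_neg (by norm_num)]
    have := (Real.rpow_pos_of_pos hk s).ne'
    field_simp
  have h := congrArg (fun f : 𝓢(ℝ, ℂ) => f x) (cutMul_sinPh_eq k)
  simp only [smul_apply, sub_apply, smul_eq_mul, cutMul_apply] at h
  rw [extSin, map_smul, cutMul_sinPh_eq, map_smul, map_sub, remSin, h, ← e, commExp, commExp, abs_neg,
    hm]
  simp only [smul_apply, sub_apply, smul_eq_mul]
  ring

theorem eLpNorm_remSin_le {s K : ℝ} {p : ℝ≥0∞} (hp : 1 ≤ p) (hK : 0 ≤ K)
    (h : ∀ m : ℝ, 1 / 2 ≤ |m| →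
      eLpNorm (commExp s m) p volume ≤ ENNReal.ofReal (K * |m| ^ (s - 1))) (k : ℕ) :
    eLpNorm (remSin s k) p volume ≤ ENNReal.ofReal (2 ^ (1 - s) * K / ((k : ℝ) + 1)) := by
  have hk : (0 : ℝ) < (k : ℝ) + 1 := by positivity
  have hm : |((k : ℝ) + 1) / 2| = ((k : ℝ) + 1) / 2 := abs_of_pos (by positivity)
  have hm2 : 1 / 2 ≤ |((k : ℝ) + 1) / 2| := by rw [hm]; linarith [k.cast_nonneg (α := ℝ)]
  have h1 := h _ hm2
  have h2 := h (-(((k : ℝ) + 1) / 2)) (by rwa [abs_neg])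
  rw [abs_neg] at h2
  rw [hm] at h1 h2
  have hsub := eLpNorm_sub_le (commExp s (((k : ℝ) + 1) / 2)).continuous.aestronglyMeasurable
    (commExp s (-(((k : ℝ) + 1) / 2))).continuous.aestronglyMeasurable hp (μ := volume)
  have hc : ‖((((k : ℝ) + 1) ^ (-s) : ℝ) : ℂ) * (1 / (2 * Complex.I))‖ =
      ((k : ℝ) + 1) ^ (-s) / 2 := by
    rw [norm_mul, Complex.norm_real, Real.norm_of_nonneg (by positivity)]
    simp [div_eq_mul_inv]
  have e : ⇑(remSin s k) = (((((k : ℝ) + 1) ^ (-s) : ℝ) : ℂ) * (1 / (2 * Complex.I))) •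
      (⇑(commExp s (((k : ℝ) + 1) / 2)) - ⇑(commExp s (-(((k : ℝ) + 1) / 2)))) := rfl
  rw [e, eLpNorm_const_smul, ← ofReal_norm, hc]
  calc _ ≤ ENNReal.ofReal (((k : ℝ) + 1) ^ (-s) / 2) *
        (ENNReal.ofReal (K * (((k : ℝ) + 1) / 2) ^ (s - 1)) +
          ENNReal.ofReal (K * (((k : ℝ) + 1) / 2) ^ (s - 1))) := by
        gcongr
        exact hsub.trans (add_le_add h1 h2)
    _ = ENNReal.ofReal (((k : ℝ) + 1) ^ (-s) / 2 * (K * (((k : ℝ) + 1) / 2) ^ (s - 1) +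
          K * (((k : ℝ) + 1) / 2) ^ (s - 1))) := by
        rw [ENNReal.ofReal_mul (p := ((k : ℝ) + 1) ^ (-s) / 2) (by positivity),
          ENNReal.ofReal_add (by positivity) (by positivity)]
    _ = _ := by
        congr 1
        rw [Real.div_rpow hk.le (by norm_num), Real.rpow_sub_one hk.ne', Real.rpow_neg hk.le,
          show 1 - s = -(s - 1) by ring, Real.rpow_neg (by norm_num)]
        have := (Real.rpow_pos_of_pos hk s).ne'
        field_simp
        ring

/-- The leading part is a fixed multiple of the cut-off sines. The commutators have norms
O((k+1)^{-s}(k+1)^{s-1}) = O(1/(k+1)), which are square-summable. -/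
theorem exists_admissible_besselS_extSin {T : ℝ} (hT : 0 ≤ T) {s : ℝ} (hs : 0 ≤ s) (hs4 : s ≤ 4) :
    ∃ A, Admissible T volume (fun k => ⇑(besselS s (extSin s k))) A := by
  obtain ⟨K, hK, h⟩ := exists_eLpNorm_commExp_le hs hs4
  have hsum : Summable fun k : ℕ => (2 ^ (1 - s) * K / ((k : ℝ) + 1)) ^ 2 := by
    have h1 : Summable fun k : ℕ => 1 / ((k : ℝ) + 1) ^ 2 := by
      have := (summable_nat_add_iff 1).2 (Real.summable_one_div_nat_pow.2 (one_lt_two))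
      simpa using this
    refine (h1.mul_left ((2 ^ (1 - s) * K) ^ 2)).congr fun k => ?_
    rw [div_pow]; ring
  have hrem := admissible_of_summable hT (r := fun k => ⇑(remSin s k))
    (fun k => (remSin s k).continuous.stronglyMeasurable)
    (a := fun k => 2 ^ (1 - s) * K / ((k : ℝ) + 1)) (fun k => by positivity) hsum
    (eLpNorm_remSin_le (by norm_num) hK.le fun m hm => (h m hm).1)
    (eLpNorm_remSin_le (by norm_num) hK.le fun m hm => (h m hm).2)
  have hadd := ((admissible_cut_sin T).const_mul ((2 ^ (-s) : ℝ) : ℂ)).add hrem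
  have e : (fun k => ⇑(besselS s (extSin s k))) =
      fun (k : ℕ) x => ((2 ^ (-s) : ℝ) : ℂ) * ((cut x : ℂ) * sinPh 0 k x) + remSin s k x := by
    funext k x
    exact besselS_extSin s k x
  exact ⟨_, e ▸ hadd⟩

/-! ### Sobolev norms of curves -/

theorem sobolevENorm_le {s : ℝ} {p : ℝ≥0∞} [Fact (1 ≤ p)] {I : Set ℝ} {f : ℝ → ℂ}
    {F g : Lp ℂ p (volume : Measure ℝ)} (hF : F =ᵐ[volume.restrict I] f)
    (h : TemperedDistribution.besselPotential ℝ ℂ s (F : 𝓢'(ℝ, ℂ)) = (g : 𝓢'(ℝ, ℂ))) :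
    sobolevENorm s p I f ≤ ‖g‖ₑ :=
  iInf_le_of_le F (iInf_le_of_le g (iInf_le_of_le hF (iInf_le _ h)))

/-- The Bessel potential of the distribution of an `L^p` function, as a continuous linear map. -/
def besselLp (s : ℝ) (p : ℝ≥0∞) [Fact (1 ≤ p)] : Lp ℂ p (volume : Measure ℝ) →L[ℂ] 𝓢'(ℝ, ℂ) :=
  (TemperedDistribution.besselPotential ℝ ℂ s).comp (Lp.toTemperedDistributionCLM ℂ volume p)

theorem besselLp_toLp (s : ℝ) (p : ℝ≥0∞) [Fact (1 ≤ p)] (f : 𝓢(ℝ, ℂ)) :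
    besselLp s p (f.toLp p) = Lp.toTemperedDistributionCLM ℂ volume p ((besselS s f).toLp p) :=
  besselPotential_toLp s p f

/-- Restriction to the unit interval. -/
def restrUnit : Lp ℂ 2 (volume : Measure ℝ) →L[ℂ] L2 :=
  LpToLpRestrictCLM ℝ ℂ ℂ volume 2 (Ioo 0 1)

theorem coeFn_restrUnit (F : Lp ℂ 2 (volume : Measure ℝ)) :
    F =ᵐ[volume.restrict (Ioo 0 1)] restrUnit F :=
  (LpToLpRestrictCLM_coeFn ℂ (Ioo (0 : ℝ) 1) F).symm

theorem restrUnit_extSin (s : ℝ) (k : ℕ) :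
    restrUnit ((extSin s k).toLp 2 volume) = ((((k : ℝ) + 1) ^ (-s) : ℝ) : ℂ) • sinVec 0 k := by
  refine Lp.ext ?_
  filter_upwards [coeFn_restrUnit ((extSin s k).toLp 2 volume),
    ae_restrict_of_ae ((extSin s k).coeFn_toLp 2 volume), coeFn_sinVec 0 k,
    Lp.coeFn_smul ((((k : ℝ) + 1) ^ (-s) : ℝ) : ℂ) (sinVec 0 k),
    ae_restrict_mem measurableSet_Ioo] with x h1 h2 h3 h4 h5
  rw [← h1, h2, h4, Pi.smul_apply, h3, extSin_apply, cut_eq_one (Ioo_subset_Icc_self h5)]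
  simp

section SobolevCurve

variable {T s B : ℝ} {b : ℝ → ℕ → ℂ}

/-- The extension of `∑ b_k(t) (k+1)^{-s} sin((k+1)πx)` to the line. -/
def extCurve (s : ℝ) (b : ℝ → ℕ → ℂ) (t : ℝ) : Lp ℂ 2 (volume : Measure ℝ) :=
  ∑' k, b t k • (extSin s k).toLp 2 volume

/-- The Bessel potential of `extCurve`. -/
def besCurve (s : ℝ) (b : ℝ → ℕ → ℂ) (t : ℝ) : Lp ℂ 2 (volume : Measure ℝ) :=
  ∑' k, b t k • (besselS s (extSin s k)).toLp 2 volume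

theorem restrUnit_extCurve (hs : 0 ≤ s) (hb : GoodFamily T B b) {t : ℝ} (ht : t ∈ Icc 0 T) :
    restrUnit (extCurve s b t) =
      ∑' k, b t k • (((((k : ℝ) + 1) ^ (-s) : ℝ) : ℂ) • sinVec 0 k) := by
  have hsum := (admissible_extSin T hs).summable_smul
    (fun k => (extSin s k).coeFn_toLp 2 volume) hb ht
  have h := (restrUnit.hasSum hsum.hasSum).tsum_eq
  rw [extCurve, ← h]
  refine tsum_congr fun k => ?_
  rw [map_smul, restrUnit_extSin]

/-- Both series converge in L², hence as distributions, and the Bessel potential is continuous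
there; the two sums agree term by term. -/
theorem besselLp_extCurve (hT : 0 ≤ T) (hs : 0 ≤ s) (hs4 : s ≤ 4) (hb : GoodFamily T B b) {t : ℝ}
    (ht : t ∈ Icc 0 T) :
    besselLp s 2 (extCurve s b t) = Lp.toTemperedDistributionCLM ℂ volume 2 (besCurve s b t) := by
  obtain ⟨A, hA⟩ := exists_admissible_besselS_extSin hT hs hs4
  have h1 := (besselLp s 2).hasSum ((admissible_extSin T hs).summable_smul
    (fun k => (extSin s k).coeFn_toLp 2 volume) hb ht).hasSum
  have h2 := (Lp.toTemperedDistributionCLM ℂ volume 2).hasSum (hA.summable_smul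
    (fun k => (besselS s (extSin s k)).coeFn_toLp 2 volume) hb ht).hasSum
  refine h1.unique ?_
  have e : ∀ k, besselLp s 2 (b t k • (extSin s k).toLp 2 volume) =
      Lp.toTemperedDistributionCLM ℂ volume 2 (b t k • (besselS s (extSin s k)).toLp 2 volume) :=
    fun k => by rw [map_smul, map_smul, besselLp_toLp]
  simp only [e]
  exact h2

theorem toTemperedDistribution_congr {p q : ℝ≥0∞} [Fact (1 ≤ p)] [Fact (1 ≤ q)]
    {F : Lp ℂ p (volume : Measure ℝ)} {G : Lp ℂ q (volume : Measure ℝ)} (h : F =ᵐ[volume] G) :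
    (F : 𝓢'(ℝ, ℂ)) = (G : 𝓢'(ℝ, ℂ)) := by
  ext φ
  rw [Lp.toTemperedDistribution_apply, Lp.toTemperedDistribution_apply]
  refine integral_congr_ae ?_
  filter_upwards [h] with x hx
  rw [hx]

theorem eLpNorm_four_eq {α : Type*} [MeasurableSpace α] {μ : Measure α} (f : α → ℂ) :
    eLpNorm f 4 μ = (∫⁻ x, ‖f x‖ₑ ^ (4 : ℝ) ∂μ) ^ (1 / 4 : ℝ) := by
  rw [eLpNorm_eq_lintegral_rpow_enorm_toReal (by norm_num) (by norm_num), ENNReal.toReal_ofNat]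

/-- Slices of a function in `L⁴` of space-time. -/
theorem exists_measurable_eLpNorm_slices {u : ℝ × ℝ → ℂ} (hu : StronglyMeasurable u) {R : ℝ}
    (h : eLpNorm u 4 ((volume : Measure ℝ).prod (volume.restrict (Ioo 0 T))) ≤ ENNReal.ofReal R) :
    Measurable (fun t => eLpNorm (fun x => u (x, t)) 4 volume) ∧
      (∀ᵐ t ∂volume.restrict (Ioo 0 T), MemLp (fun x => u (x, t)) 4 volume) ∧
      (∫⁻ t in Ioo 0 T, eLpNorm (fun x => u (x, t)) 4 volume ^ (4 : ℝ)) ^ (1 / 4 : ℝ) ≤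
        ENNReal.ofReal R := by
  have hm : Measurable fun z : ℝ × ℝ => ‖u z‖ₑ ^ (4 : ℝ) := hu.measurable.enorm.pow_const _
  have hm2 : Measurable fun t => ∫⁻ x, ‖u (x, t)‖ₑ ^ (4 : ℝ) := hm.lintegral_prod_left'
  simp only [eLpNorm_four_eq] at h ⊢
  have e : ∀ t, ((∫⁻ x, ‖u (x, t)‖ₑ ^ (4 : ℝ)) ^ (1 / 4 : ℝ)) ^ (4 : ℝ) =
      ∫⁻ x, ‖u (x, t)‖ₑ ^ (4 : ℝ) := fun t => by
    rw [← ENNReal.rpow_mul]; norm_num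
  rw [lintegral_prod_symm _ hm.aemeasurable] at h
  refine ⟨hm2.pow_const _, ?_, by simpa only [e] using h⟩
  have hfin : ∫⁻ t in Ioo 0 T, ∫⁻ x, ‖u (x, t)‖ₑ ^ (4 : ℝ) ≠ ⊤ := by
    intro htop
    rw [htop, ENNReal.top_rpow_of_pos (by norm_num)] at h
    exact absurd h (by simp)
  filter_upwards [ae_lt_top hm2 hfin] with t ht
  refine ⟨(hu.comp_measurable measurable_prodMk_right).aestronglyMeasurable, ?_⟩
  rw [eLpNorm_four_eq]
  exact ENNReal.rpow_lt_top_of_nonneg (by norm_num) ht.ne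

theorem lintegral_const_pow_four_le (hT : 0 ≤ T) {D : ℝ} (hD : 0 ≤ D) :
    (∫⁻ _ in Ioo 0 T, ENNReal.ofReal D ^ (4 : ℝ)) ^ (1 / 4 : ℝ) ≤
      ENNReal.ofReal ((T + 1) * D) := by
  rw [lintegral_const, Measure.restrict_apply_univ, Real.volume_Ioo, sub_zero,
    ENNReal.mul_rpow_of_nonneg _ _ (by norm_num), ← ENNReal.rpow_mul,
    show (4 : ℝ) * (1 / 4) = 1 by norm_num, ENNReal.rpow_one,
    ENNReal.ofReal_rpow_of_nonneg hT (by norm_num), ← ENNReal.ofReal_mul hD, mul_comm]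
  refine ENNReal.ofReal_le_ofReal (mul_le_mul_of_nonneg_right ?_ hD)
  calc T ^ (1 / 4 : ℝ) ≤ (T + 1) ^ (1 / 4 : ℝ) :=
        Real.rpow_le_rpow hT (by linarith) (by norm_num)
    _ ≤ (T + 1) ^ (1 : ℝ) := Real.rpow_le_rpow_of_exponent_le (by linarith) (by norm_num)
    _ = T + 1 := Real.rpow_one _

variable {M : ℝ} {q : ℝ → ℂ}

theorem besselLp_extCurve_add (hT : 0 ≤ T) (hs : 0 ≤ s) (hs4 : s ≤ 4) (hb : GoodFamily T B b)
    (f : 𝓢(ℝ, ℂ)) {t : ℝ} (ht : t ∈ Icc 0 T) (c : ℂ) :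
    besselLp s 2 (extCurve s b t + c • f.toLp 2 volume) = Lp.toTemperedDistributionCLM ℂ volume 2
      (besCurve s b t + c • (besselS s f).toLp 2 volume) := by
  rw [map_add, map_smul, besselLp_extCurve hT hs hs4 hb ht, besselLp_toLp, map_add, map_smul]

theorem sobolevENorm_extCurve_add_le (hT : 0 ≤ T) (hs : 0 ≤ s) (hs4 : s ≤ 4)
    (hb : GoodFamily T B b) (f : 𝓢(ℝ, ℂ)) {t : ℝ} (ht : t ∈ Icc 0 T) (c : ℂ) :
    sobolevENorm s 2 (Ioo 0 1) (restrUnit (extCurve s b t + c • f.toLp 2 volume)) ≤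
      ‖besCurve s b t + c • (besselS s f).toLp 2 volume‖ₑ :=
  sobolevENorm_le (coeFn_restrUnit _) (besselLp_extCurve_add hT hs hs4 hb f ht c)

/-- The extension to the line is linear in the coefficients, so a difference of extensions extends
the difference, and continuity of the potentials in L² suffices. -/
theorem continuousHs_extCurve_add (hT : 0 ≤ T) (hs : 0 ≤ s) (hs4 : s ≤ 4)
    (hb : GoodFamily T B b) (f : 𝓢(ℝ, ℂ)) (hq : Continuous q) {U : ℝ → L2}
    (hU : ∀ t ∈ Icc 0 T, U t = restrUnit (extCurve s b t + q t • f.toLp 2 volume)) :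
    ContinuousHs s T U := by
  refine ⟨fun t ht => ?_, fun t₀ ht₀ => ?_⟩
  · rw [hU t ht]
    exact (sobolevENorm_extCurve_add_le hT hs hs4 hb f ht (q t)).trans_lt enorm_lt_top
  · obtain ⟨A, hA⟩ := exists_admissible_besselS_extSin hT hs hs4
    have hcont : ContinuousOn (fun t => besCurve s b t + q t • (besselS s f).toLp 2 volume) (Icc 0 T) :=
      (hA.continuousOn_tsum (fun k => (besselS s (extSin s k)).coeFn_toLp 2 volume) hb).add
        (hq.smul continuous_const).continuousOn
    have h1 : Tendsto (fun t => ‖(besCurve s b t + q t • (besselS s f).toLp 2 volume) -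
        (besCurve s b t₀ + q t₀ • (besselS s f).toLp 2 volume)‖ₑ) (𝓝[Icc 0 T] t₀) (𝓝 0) := by
      have h2 := ((hcont t₀ ht₀).tendsto.sub_const
        (besCurve s b t₀ + q t₀ • (besselS s f).toLp 2 volume)).enorm
      simpa using h2
    refine tendsto_of_tendsto_of_tendsto_of_le_of_le' tendsto_const_nhds h1
      (Eventually.of_forall fun _ => zero_le) ?_
    filter_upwards [self_mem_nhdsWithin] with t ht
    refine sobolevENorm_le (F := (extCurve s b t + q t • f.toLp 2 volume) -
      (extCurve s b t₀ + q t₀ • f.toLp 2 volume)) ?_ ?_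
    · refine (coeFn_restrUnit _).trans ?_
      rw [map_sub, ← hU t ht, ← hU t₀ ht₀]
      exact Lp.coeFn_sub _ _
    · change besselLp s 2 _ = Lp.toTemperedDistributionCLM ℂ volume 2 _
      rw [map_sub, map_sub, besselLp_extCurve_add hT hs hs4 hb f ht,
        besselLp_extCurve_add hT hs hs4 hb f ht₀]

theorem exists_l4HsNormLE_extCurve_add (hT : 0 ≤ T) (hs : 0 ≤ s) (hs4 : s ≤ 4) (f : 𝓢(ℝ, ℂ)) :
    ∃ C : ℝ, 0 < C ∧ ∀ (B : ℝ) (b : ℝ → ℕ → ℂ), 0 ≤ B → GoodFamily T B b →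
      ∀ (M : ℝ) (q : ℝ → ℂ), 0 ≤ M → (∀ t ∈ Icc 0 T, ‖q t‖ ≤ M) → ∀ U : ℝ → L2,
        (∀ t ∈ Icc 0 T, U t = restrUnit (extCurve s b t + q t • f.toLp 2 volume)) →
        L4HsNormLE s T U (ENNReal.ofReal (C * (B + M))) := by
  obtain ⟨A, hA⟩ := exists_admissible_besselS_extSin hT hs hs4
  set D : ℝ := ‖(besselS s f).toLp 4 volume‖ with hD
  have hD0 : 0 ≤ D := norm_nonneg _
  have hA0 := hA.nonneg
  refine ⟨A + (T + 1) * D + 1, by positivity, fun B b hB hb M q hM hq U hU => ?_⟩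
  -- The L⁴ Sobolev norm needs L⁴ representatives of both the extension and its potential. At a.e.
  -- time they coincide with the L² ones and define the same distributions, so the L² identity
  -- transfers.
  obtain ⟨u, hu1, hu2, hu3⟩ := (admissible_extSin T hs).exists_slices
    (fun k => (extSin s k).coeFn_toLp 2 volume) hT hB hb
  obtain ⟨v, hv1, hv2, hv3⟩ := hA.exists_slices
    (fun k => (besselS s (extSin s k)).coeFn_toLp 2 volume) hT hB hb
  obtain ⟨-, hu4, -⟩ := exists_measurable_eLpNorm_slices hu1 hu3
  obtain ⟨hvm, hv4, hv5⟩ := exists_measurable_eLpNorm_slices hv1 hv3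
  refine ⟨(fun t => eLpNorm (fun x => v (x, t)) 4 volume) + fun _ => ENNReal.ofReal (M * D),
    hvm.add measurable_const, ?_, ?_⟩
  · filter_upwards [hu2, hv2, hu4, hv4, ae_restrict_mem measurableSet_Ioo] with t h1 h2 h3 h4 ht
    have ht' := Ioo_subset_Icc_self ht
    have e1 : h3.toLp _ =ᵐ[volume] extCurve s b t := h3.coeFn_toLp.trans h1
    have e2 : h4.toLp _ =ᵐ[volume] besCurve s b t := h4.coeFn_toLp.trans h2
    have h5 : besselLp s 4 (h3.toLp _ + q t • f.toLp 4 volume) = Lp.toTemperedDistributionCLM ℂ volume 4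
        (h4.toLp _ + q t • (besselS s f).toLp 4 volume) := by
      have h6 : besselLp s 4 (h3.toLp _) = besselLp s 2 (extCurve s b t) :=
        congrArg (TemperedDistribution.besselPotential ℝ ℂ s) (toTemperedDistribution_congr e1)
      have h7 : Lp.toTemperedDistributionCLM ℂ volume 2 (besCurve s b t) =
          Lp.toTemperedDistributionCLM ℂ volume 4 (h4.toLp _) :=
        (toTemperedDistribution_congr e2).symm
      rw [map_add, map_add, map_smul, map_smul, besselLp_toLp, h6,
        besselLp_extCurve hT hs hs4 hb ht', h7]
    have h8 : ⇑(h3.toLp _ + q t • f.toLp 4 volume : Lp ℂ 4 (volume : Measure ℝ))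
        =ᵐ[volume.restrict (Ioo 0 1)] U t := by
      rw [hU t ht']
      filter_upwards [coeFn_restrUnit (extCurve s b t + q t • f.toLp 2 volume),
        ae_restrict_of_ae (Lp.coeFn_add (h3.toLp _) (q t • f.toLp 4 volume)),
        ae_restrict_of_ae (Lp.coeFn_add (extCurve s b t) (q t • f.toLp 2 volume)),
        ae_restrict_of_ae (Lp.coeFn_smul (q t) (f.toLp 4 volume)),
        ae_restrict_of_ae (Lp.coeFn_smul (q t) (f.toLp 2 volume)),
        ae_restrict_of_ae (f.coeFn_toLp 2 volume), ae_restrict_of_ae (f.coeFn_toLp 4 volume),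
        ae_restrict_of_ae e1] with x i1 i2 i3 i4 i5 i6 i7 i8
      rw [← i1, i2, i3, Pi.add_apply, Pi.add_apply, i4, i5, Pi.smul_apply, Pi.smul_apply, i6, i7, i8]
    refine (sobolevENorm_le h8 h5).trans ((enorm_add_le _ _).trans ?_)
    refine add_le_add ?_ ?_
    · rw [Lp.enorm_def, eLpNorm_congr_ae h4.coeFn_toLp]
    · rw [enorm_smul, ← ofReal_norm, ← ofReal_norm, ← ENNReal.ofReal_mul (norm_nonneg _)]
      exact ENNReal.ofReal_le_ofReal (mul_le_mul_of_nonneg_right (hq t ht') hD0)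
  · refine (ENNReal.lintegral_Lp_add_le hvm.aemeasurable aemeasurable_const (by norm_num)).trans ?_
    refine (add_le_add hv5 (lintegral_const_pow_four_le hT (mul_nonneg hM hD0))).trans ?_
    rw [← ENNReal.ofReal_add (mul_nonneg hA0 hB) (by positivity)]
    refine ENNReal.ofReal_le_ofReal ?_
    nlinarith [mul_nonneg hA0 hM, mul_nonneg (mul_nonneg (add_nonneg hT zero_le_one) hD0) hB]

theorem exists_sobolevENorm_extCurve_add_le (hT : 0 ≤ T) (hs : 0 ≤ s) (hs4 : s ≤ 4) (f : 𝓢(ℝ, ℂ)) :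
    ∃ C : ℝ, 0 < C ∧ ∀ (B : ℝ) (b : ℝ → ℕ → ℂ), 0 ≤ B → GoodFamily T B b →
      ∀ (M : ℝ) (q : ℝ → ℂ), 0 ≤ M → (∀ t ∈ Icc 0 T, ‖q t‖ ≤ M) → ∀ t ∈ Icc 0 T,
        sobolevENorm s 2 (Ioo 0 1) (restrUnit (extCurve s b t + q t • f.toLp 2 volume)) ≤
          ENNReal.ofReal (C * (B + M)) := by
  obtain ⟨A, hA⟩ := exists_admissible_besselS_extSin hT hs hs4
  set D : ℝ := ‖(besselS s f).toLp 2 volume‖ with hD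
  have hD0 : 0 ≤ D := norm_nonneg _
  have hA0 := hA.nonneg
  refine ⟨A + D + 1, by positivity, fun B b hB hb M q hM hq t ht => ?_⟩
  refine (sobolevENorm_extCurve_add_le hT hs hs4 hb f ht (q t)).trans ?_
  rw [← ofReal_norm]
  refine ENNReal.ofReal_le_ofReal ((norm_add_le _ _).trans ?_)
  have h1 := hA.norm_tsum_le (fun k => (besselS s (extSin s k)).coeFn_toLp 2 volume) hb ht
  have h2 := mul_le_mul_of_nonneg_right (hq t ht) hD0
  rw [norm_smul, ← hD]
  change ‖besCurve s b t‖ ≤ _ at h1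
  nlinarith [mul_nonneg hA0 hM, mul_nonneg hD0 hB]

end SobolevCurve

/-! ### Weak derivatives -/

theorem memLp_of_continuous {f : ℝ → ℂ} (hf : Continuous f) :
    MemLp f 2 (volume.restrict (Ioo (0 : ℝ) 1)) := by
  obtain ⟨C, hC⟩ := isCompact_Icc.exists_bound_of_continuousOn (s := Icc (0 : ℝ) 1) hf.continuousOn
  refine MemLp.of_bound hf.aestronglyMeasurable C ?_
  filter_upwards [ae_restrict_mem measurableSet_Ioo] with x hx using hC x (Ioo_subset_Icc_self hx)

/-- A continuous function as an element of `L²(0,1)`. -/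
def contVec (f : ℝ → ℂ) (hf : Continuous f) : L2 := (memLp_of_continuous hf).toLp f

theorem coeFn_contVec {f : ℝ → ℂ} (hf : Continuous f) :
    contVec f hf =ᵐ[volume.restrict (Ioo (0 : ℝ) 1)] f := (memLp_of_continuous hf).coeFn_toLp

/-- The pairing `f ↦ ∫₀¹ f φ` with a continuous function. -/
def pairing (φ : ℝ → ℂ) (hφ : Continuous φ) : L2 →L[ℂ] ℂ :=
  innerSL ℂ (contVec (fun x => star (φ x)) hφ.star)

theorem pairing_apply {φ : ℝ → ℂ} (hφ : Continuous φ) (f : L2) :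
    pairing φ hφ f = ∫ x in Ioo (0 : ℝ) 1, f x * φ x := by
  rw [pairing, innerSL_apply_apply, L2.inner_def]
  refine integral_congr_ae ?_
  filter_upwards [coeFn_contVec hφ.star] with x hx
  rw [hx, RCLike.inner_apply]
  simp

theorem contDiff_iteratedDeriv {φ : ℝ → ℂ} (hφ : ContDiff ℝ ∞ φ) (m : ℕ) :
    ContDiff ℝ ∞ (iteratedDeriv m φ) := by
  rw [iteratedDeriv_eq_iterate]
  exact hφ.iterate_deriv m

theorem isWeakDeriv_iff {m : ℕ} {f v : L2} : IsWeakDeriv m f v ↔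
    ∀ (φ : ℝ → ℂ) (hφ : ContDiff ℝ ∞ φ), HasCompactSupport φ → tsupport φ ⊆ Ioo 0 1 →
      pairing (iteratedDeriv m φ) (contDiff_iteratedDeriv hφ m).continuous f =
        (-1) ^ m * pairing φ hφ.continuous v := by
  simp only [pairing_apply]
  rfl

theorem IsWeakDeriv.add {m : ℕ} {f v f' v' : L2} (h : IsWeakDeriv m f v)
    (h' : IsWeakDeriv m f' v') : IsWeakDeriv m (f + f') (v + v') := by
  rw [isWeakDeriv_iff] at *
  intro φ h1 h2 h3
  rw [map_add, map_add, h φ h1 h2 h3, h' φ h1 h2 h3, mul_add]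

theorem IsWeakDeriv.smul {m : ℕ} {f v : L2} (h : IsWeakDeriv m f v) (c : ℂ) :
    IsWeakDeriv m (c • f) (c • v) := by
  rw [isWeakDeriv_iff] at *
  intro φ h1 h2 h3
  rw [map_smul, map_smul, h φ h1 h2 h3, smul_eq_mul, smul_eq_mul, mul_left_comm]

/-- Each test function turns the definition into an equality of continuous linear functionals on
L²(0,1). -/
theorem IsWeakDeriv.tsum {m : ℕ} {f v : ℕ → L2} (h : ∀ k, IsWeakDeriv m (f k) (v k))
    (hf : Summable f) (hv : Summable v) : IsWeakDeriv m (∑' k, f k) (∑' k, v k) := by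
  simp only [isWeakDeriv_iff] at *
  intro φ h1 h2 h3
  have e1 := (pairing (iteratedDeriv m φ) (contDiff_iteratedDeriv h1 m).continuous).hasSum hf.hasSum
  have e2 := ((pairing φ h1.continuous).hasSum hv.hasSum).mul_left ((-1) ^ m)
  refine e1.unique ?_
  simp only [fun k => h k φ h1 h2 h3]
  exact e2

theorem integral_mul_iteratedDeriv (m : ℕ) {f φ : ℝ → ℂ} (hf : ContDiff ℝ ∞ f)
    (hφ : ContDiff ℝ ∞ φ) (hc : HasCompactSupport φ) :
    ∫ x, f x * iteratedDeriv m φ x = (-1) ^ m * ∫ x, iteratedDeriv m f x * φ x := by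
  induction m generalizing f with
  | zero => simp
  | succ m ih =>
    have hd : ContDiff ℝ ∞ (deriv f) := (contDiff_infty_iff_deriv.1 hf).2
    have hφm := contDiff_iteratedDeriv hφ m
    have hφm1 := contDiff_iteratedDeriv hφ (m + 1)
    have hs : ∀ n, HasCompactSupport (iteratedDeriv n φ) := fun n => by
      induction n with
      | zero => simpa using hc
      | succ n ihn => rw [iteratedDeriv_succ]; exact ihn.deriv
    have h1 : ∫ x, f x * iteratedDeriv (m + 1) φ x = -∫ x, deriv f x * iteratedDeriv m φ x := by
      refine integral_mul_deriv_eq_deriv_mul_of_integrable (fun x _ => ?_) (fun x _ => ?_) ?_ ?_ ?_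
      · exact (hf.differentiable (by simp) x).hasDerivAt
      · rw [iteratedDeriv_succ]
        exact (hφm.differentiable (by simp) x).hasDerivAt
      · exact (hf.continuous.mul hφm1.continuous).integrable_of_hasCompactSupport
          (hs (m + 1)).mul_left
      · exact (hd.continuous.mul hφm.continuous).integrable_of_hasCompactSupport (hs m).mul_left
      · exact (hf.continuous.mul hφm.continuous).integrable_of_hasCompactSupport (hs m).mul_left
    rw [h1, ih hd, iteratedDeriv_succ', pow_succ]
    ring

theorem isWeakDeriv_contVec (m : ℕ) {f : ℝ → ℂ} (hf : ContDiff ℝ ∞ f) :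
    IsWeakDeriv m (contVec f hf.continuous)
      (contVec (iteratedDeriv m f) (contDiff_iteratedDeriv hf m).continuous) := by
  intro φ h1 h2 h3
  have hsub : tsupport (iteratedDeriv m φ) ⊆ Ioo 0 1 := by
    refine subset_trans ?_ h3
    rw [iteratedDeriv_eq_iterate]
    induction m with
    | zero => exact subset_rfl
    | succ m ih =>
      rw [Function.iterate_succ', Function.comp_apply]
      exact tsupport_deriv_subset.trans ih
  have e : ∀ {g ψ : ℝ → ℂ} (hg : Continuous g), tsupport ψ ⊆ Ioo 0 1 →
      ∫ x in Ioo (0 : ℝ) 1, contVec g hg x * ψ x = ∫ x, g x * ψ x := by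
    intro g ψ hg hψ
    have : ∫ x in Ioo (0 : ℝ) 1, contVec g hg x * ψ x = ∫ x in Ioo (0 : ℝ) 1, g x * ψ x := by
      refine integral_congr_ae ?_
      filter_upwards [coeFn_contVec hg] with x hx
      rw [hx]
    rw [this]
    refine setIntegral_eq_integral_of_forall_compl_eq_zero fun x hx => ?_
    rw [image_eq_zero_of_notMem_tsupport fun h => hx (hψ h), mul_zero]
  rw [e _ hsub, e _ h3, integral_mul_iteratedDeriv m hf h1 h2]

/-- Differentiation only shifts the phase by π/2; this is why the estimates for sines allow an
arbitrary δ. -/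
theorem deriv_sinPh (δ : ℝ) (k : ℕ) (x : ℝ) : HasDerivAt (sinPh δ k)
    ((((k : ℝ) + 1) * Real.pi : ℝ) * sinPh (δ + Real.pi / 2) k x) x := by
  have h1 : HasDerivAt (fun x : ℝ => ((k : ℝ) + 1) * Real.pi * x + δ) (((k : ℝ) + 1) * Real.pi) x := by
    simpa using ((hasDerivAt_id x).const_mul (((k : ℝ) + 1) * Real.pi)).add_const δ
  have h2 := (h1.sin).ofReal_comp
  have e : ((((k : ℝ) + 1) * Real.pi : ℝ) : ℂ) * sinPh (δ + Real.pi / 2) k x =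
      ((Real.cos (((k : ℝ) + 1) * Real.pi * x + δ) * (((k : ℝ) + 1) * Real.pi) : ℝ) : ℂ) := by
    rw [sinPh, ← add_assoc, Real.sin_add_pi_div_two, ← Complex.ofReal_mul, mul_comm]
  rw [e]
  exact h2

theorem iteratedDeriv_sinPh (m : ℕ) (k : ℕ) : iteratedDeriv m (sinPh 0 k) =
    fun x => (((((k : ℝ) + 1) * Real.pi) ^ m : ℝ) : ℂ) * sinPh (m * (Real.pi / 2)) k x := by
  induction m with
  | zero => simp
  | succ m ih =>
    rw [iteratedDeriv_succ, ih]
    funext x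
    rw [((deriv_sinPh _ k x).const_mul _).deriv]
    push_cast
    rw [add_mul, one_mul, pow_succ]
    ring_nf

theorem isWeakDeriv_sinVec (m k : ℕ) : IsWeakDeriv m (sinVec 0 k)
    ((((((k : ℝ) + 1) * Real.pi) ^ m : ℝ) : ℂ) • sinVec (m * (Real.pi / 2)) k) := by
  have h := isWeakDeriv_contVec m (contDiff_sinPh 0 k)
  have e : contVec (iteratedDeriv m (sinPh 0 k))
      (contDiff_iteratedDeriv (contDiff_sinPh 0 k) m).continuous =
      (((((k : ℝ) + 1) * Real.pi) ^ m : ℝ) : ℂ) • sinVec (m * (Real.pi / 2)) k := by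
    refine Lp.ext ?_
    filter_upwards [coeFn_contVec (contDiff_iteratedDeriv (contDiff_sinPh 0 k) m).continuous,
      coeFn_sinVec (m * (Real.pi / 2)) k, Lp.coeFn_smul (((((k : ℝ) + 1) * Real.pi) ^ m : ℝ) : ℂ)
        (sinVec (m * (Real.pi / 2)) k)] with x h1 h2 h3
    rw [h1, h3, Pi.smul_apply, h2, iteratedDeriv_sinPh, smul_eq_mul]
  rw [← e]
  exact h

/-! ### The series `∑ k⁻³ sin(kπx)` -/

/-- The sum of the series `∑ k⁻³ sin(kπx)` on `[0,1]`. -/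
def cubic (x : ℝ) : ℂ :=
  (((-1) ^ (1 + 1) * (2 * Real.pi) ^ (2 * 1 + 1) / 2 / (2 * 1 + 1).factorial *
    ((Polynomial.bernoulli (2 * 1 + 1)).map (algebraMap ℚ ℝ)).eval (x / 2) : ℝ) : ℂ)

theorem contDiff_cubic : ContDiff ℝ ∞ cubic := by
  unfold cubic
  refine Complex.ofRealCLM.contDiff.comp (contDiff_const.mul ?_)
  simp only [Polynomial.eval_map_algebraMap]
  exact (Polynomial.contDiff_aeval _ _).comp (contDiff_id.div_const 2)

theorem hasSum_cubic {x : ℝ} (hx : x ∈ Icc (0 : ℝ) 1) :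
    HasSum (fun k : ℕ => 1 / ((k : ℂ) + 1) ^ 3 * sinPh 0 k x) (cubic x) := by
  -- The Fourier series of the third Bernoulli polynomial has period 1 and the sines here have
  -- period 2, hence the argument x/2.
  have h := hasSum_one_div_nat_pow_mul_sin (k := 1) one_ne_zero (x := x / 2)
    ⟨by linarith [hx.1], by linarith [hx.2]⟩
  rw [← hasSum_nat_add_iff' 1] at h
  simp only [Finset.range_one, Finset.sum_singleton, Nat.cast_zero, mul_zero, zero_mul,
    Real.sin_zero, sub_zero] at h
  have h2 : HasSum _ (cubic x) := Complex.hasSum_ofReal.2 h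
  convert h2 using 1
  funext k
  have e : 2 * Real.pi * ((k + 1 : ℕ) : ℝ) * (x / 2) = ((k : ℝ) + 1) * Real.pi * x + 0 := by
    push_cast; ring
  rw [e, sinPh]
  push_cast
  norm_num

theorem norm_sinVec_le (δ : ℝ) (k : ℕ) : ‖sinVec δ k‖ ≤ 3 := by
  have h := (admissible_sinPh_unit 0 δ).besselBound (coeFn_sinVec δ)
  simpa using h.2 {k} fun _ => 1

/-- The series converges absolutely in L²; its limit is identified along an a.e. convergent
subsequence of partial sums with the pointwise sum. -/
theorem hasSum_contVec_cubic :
    HasSum (fun k : ℕ => (1 / ((k : ℂ) + 1) ^ 3) • sinVec 0 k)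
      (contVec cubic contDiff_cubic.continuous) := by
  have hsum : Summable fun k : ℕ => (1 / ((k : ℂ) + 1) ^ 3) • sinVec 0 k := by
    have h1 : Summable fun k : ℕ => 1 / ((k : ℝ) + 1) ^ 3 * 3 := by
      have := (summable_nat_add_iff 1).2 (Real.summable_one_div_nat_pow.2 (show 1 < 3 by norm_num))
      refine Summable.mul_right 3 ?_
      simpa using this
    refine Summable.of_norm_bounded h1 fun k => ?_
    rw [norm_smul]
    have : ‖(1 / ((k : ℂ) + 1) ^ 3)‖ = 1 / ((k : ℝ) + 1) ^ 3 := by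
      rw [norm_div, norm_one, norm_pow]
      congr 2
      exact_mod_cast Complex.norm_of_nonneg (r := (k : ℝ) + 1) (by positivity)
    rw [this]
    gcongr
    exact norm_sinVec_le 0 k
  convert hsum.hasSum using 1
  have h2 := hsum.hasSum.tendsto_sum_nat
  obtain ⟨ns, hns, h3⟩ := (tendstoInMeasure_of_tendsto_Lp h2).exists_seq_tendsto_ae
  refine Lp.ext ?_
  have h4 : ∀ᵐ x ∂volume.restrict (Ioo (0 : ℝ) 1), ∀ k : ℕ,
      ((1 / ((k : ℂ) + 1) ^ 3) • sinVec 0 k : L2) x = 1 / ((k : ℂ) + 1) ^ 3 * sinPh 0 k x := by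
    rw [ae_all_iff]
    intro k
    filter_upwards [Lp.coeFn_smul (1 / ((k : ℂ) + 1) ^ 3) (sinVec 0 k), coeFn_sinVec 0 k] with x h5 h6
    rw [h5, Pi.smul_apply, h6, smul_eq_mul]
  have h7 : ∀ᵐ x ∂volume.restrict (Ioo (0 : ℝ) 1), ∀ n : ℕ,
      (∑ k ∈ Finset.range n, (1 / ((k : ℂ) + 1) ^ 3) • sinVec 0 k : L2) x =
        ∑ k ∈ Finset.range n, ((1 / ((k : ℂ) + 1) ^ 3) • sinVec 0 k : L2) x := by
    rw [ae_all_iff]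
    intro n
    filter_upwards [Lp.coeFn_finsetSum (p := 2) (Finset.range n)
      (fun k : ℕ => (1 / ((k : ℂ) + 1) ^ 3) • sinVec 0 k)] with x h8
    rw [h8, Finset.sum_apply]
  filter_upwards [coeFn_contVec contDiff_cubic.continuous, h3, h4, h7,
    ae_restrict_mem measurableSet_Ioo] with x i1 i2 i3 i4 i5
  rw [i1]
  refine tendsto_nhds_unique ?_ i2
  simp only [i4, i3]
  exact (hasSum_cubic (Ioo_subset_Icc_self i5)).tendsto_sum_nat.comp hns.tendsto_atTop

theorem restrUnit_cutMul {f : ℝ → ℂ} (hf : ContDiff ℝ ∞ f) :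
    restrUnit ((cutMul f hf).toLp 2 volume) = contVec f hf.continuous := by
  refine Lp.ext ?_
  filter_upwards [coeFn_restrUnit ((cutMul f hf).toLp 2 volume),
    ae_restrict_of_ae ((cutMul f hf).coeFn_toLp 2 volume), coeFn_contVec hf.continuous,
    ae_restrict_mem measurableSet_Ioo] with x h1 h2 h3 h4
  rw [← h1, h2, h3, cutMul_apply, cut_eq_one (Ioo_subset_Icc_self h4)]
  simp
open scoped FourierTransform

/-! ### Extensions of functions in `H^σ` and `H^σ_0` -/

section Extensions

variable {σ T : ℝ} {h : ℝ → ℂ} {F g : Lp ℂ 2 (volume : Measure ℝ)} {I : Set ℝ}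

/-- For σ ≥ 5/8 the transform of F is integrable as well as square-integrable, so the pointwise
inversion formula applies. -/
theorem IsExtension.coeFn_eq_extVal (hσ : 5 / 8 ≤ σ) (H : IsExtension σ I h F g) :
    F =ᵐ[volume] extVal σ g := by
  have hγ : MemLp (fun ξ => ftL2 g ξ) 2 volume := Lp.memLp _
  have hi : Integrable (fun ξ => (jap (-σ) ξ : ℂ) * ftL2 g ξ) := integrable_jap_mul hσ hγ
  have hm : MemLp (fun ξ => (jap (-σ) ξ : ℂ) * ftL2 g ξ) 2 := memLp_jap_mul (by linarith) hγ
  have e : (𝓕 F : Lp ℂ 2 (volume : Measure ℝ)) = hm.toLp _ :=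
    Lp.ext ((coeFn_fourier_of_besselPotential (by linarith) H.bessel).trans hm.coeFn_toLp.symm)
  have e2 : F = 𝓕⁻ (hm.toLp _ : Lp ℂ 2 (volume : Measure ℝ)) := by
    rw [← e, FourierTransform.fourierInv_fourier_eq]
  have h3 := coeFn_fourierInv_toLp hi hm
  rw [← e2] at h3
  filter_upwards [h3] with t ht
  rw [ht, Real.fourierInv_eq', extVal]
  refine integral_congr_ae (ae_of_all _ fun ξ => ?_)
  simp only [smul_eq_mul, RCLike.inner_apply, conj_trivial]
  rw [mul_comm]
  congr 2
  push_cast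
  ring

theorem exists_isExtension_of_lt {r : ℝ≥0∞} (H : sobolevENorm σ 2 I h < r) :
    ∃ F g, IsExtension σ I h F g ∧ ‖g‖ₑ < r := by
  simp only [sobolevENorm, iInf_lt_iff] at H
  obtain ⟨F, g, h1, h2, h3⟩ := H
  exact ⟨F, g, ⟨h1, h2⟩, h3⟩

theorem IsExtension.enorm_le (hσ : 0 ≤ σ) (H : IsExtension σ I h F g) : ‖F‖ₑ ≤ ‖g‖ₑ := by
  have e1 : ‖F‖ = ‖(𝓕 F : Lp ℂ 2 (volume : Measure ℝ))‖ := (Lp.norm_fourier_eq F).symm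
  have e2 : ‖g‖ = ‖(𝓕 g : Lp ℂ 2 (volume : Measure ℝ))‖ := (Lp.norm_fourier_eq g).symm
  rw [← ofReal_norm, ← ofReal_norm, e1, e2]
  refine ENNReal.ofReal_le_ofReal (Lp.norm_le_norm_of_ae_le ?_)
  filter_upwards [coeFn_fourier_of_besselPotential hσ H.bessel] with ξ hξ
  rw [hξ, norm_mul, norm_ofReal_jap]
  exact mul_le_of_le_one_left (norm_nonneg _) (jap_neg_le_one hσ ξ)

theorem isExtension_zero (hh : h =ᵐ[volume.restrict I] 0) : IsExtension σ I h 0 0 := by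
  refine ⟨?_, ?_⟩
  · exact EventuallyEq.trans (ae_restrict_of_ae (Lp.coeFn_zero ℂ 2 volume)) hh.symm
  · change TemperedDistribution.besselPotential ℝ ℂ σ (Lp.toTemperedDistributionCLM ℂ volume 2 0) =
      Lp.toTemperedDistributionCLM ℂ volume 2 0
    rw [map_zero, map_zero]

/-- The L² norm on I is bounded by the norm of every extension. This settles the case in which twice
the infimum does not exceed the infimum. -/
theorem ae_eq_zero_of_sobolevENorm_eq_zero (hσ : 0 ≤ σ) (H : sobolevENorm σ 2 I h = 0) :
    h =ᵐ[volume.restrict I] 0 := by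
  have hle : ∀ ε : ℝ≥0∞, 0 < ε → eLpNorm h 2 (volume.restrict I) ≤ ε := by
    intro ε hε
    obtain ⟨F, g, h1, h2⟩ := exists_isExtension_of_lt (H.trans_lt hε)
    rw [← eLpNorm_congr_ae h1.ae_eq]
    refine (eLpNorm_mono_measure _ Measure.restrict_le_self).trans ?_
    rw [← Lp.enorm_def]
    exact (h1.enorm_le hσ).trans h2.le
  have hz : eLpNorm h 2 (volume.restrict I) = 0 := by
    by_contra hne
    exact hne (nonpos_iff_eq_zero.1 (le_of_forall_gt_imp_ge_of_dense fun ε hε => hle ε hε))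
  obtain ⟨F, g, h1, -⟩ := exists_isExtension_of_lt (H.trans_lt one_pos)
  have hm : AEStronglyMeasurable h (volume.restrict I) :=
    ((Lp.aestronglyMeasurable F).mono_measure Measure.restrict_le_self).congr h1.ae_eq
  exact (eLpNorm_eq_zero_iff hm (by norm_num)).1 hz

/-- Extensions whose norm is at most twice the infimum. -/
theorem exists_isExtension (hσ : 0 ≤ σ) (H : MemHs σ I h) :
    ∃ F g, IsExtension σ I h F g ∧ ‖g‖ₑ ≤ 2 * sobolevENorm σ 2 I h := by
  by_cases h0 : sobolevENorm σ 2 I h = 0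
  · exact ⟨0, 0, isExtension_zero (ae_eq_zero_of_sobolevENorm_eq_zero hσ h0), by simp⟩
  · have hlt : sobolevENorm σ 2 I h < 2 * sobolevENorm σ 2 I h := by
      rw [two_mul]
      exact ENNReal.lt_add_right H.ne h0
    obtain ⟨F, g, h1, h2⟩ := exists_isExtension_of_lt hlt
    exact ⟨F, g, h1, h2.le⟩

/-- Evaluation at 0 is bounded on H^σ for σ ≥ 5/8, and the approximating test functions vanish at 0.
-/
theorem IsExtension.extVal_zero_eq_zero (hT : 0 < T) (hσ : 5 / 8 ≤ σ)
    (H : IsExtension σ (Ioo 0 T) h F g) (h0 : MemHsZero σ (Ioo 0 T) h) : extVal σ g 0 = 0 := by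
  obtain ⟨C, hC, hle⟩ := exists_norm_extVal_le hσ
  have key : ∀ ε : ℝ, 0 < ε → ‖extVal σ g 0‖ ≤ C * ε := by
    intro ε hε
    obtain ⟨φ, hφ1, hφ2, hφ3, hφ4⟩ := h0.2 (ENNReal.ofReal ε) (ENNReal.ofReal_pos.2 hε)
    obtain ⟨F', g', H', hg'⟩ := exists_isExtension_of_lt hφ4
    have hae : (fun t => extVal σ g t) =ᵐ[volume.restrict (Icc 0 T)]
        fun t => extVal σ g' t + φ t := by
      rw [← restrict_Ioo_eq_restrict_Icc]
      filter_upwards [ae_restrict_of_ae (H.coeFn_eq_extVal hσ),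
        ae_restrict_of_ae (H'.coeFn_eq_extVal hσ), H.ae_eq, H'.ae_eq] with t h1 h2 h3 h4
      rw [← h1, ← h2, h3, h4]
      ring
    -- Continuity carries the a.e. equality on (0,T) to the end point 0.
    have hz : extVal σ g 0 = extVal σ g' 0 + φ 0 :=
      Measure.eqOn_Icc_of_ae_eq volume hT.ne hae (continuous_extVal hσ g).continuousOn
        ((continuous_extVal hσ g').add hφ1.continuous).continuousOn ⟨le_rfl, hT.le⟩
    have hφ0 : φ 0 = 0 := image_eq_zero_of_notMem_tsupport fun hm => lt_irrefl _ (hφ3 hm).1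
    rw [hz, hφ0, add_zero]
    refine (hle g' 0).trans (mul_le_mul_of_nonneg_left ?_ hC.le)
    rw [← ofReal_norm] at hg'
    exact (ENNReal.ofReal_lt_ofReal_iff hε).1 hg' |>.le
  rw [← norm_le_zero_iff]
  refine le_of_forall_pos_le_add fun δ hδ => ?_
  have := key (δ / C) (by positivity)
  rw [mul_div_cancel₀ _ hC.ne'] at this
  linarith

end Extensions

/-! ### The boundary integral operator -/

section Assembly

variable {T s : ℝ}

/-- Termwise differentiation: the factor ((k+1)π)^m cancels (k+1)^{-m}, leaving π^m times
phase-shifted sines with the same good coefficients. -/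
theorem exists_weakDeriv_bound (hT : 0 ≤ T) (m : ℕ) : ∃ C : ℝ, 0 < C ∧
    ∀ (B : ℝ) (b : ℝ → ℕ → ℂ), 0 ≤ B → GoodFamily T B b →
      ∀ (M : ℝ) (q : ℝ → ℂ), 0 ≤ M → Continuous q → (∀ t ∈ Icc 0 T, ‖q t‖ ≤ M) → ∀ U : ℝ → L2,
        (∀ t ∈ Icc 0 T, U t = ∑' k, b t k • (((((k : ℝ) + 1) ^ (-(m : ℝ)) : ℝ) : ℂ) • sinVec 0 k) +
          q t • contVec cubic contDiff_cubic.continuous) →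
        ∃ V : ℝ → L2, (∀ t ∈ Icc 0 T, IsWeakDeriv m (U t) (V t)) ∧ ContinuousOn V (Icc 0 T) ∧
          L4NormLE T V (ENNReal.ofReal (C * (B + M))) ∧
          ∀ t ∈ Icc 0 T, ‖V t‖ₑ ≤ ENNReal.ofReal (C * (B + M)) := by
  have hc := (contDiff_iteratedDeriv contDiff_cubic m).continuous
  obtain ⟨D, hD⟩ := isCompact_Icc.exists_bound_of_continuousOn (s := Icc (0 : ℝ) 1) hc.continuousOn
  have hD0 : 0 ≤ D := (norm_nonneg _).trans (hD 0 ⟨le_rfl, zero_le_one⟩)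
  set δ : ℝ := m * (Real.pi / 2)
  set P : ℂ := (((Real.pi ^ m : ℝ)) : ℂ) with hP
  have hw := (admissible_sinPh_unit T δ).const_mul P
  set A : ℝ := ‖P‖ * 3
  have hA : 0 ≤ A := hw.nonneg
  have hvw : ∀ k, (P • sinVec δ k : L2) =ᵐ[volume.restrict (Ioo (0 : ℝ) 1)]
      fun x => P * sinPh δ k x := fun k => by
    filter_upwards [Lp.coeFn_smul P (sinVec δ k), coeFn_sinVec δ k] with x h1 h2
    rw [h1, Pi.smul_apply, h2, smul_eq_mul]
  set Q := contVec _ hc with hQ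
  have hQ0 := norm_nonneg Q
  refine ⟨A + (T + 1) * D + ‖Q‖ + 1, by positivity, fun B b hB hb M q hM hq hqM U hU => ?_⟩
  have hbes := admissible_sinPh_unit T 0
  refine ⟨fun t => ∑' k, b t k • (P • sinVec δ k) + q t • Q, fun t ht => ?_, ?_, ?_, fun t ht => ?_⟩
  · rw [hU t ht]
    refine IsWeakDeriv.add ?_ ((isWeakDeriv_contVec m contDiff_cubic).smul (q t))
    refine IsWeakDeriv.tsum (fun k => ?_) ?_ (hw.summable_smul hvw hb ht)
    · have h1 := ((isWeakDeriv_sinVec m k).smul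
        ((((k : ℝ) + 1) ^ (-(m : ℝ)) : ℝ) : ℂ)).smul (b t k)
      have hk : (0 : ℝ) < (k : ℝ) + 1 := by positivity
      have e : ((((k : ℝ) + 1) ^ (-(m : ℝ)) : ℝ) : ℂ) •
          (((((k : ℝ) + 1) * Real.pi) ^ m : ℝ) : ℂ) • sinVec δ k = P • sinVec δ k := by
        rw [smul_smul, ← Complex.ofReal_mul, mul_pow, ← mul_assoc, Real.rpow_neg hk.le,
          Real.rpow_natCast, inv_mul_cancel₀ (pow_ne_zero m hk.ne'), one_mul]
      rwa [e] at h1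
    · have hν : ∀ k : ℕ, ‖((((k : ℝ) + 1) ^ (-(m : ℝ)) : ℝ) : ℂ)‖ ≤ 1 :=
        norm_rpow_neg_le_one m.cast_nonneg
      refine ((hbes.mul_left hν).summable_smul (fun k => ?_) hb ht)
      filter_upwards [Lp.coeFn_smul ((((k : ℝ) + 1) ^ (-(m : ℝ)) : ℝ) : ℂ) (sinVec 0 k),
        coeFn_sinVec 0 k] with x h1 h2
      rw [h1, Pi.smul_apply, h2, smul_eq_mul]
  · exact (hw.continuousOn_tsum hvw hb).add (hq.smul continuous_const).continuousOn
  · refine ((hw.l4NormLE hvw hT hB hb).add_smul hT hq hM hqM hc hD (coeFn_contVec hc)).mono ?_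
    rw [← ENNReal.ofReal_add (mul_nonneg hA hB) (by positivity)]
    refine ENNReal.ofReal_le_ofReal ?_
    nlinarith [mul_nonneg hA hM, mul_nonneg hQ0 hB, mul_nonneg hQ0 hM,
      mul_nonneg (mul_nonneg (add_nonneg hT zero_le_one) hD0) hB]
  · rw [← ofReal_norm]
    refine ENNReal.ofReal_le_ofReal ((norm_add_le _ _).trans ?_)
    have h1 := hw.norm_tsum_le hvw hb ht
    have h2 := mul_le_mul_of_nonneg_right (hqM t ht) hQ0
    rw [norm_smul]
    nlinarith [mul_nonneg hA hM, mul_nonneg hQ0 hB,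
      mul_nonneg (mul_nonneg (add_nonneg hT zero_le_one) hD0) hB,
      mul_nonneg (mul_nonneg (add_nonneg hT zero_le_one) hD0) hM]

theorem ofReal_mul_norm_le {C : ℝ} (hC : 0 ≤ C) {g : Lp ℂ 2 (volume : Measure ℝ)} {N : ℝ≥0∞}
    (hg : ‖g‖ₑ ≤ 2 * N) : ENNReal.ofReal (C * ‖g‖) ≤ ENNReal.ofReal (2 * C) * N := by
  rw [ENNReal.ofReal_mul hC, ofReal_norm, ENNReal.ofReal_mul (by norm_num), ENNReal.ofReal_ofNat,
    mul_comm 2, mul_assoc]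
  gcongr

/-- The coefficients of `W_{2,N} h` are the sum of a good family divided by `(k+1)^s` and a
multiple of `(k+1)⁻³`. -/
theorem exists_decomposition (hT : 0 < T) (hs : 0 ≤ s) (hs4 : s ≤ 4) : ∃ C : ℝ, 0 < C ∧
    ∀ h : ℝ → ℂ, MemHsZero ((1 + s) / 4) (Ioo 0 T) h →
      ∃ (B : ℝ) (b : ℝ → ℕ → ℂ) (M : ℝ) (q : ℝ → ℂ), 0 ≤ B ∧ GoodFamily T B b ∧ 0 ≤ M ∧
        Continuous q ∧ (∀ t ∈ Icc 0 T, ‖q t‖ ≤ M) ∧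
        ENNReal.ofReal (B + M) ≤ ENNReal.ofReal C * sobolevENorm ((1 + s) / 4) 2 (Ioo 0 T) h ∧
        ∀ t k, coeffW2 h t (k + 1) = b t k * ((((k : ℝ) + 1) ^ (-s) : ℝ) : ℂ) +
          q t * (1 / ((k : ℂ) + 1) ^ 3) := by
  have hpow : ∀ (k : ℕ) (z : ℂ), ((((k : ℝ) + 1) ^ s : ℝ) : ℂ) * z *
      ((((k : ℝ) + 1) ^ (-s) : ℝ) : ℂ) = z := fun k z => by
    have hk : (0 : ℝ) < (k : ℝ) + 1 := by positivity
    rw [mul_right_comm, ← Complex.ofReal_mul, ← Real.rpow_add hk, add_neg_cancel, Real.rpow_zero,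
      Complex.ofReal_one, one_mul]
  -- Below the threshold no boundary term is needed and q = 0; above it q is a multiple of the
  -- continuous representative of h.
  rcases le_total s (3 / 2) with h32 | h32
  · obtain ⟨C, hC, hfam⟩ := IsExtension.exists_goodFamily_low hT.le hs h32
    refine ⟨2 * C, by positivity, fun h hh => ?_⟩
    obtain ⟨F, g, H, hg⟩ := exists_isExtension (by linarith) hh.1
    refine ⟨C * ‖g‖, _, 0, 0, by positivity, hfam h F g H, le_rfl, continuous_zero, by simp, ?_, ?_⟩
    · rw [add_zero]
      exact ofReal_mul_norm_le hC.le hg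
    · intro t k
      rw [hpow]
      simp
  · obtain ⟨C, hC, hfam⟩ := IsExtension.exists_goodFamily_high hT.le h32 hs4
    have hσ : 5 / 8 ≤ (1 + s) / 4 := by linarith
    obtain ⟨C', hC', hval⟩ := exists_norm_extVal_le hσ
    have hpi : 0 < 2 / Real.pi ^ 3 := by positivity
    refine ⟨2 * (C + 2 / Real.pi ^ 3 * C'), by positivity, fun h hh => ?_⟩
    obtain ⟨F, g, H, hg⟩ := exists_isExtension (by linarith) hh.1
    refine ⟨C * ‖g‖, _, 2 / Real.pi ^ 3 * C' * ‖g‖, fun t => 2 / Real.pi ^ 3 * extVal ((1 + s) / 4) g t,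
      by positivity, hfam h F g H (H.extVal_zero_eq_zero hT hσ hh), by positivity,
      continuous_const.mul (continuous_extVal hσ g), fun t _ => ?_, ?_, ?_⟩
    · rw [norm_mul, mul_assoc]
      have e : ‖(2 / Real.pi ^ 3 : ℂ)‖ = 2 / Real.pi ^ 3 := by
        rw [norm_div, norm_pow, Complex.norm_real, Real.norm_of_nonneg Real.pi_pos.le]
        simp
      rw [e]
      exact mul_le_mul_of_nonneg_left (hval g t) hpi.le
    · rw [← add_mul]
      exact ofReal_mul_norm_le (by positivity) hg
    · intro t k
      rw [hpow]
      ring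

theorem W2N_eq_of_decomposition {B : ℝ} {b : ℝ → ℕ → ℂ} {q : ℝ → ℂ} (hs : 0 ≤ s) {h : ℝ → ℂ}
    (hb : GoodFamily T B b)
    (hcoeff : ∀ t k, coeffW2 h t (k + 1) = b t k * ((((k : ℝ) + 1) ^ (-s) : ℝ) : ℂ) +
      q t * (1 / ((k : ℂ) + 1) ^ 3)) {t : ℝ} (ht : t ∈ Icc 0 T) :
    W2N h t = ∑' k, b t k • (((((k : ℝ) + 1) ^ (-s) : ℝ) : ℂ) • sinVec 0 k) +
      q t • contVec cubic contDiff_cubic.continuous := by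
  have h1 : Summable fun k => b t k • (((((k : ℝ) + 1) ^ (-s) : ℝ) : ℂ) • sinVec 0 k) := by
    refine ((admissible_sinPh_unit T 0).mul_left (norm_rpow_neg_le_one hs)).summable_smul
      (fun k => ?_) hb ht
    filter_upwards [Lp.coeFn_smul ((((k : ℝ) + 1) ^ (-s) : ℝ) : ℂ) (sinVec 0 k),
      coeFn_sinVec 0 k] with x h1 h2
    rw [h1, Pi.smul_apply, h2, smul_eq_mul]
  have h2 := hasSum_contVec_cubic.const_smul (q t)
  rw [W2N, ← (h1.hasSum.add h2).tsum_eq]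
  refine tsum_congr fun k => ?_
  rw [← sinVec_zero, hcoeff, add_smul, mul_smul, mul_smul]

theorem exists_bound_of_memHsZero (hT : 0 < T) (hs : s ∈ Icc (0 : ℝ) 4) : ∃ C : ℝ, 0 < C ∧
    ∀ h : ℝ → ℂ, MemHsZero ((1 + s) / 4) (Ioo 0 T) h →
      (L4HsNormLE s T (W2N h)
          (ENNReal.ofReal C * sobolevENorm ((1 + s) / 4) 2 (Ioo 0 T) h) ∧
        ContinuousHs s T (W2N h) ∧
        ∀ t ∈ Icc 0 T, sobolevENorm s 2 (Ioo 0 1) (W2N h t) ≤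
          ENNReal.ofReal C * sobolevENorm ((1 + s) / 4) 2 (Ioo 0 T) h) ∧
      (∀ m : ℕ, (m : ℝ) = s → ∃ V : ℝ → L2,
        (∀ t ∈ Icc 0 T, IsWeakDeriv m (W2N h t) (V t)) ∧
        ContinuousOn V (Icc 0 T) ∧
        L4NormLE T V (ENNReal.ofReal C * sobolevENorm ((1 + s) / 4) 2 (Ioo 0 T) h) ∧
        ∀ t ∈ Icc 0 T, ‖V t‖ₑ ≤
          ENNReal.ofReal C * sobolevENorm ((1 + s) / 4) 2 (Ioo 0 T) h) := by
  obtain ⟨hs0, hs4⟩ := hs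
  set f : 𝓢(ℝ, ℂ) := cutMul cubic contDiff_cubic
  obtain ⟨C₀, hC₀, hdec⟩ := exists_decomposition hT hs0 hs4
  obtain ⟨C₁, hC₁, hb₁⟩ := exists_l4HsNormLE_extCurve_add hT.le hs0 hs4 f
  obtain ⟨C₂, hC₂, hb₂⟩ := exists_sobolevENorm_extCurve_add_le hT.le hs0 hs4 f
  -- The order of differentiation is taken as the floor of s so that the constant is fixed before it
  -- is known whether s is an integer.
  obtain ⟨C₃, hC₃, hb₃⟩ := exists_weakDeriv_bound hT.le ⌊s⌋₊
  refine ⟨(C₁ + C₂ + C₃) * C₀, by positivity, fun h hh => ?_⟩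
  obtain ⟨B, b, M, q, hB, hb, hM, hq, hqM, hBM, hcoeff⟩ := hdec h hh
  have hW := fun t (ht : t ∈ Icc 0 T) => W2N_eq_of_decomposition hs0 hb hcoeff ht
  have hW' : ∀ t ∈ Icc 0 T, W2N h t = restrUnit (extCurve s b t + q t • f.toLp 2 volume) := by
    intro t ht
    rw [hW t ht, map_add, map_smul, restrUnit_extCurve hs0 hb ht, restrUnit_cutMul]
  have hle : ∀ C, 0 ≤ C → C ≤ C₁ + C₂ + C₃ → ENNReal.ofReal (C * (B + M)) ≤
      ENNReal.ofReal ((C₁ + C₂ + C₃) * C₀) * sobolevENorm ((1 + s) / 4) 2 (Ioo 0 T) h := by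
    intro C hC hCle
    rw [ENNReal.ofReal_mul hC, ENNReal.ofReal_mul (p := C₁ + C₂ + C₃) (by positivity), mul_assoc]
    exact mul_le_mul' (ENNReal.ofReal_le_ofReal hCle) hBM
  refine ⟨⟨?_, continuousHs_extCurve_add hT.le hs0 hs4 hb f hq hW', fun t ht => ?_⟩, ?_⟩
  · exact (hb₁ B b hB hb M q hM hqM _ hW').mono (hle C₁ hC₁.le (by linarith))
  · rw [hW' t ht]
    exact (hb₂ B b hB hb M q hM hqM t ht).trans (hle C₂ hC₂.le (by linarith))
  · intro m hm
    obtain rfl : ⌊s⌋₊ = m := by rw [← hm, Nat.floor_natCast]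
    have hWm : ∀ t ∈ Icc 0 T, W2N h t = ∑' k, b t k •
        (((((k : ℝ) + 1) ^ (-((⌊s⌋₊ : ℕ) : ℝ)) : ℝ) : ℂ) • sinVec 0 k) +
        q t • contVec cubic contDiff_cubic.continuous := by
      rw [hm]; exact hW
    obtain ⟨V, hV1, hV2, hV3, hV4⟩ := hb₃ B b hB hb M q hM hq hqM _ hWm
    have h3 := hle C₃ hC₃.le (by linarith)
    exact ⟨V, hV1, hV2, hV3.mono h3, fun t ht => (hV4 t ht).trans h3⟩

/-- The case s = 0 of the low range: the coefficients themselves form a good family, and mere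
membership in H^{1/4} is enough. -/
theorem exists_bound_of_memHs (hT : 0 < T) : ∃ C : ℝ, 0 < C ∧ ∀ h : ℝ → ℂ,
    MemHs (1 / 4) (Ioo 0 T) h →
      (∀ t ∈ Icc 0 T, Summable fun k : ℕ => coeffW2 h t (k + 1) • sinL2 (k + 1)) ∧
      ContinuousOn (W2N h) (Icc 0 T) ∧
      L4NormLE T (W2N h) (ENNReal.ofReal C * sobolevENorm (1 / 4) 2 (Ioo 0 T) h) ∧
      ∀ t ∈ Icc 0 T, ‖W2N h t‖ₑ ≤ ENNReal.ofReal C * sobolevENorm (1 / 4) 2 (Ioo 0 T) h := by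
  obtain ⟨C, hC, hfam⟩ := IsExtension.exists_goodFamily_low (s := 0) hT.le le_rfl (by norm_num)
  simp only [Real.rpow_zero, Complex.ofReal_one, one_mul, add_zero] at hfam
  refine ⟨2 * (3 * C), by positivity, fun h hh => ?_⟩
  obtain ⟨F, g, H, hg⟩ := exists_isExtension (by norm_num) hh
  have hb := hfam h F g H
  have hadm := admissible_sinPh_unit T 0
  have hW : W2N h = fun t => ∑' k, coeffW2 h t (k + 1) • sinVec 0 k := by
    simp only [sinVec_zero]
    rfl
  have hle := ofReal_mul_norm_le (C := 3 * C) (by positivity) hg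
  rw [mul_assoc] at hle
  refine ⟨fun t ht => ?_, ?_, ?_, fun t ht => ?_⟩
  · simp only [← sinVec_zero]
    exact hadm.summable_smul (coeFn_sinVec 0) hb ht
  · rw [hW]
    exact hadm.continuousOn_tsum (coeFn_sinVec 0) hb
  · rw [hW]
    exact (hadm.l4NormLE (coeFn_sinVec 0) hT.le (by positivity) hb).mono hle
  · rw [hW, ← ofReal_norm]
    exact (ENNReal.ofReal_le_ofReal (hadm.norm_tsum_le (coeFn_sinVec 0) hb ht)).trans hle

end Assembly

end NavierBoundary

end

theorem mainTheorem5 (T : ℝ) (hT : 0 < T) :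
    (∃ C : ℝ, 0 < C ∧ ∀ h : ℝ → ℂ, NavierBoundary.MemHs (1 / 4) (Ioo 0 T) h →
      (∀ t ∈ Icc 0 T, Summable fun k : ℕ =>
        NavierBoundary.coeffW2 h t (k + 1) • NavierBoundary.sinL2 (k + 1)) ∧
      ContinuousOn (NavierBoundary.W2N h) (Icc 0 T) ∧
      NavierBoundary.L4NormLE T (NavierBoundary.W2N h)
        (ENNReal.ofReal C * NavierBoundary.sobolevENorm (1 / 4) 2 (Ioo 0 T) h) ∧
      ∀ t ∈ Icc 0 T, ‖NavierBoundary.W2N h t‖ₑ ≤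
        ENNReal.ofReal C * NavierBoundary.sobolevENorm (1 / 4) 2 (Ioo 0 T) h) ∧
    (∀ s ∈ Icc (0 : ℝ) 4, ∃ C : ℝ, 0 < C ∧ ∀ h : ℝ → ℂ,
      NavierBoundary.MemHsZero ((1 + s) / 4) (Ioo 0 T) h →
      (NavierBoundary.L4HsNormLE s T (NavierBoundary.W2N h)
          (ENNReal.ofReal C * NavierBoundary.sobolevENorm ((1 + s) / 4) 2 (Ioo 0 T) h) ∧
        NavierBoundary.ContinuousHs s T (NavierBoundary.W2N h) ∧
        ∀ t ∈ Icc 0 T, NavierBoundary.sobolevENorm s 2 (Ioo 0 1) (NavierBoundary.W2N h t) ≤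
          ENNReal.ofReal C * NavierBoundary.sobolevENorm ((1 + s) / 4) 2 (Ioo 0 T) h) ∧
      (∀ m : ℕ, (m : ℝ) = s → ∃ V : ℝ → NavierBoundary.L2,
        (∀ t ∈ Icc 0 T, NavierBoundary.IsWeakDeriv m (NavierBoundary.W2N h t) (V t)) ∧
        ContinuousOn V (Icc 0 T) ∧
        NavierBoundary.L4NormLE T V
          (ENNReal.ofReal C * NavierBoundary.sobolevENorm ((1 + s) / 4) 2 (Ioo 0 T) h) ∧
        ∀ t ∈ Icc 0 T, ‖V t‖ₑ ≤
          ENNReal.ofReal C * NavierBoundary.sobolevENorm ((1 + s) / 4) 2 (Ioo 0 T) h)) :=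
  ⟨NavierBoundary.exists_bound_of_memHs hT, fun _ hs => NavierBoundary.exists_bound_of_memHsZero hT hs⟩
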